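/- Let $f:S^2\to S^2$ be a Thurston map, i.e. an orientation-preserving branched covering of degree $d\ge 2$ whose postcritical set $P=\bigcup_{n>0}f^{n}(\{\text{critical points}\})$ is finite, and suppose that $f$ has no periodic critical points. Let $G$ be the orbifold fundamental group of $f$: for a base point $b\in S^2\setminus P$ it is the quotient of $\pi_1(S^2\setminus P,b)$ by the normal subgroup generated by all $g^{\nu(p)}$, where $p\in P$, $g$ is represented by a peripheral loop about $p$, and $\nu(p)=\operatorname{lcm}\{\deg(f^n,x): f^n(x)=p\}$. *The selfsimilarity complex.* Defining data consist of a base point $b\in S^2\setminus P$, a finite set $X$ with a bijection $\Lambda:X\to f^{-1}(b)$, a path $\lambda_x$ in $S^2\setminus P$ from $b$ to $\Lambda(x)$ for each $x\in X$, a finite generating set $S$ of $G$, and a loop $\gamma_s$ in $S^2\setminus P$ based at $b$ representing $s$ for each $s\in S$. For words $w\in X^*$ put $\Lambda(\emptyset)=b$, and let $\Lambda(xw)$ be the endpoint of the lift of $\lambda_x$ under $f^{|w|}$ starting at $\Lambda(w)$; then $\Lambda$ maps $X^n$ bijectively onto $f^{-n}(b)$. For $s\in S$ and $|w|=n$, let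 $s.w\in X^n$ be the word such that the lift of $\gamma_s$ under $f^n$ starting at $\Lambda(w)$ ends at $\Lambda(s.w)$. The complex $\Sigma$ has vertex set $X^*$; for every $w$, $s$ and $x$ it has a horizontal edge labelled $s$ joining $w$ to $s.w$, and a vertical edge labelled $x$ joining $w$ to $xw$. The level of $w$ is $|w|$. Deleting the last letter of words (and keeping the labels of edges) defines a cellular map $f_\Sigma:\Sigma'\to\Sigma$, where $\Sigma'$ is the subcomplex spanned by the nonempty words. *The covering graph.* Let $\mathcal U_0$ be a finite cover of $S^2$ by open round balls, each containing at most one point of $P$, and only as its centre. Let $\mathcal U_n$ be the set of connected components of the sets $f^{-n}(U)$, $U\in\mathcal U_0$, and let $\mathcal U_{-1}=\{S^2\}$. The graph $\Gamma$ has one vertex of level $n$ for each element of $\mathcal U_n$, $n\ge-1$; two distinct vertices are joined by an edge if their levels differ by at most $1$ and the corresponding sets intersect. The rule $U\mapsto f(U)$ induces a cellular map $f_\Gamma:\Gamma'\to\Gamma$, where $\Gamma'$ is the subgraph spanned by the vertices of level $\ge1$. Both $\Sigma$ and $\Gamma$ carry the path metrics for which every edge has length $1$. **Theorem.** For every $\delta>0$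 there exist defining data for $\Sigma$, a cover $\mathcal U_0$ as above by balls of radius less than $\delta$, and a quasi-isometry $\Phi:\Sigma\to\Gamma$ such that 1. $\Phi$ is level-preserving: for every $n\ge0$ it maps the subcomplex of $\Sigma$ spanned by the vertices of level $n$ into the subgraph of $\Gamma$ spanned by the vertices of level $n$; 2. for every vertex $v$ of $\Sigma$, $\Phi(v)$ is a vertex of $\Gamma$, and $\Lambda(v)\in\Phi(v)$; 3. $\Phi(\Sigma')\subset\Gamma'$, and $\Phi\circ f_\Sigma=f_\Gamma\circ\Phi$ on $\Sigma'$. Here a function $\Phi$ between metric spaces is a quasi-isometry if there are $\lambda\ge1$ and $c,B\ge0$ such that $\frac1\lambda|x-x'|-c\le|\Phi(x)-\Phi(x')|\le\lambda|x-x'|+c$ for all $x,x'$, and every point of the target has distance at most $B$ from a point of the image. -/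

import Mathlib

open Set Filter Topology
open scoped unitInterval

noncomputable section

/-! ## Branched coverings of the two-sphere and Thurston maps -/

/-- The ambient Euclidean space `ℝ³`. -/
abbrev Space3 : Type := EuclideanSpace ℝ (Fin 3)

/-- The round two-sphere. -/
abbrev Sphere2 : Type := Metric.sphere (0 : Space3) 1

/-- `c` runs once around the round circle of angular radius `θ` about `x`, where `u`, `v` is an
orthonormal basis of the tangent plane at `x` (`c` is extended `2π`-periodically to `ℝ`). -/
def IsRoundCircle (x : Sphere2) (u v : Space3) (θ : ℝ) (c : ℝ → Sphere2) : Prop :=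
  Orthonormal ℝ ![(x : Space3), u, v] ∧
    ∀ t : ℝ, (c t : Space3) =
      Real.cos θ • (x : Space3) + Real.sin θ • (Real.cos t • u + Real.sin t • v)

/-- A chart `φ` of the sphere with values in `ℂ` is orientation preserving at `x`: small round
circles about `x`, run counterclockwise as seen from outside of the sphere, are mapped to loops
of winding number `1` about `φ x`.  The winding number is read off a continuous logarithm `L`. -/
def IsPositiveAt (φ : OpenPartialHomeomorph Sphere2 ℂ) (x : Sphere2) : Prop :=
  ∃ u v : Space3, (Matrix.of fun i j => (![(x : Space3), u, v] i) j).det = 1 ∧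
    ∀ᶠ θ in 𝓝[>] (0 : ℝ), ∃ c : ℝ → Sphere2, IsRoundCircle x u v θ c ∧
      ∃ L : ℝ → ℂ, Continuous L ∧ (∀ t, φ (c t) - φ x = Complex.exp (L t)) ∧
        L (2 * Real.pi) = L 0 + 2 * Real.pi * Complex.I

/-- An orientation-preserving branched covering of the sphere: a continuous map which near every
point is `z ↦ z ^ k` for some `k ≥ 1`, in orientation-preserving charts centred at the point
and at its image. -/
structure IsBranchedCovering (f : Sphere2 → Sphere2) : Prop where
  continuous : Continuous f
  local_model : ∀ x, ∃ (k : ℕ) (φ ψ : OpenPartialHomeomorph Sphere2 ℂ), k ≠ 0 ∧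
    x ∈ φ.source ∧ f x ∈ ψ.source ∧ φ x = 0 ∧ ψ (f x) = 0 ∧
    IsPositiveAt φ x ∧ IsPositiveAt ψ (f x) ∧
    MapsTo f φ.source ψ.source ∧ ∀ y ∈ φ.source, ψ (f y) = φ y ^ k

/-- The degree of a branched covering: the number of points of a generic (that is, largest)
fibre. -/
def mapDegree (f : Sphere2 → Sphere2) : ℕ∞ := ⨆ y, (f ⁻¹' {y}).encard

/-- The local degree of `g` at `x`: the least `k` such that on some neighbourhood of `x` the map
`g` is at most `k`-to-one. -/
def localDegree (g : Sphere2 → Sphere2) (x : Sphere2) : ℕ :=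
  sInf {k : ℕ | ∃ W ∈ 𝓝 x, ∀ y, (g ⁻¹' {y} ∩ W).encard ≤ k}

/-- The critical points (branch points) of `f`. -/
def criticalPoints (f : Sphere2 → Sphere2) : Set Sphere2 := {x | 1 < localDegree f x}

/-- The postcritical set: the union of the forward images `f^n`, `n > 0`, of the set of critical
points. -/
def postcriticalSet (f : Sphere2 → Sphere2) : Set Sphere2 :=
  ⋃ n : ℕ, f^[n + 1] '' criticalPoints f

/-- A Thurston map: an orientation-preserving branched covering of degree at least `2` whose
postcritical set is finite. -/
structure IsThurstonMap (f : Sphere2 → Sphere2) : Prop where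
  branched : IsBranchedCovering f
  degree : 2 ≤ mapDegree f
  finite : (postcriticalSet f).Finite

/-! ## The orbifold fundamental group -/

/-- The sphere minus the postcritical set. -/
abbrev PuncturedSphere (f : Sphere2 → Sphere2) : Type := {x : Sphere2 // x ∉ postcriticalSet f}

/-- The weight of `y`: the least common multiple of the local degrees of all iterates `f^n` at
the points of `f^{-n}(y)`, with the value `0` if there is no positive common multiple (infinite
weight). -/
def orbifoldWeight (f : Sphere2 → Sphere2) (y : Sphere2) : ℕ :=
  sInf {k : ℕ | 0 < k ∧ ∀ (n : ℕ) (x : Sphere2), f^[n] x = y → localDegree f^[n] x ∣ k}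

/-- The classes of peripheral loops about the puncture `p`: follow a path `δ` from the base point
to a round circle about `p` whose closed disc contains no other postcritical point, go around
the circle once, and return along `δ`. -/
def peripheralClasses (f : Sphere2 → Sphere2) (b : PuncturedSphere f) (p : Sphere2) :
    Set (FundamentalGroup (PuncturedSphere f) b) :=
  {g | ∃ (θ : ℝ) (u v : Space3) (c : ℝ → Sphere2), 0 < θ ∧ θ < Real.pi ∧
    IsRoundCircle p u v θ c ∧
    (∀ q ∈ postcriticalSet f, q ≠ p → inner ℝ (p : Space3) (q : Space3) < Real.cos θ) ∧
    ∃ (a : PuncturedSphere f) (δ : Path b a) (κ : Path a a),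
      (∀ t : I, (κ t : Sphere2) = c (2 * Real.pi * t)) ∧
      g = FundamentalGroup.fromPath
        (Path.Homotopic.Quotient.mk ((δ.trans κ).trans δ.symm))}

/-- The subgroup normally generated by the powers `g ^ ν(p)`, where `g` is peripheral about the
postcritical point `p` and `ν(p)` is the weight (nothing is added for infinite weight, since
then `g ^ 0 = 1`). -/
def orbifoldRelations (f : Sphere2 → Sphere2) (b : PuncturedSphere f) :
    Subgroup (FundamentalGroup (PuncturedSphere f) b) :=
  Subgroup.normalClosure
    {h | ∃ p ∈ postcriticalSet f, ∃ g ∈ peripheralClasses f b p, h = g ^ orbifoldWeight f p}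

instance (f : Sphere2 → Sphere2) (b : PuncturedSphere f) : (orbifoldRelations f b).Normal :=
  Subgroup.normalClosure_normal

/-- The orbifold fundamental group of the orbifold associated to `f`. -/
abbrev OrbifoldGroup (f : Sphere2 → Sphere2) (b : PuncturedSphere f) : Type :=
  FundamentalGroup (PuncturedSphere f) b ⧸ orbifoldRelations f b

/-- The element of the orbifold fundamental group represented by a loop. -/
def loopClass (f : Sphere2 → Sphere2) (b : PuncturedSphere f) (γ : Path b b) :
    OrbifoldGroup f b :=
  QuotientGroup.mk (FundamentalGroup.fromPath (Path.Homotopic.Quotient.mk γ))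

/-! ## One-complexes, their geometric realizations and quasi-isometries -/

/-- A one-complex (multiple edges and loops are allowed), given by its vertices, its oriented
edges, the initial vertex of an oriented edge and the reversal of orientation.  The terminal
vertex of `d` is `src (rev d)`. -/
structure OneComplex where
  V : Type
  D : Type
  src : D → V
  rev : D → D
  rev_rev : ∀ d, rev (rev d) = d
  rev_ne : ∀ d, rev d ≠ d

namespace OneComplex

variable (K : OneComplex)

/-- Interior points of edges as pairs (oriented edge, parameter in `(0, 1)`); the point with
parameter `t` on `d` is the point with parameter `1 - t` on the reversed edge. -/
def EdgeRel (p q : K.D × Ioo (0 : ℝ) 1) : Prop :=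
  q.1 = K.rev p.1 ∧ (q.2 : ℝ) = 1 - (p.2 : ℝ)

/-- The geometric realization: a point is a vertex or an interior point of an edge. -/
def Point : Type := K.V ⊕ Quot K.EdgeRel

variable {K}

/-- A vertex as a point of the realization. -/
def vertex (v : K.V) : K.Point := Sum.inl v

/-- The point with parameter `t` on the oriented edge `d`. -/
def edgePoint (d : K.D) (t : Ioo (0 : ℝ) 1) : K.Point := Sum.inr (Quot.mk _ (d, t))

/-- `p` lies on a closed edge with endpoint `a` at length `s` from that endpoint, or it is the
vertex `a` and `s = 0`. -/
def At (p : K.Point) (a : K.V) (s : ℝ) : Prop :=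
  (p = vertex a ∧ s = 0) ∨
    ∃ (d : K.D) (t : Ioo (0 : ℝ) 1), p = edgePoint d t ∧ K.src d = a ∧ s = t

variable (K) in
/-- The simple graph of adjacency of vertices. -/
def graph : SimpleGraph K.V :=
  SimpleGraph.fromRel fun a a' => ∃ d, K.src d = a ∧ K.src (K.rev d) = a'

/-- The path metric in which every edge has length one: a shortest path between two points
either runs inside one edge, or it leads from the first point to an end of its edge, from there
through vertices to an end of the edge of the second point, and then to that point. -/
def pointDist (p q : K.Point) : ℝ :=
  sInf ({r | ∃ (a a' : K.V) (s t : ℝ), At p a s ∧ At q a' t ∧ r = s + K.graph.dist a a' + t} ∪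
    {r | ∃ (d : K.D) (s t : Ioo (0 : ℝ) 1),
      p = edgePoint d s ∧ q = edgePoint d t ∧ r = |(s : ℝ) - t|})

variable (K) in
/-- The full subcomplex spanned by the vertices that satisfy `A`. -/
def full (A : K.V → Prop) : OneComplex where
  V := {v // A v}
  D := {d // A (K.src d) ∧ A (K.src (K.rev d))}
  src d := ⟨K.src d.1, d.2.1⟩
  rev d := ⟨K.rev d.1, d.2.2, by rw [K.rev_rev]; exact d.2.1⟩
  rev_rev d := Subtype.ext (K.rev_rev d.1)
  rev_ne d h := K.rev_ne d.1 (congrArg Subtype.val h)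

/-- A cellular map that sends vertices to vertices and each edge isometrically to an edge, in
terms of the cells. -/
structure CellMap (K L : OneComplex) where
  onV : K.V → L.V
  onD : K.D → L.D
  onD_rev : ∀ d, onD (K.rev d) = L.rev (onD d)

/-- The map of realizations defined by a cellular map. -/
def CellMap.map {K L : OneComplex} (F : CellMap K L) : K.Point → L.Point :=
  Sum.map F.onV (Quot.map (fun p => (F.onD p.1, p.2)) fun p _ h =>
    ⟨(congrArg F.onD h.1).trans (F.onD_rev p.1), h.2⟩)

variable (K) in
/-- The inclusion of a full subcomplex. -/
def incl (A : K.V → Prop) : CellMap (K.full A) K where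
  onV := Subtype.val
  onD := Subtype.val
  onD_rev _ := rfl

/-- Quasi-isometries between realizations of one-complexes. -/
def IsQuasiIsometry {K L : OneComplex} (Φ : K.Point → L.Point) : Prop :=
  ∃ A c B : ℝ, 1 ≤ A ∧ 0 ≤ c ∧ 0 ≤ B ∧
    (∀ p q, 1 / A * pointDist p q - c ≤ pointDist (Φ p) (Φ q) ∧
      pointDist (Φ p) (Φ q) ≤ A * pointDist p q + c) ∧
    ∀ y, ∃ p, pointDist y (Φ p) ≤ B

end OneComplex

/-! ## The selfsimilarity complex -/

/-- Defining data for the selfsimilarity complex: a base point `b` outside the postcritical set,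
a finite alphabet `X` in bijection with the fibre of `b`, for each letter a path outside the
postcritical set from `b` to the corresponding point of the fibre, a finite generating set `S`
of the orbifold fundamental group, and for each `s ∈ S` a loop outside the postcritical set
which represents `s`. -/
structure DefiningData (f : Sphere2 → Sphere2) where
  b : PuncturedSphere f
  X : Type
  finite_X : Finite X
  code : X ≃ f ⁻¹' {(b : Sphere2)}
  arc : (x : X) → Path (b : Sphere2) (code x : Sphere2)
  arc_notMem : ∀ x t, arc x t ∉ postcriticalSet f
  S : Set (OrbifoldGroup f b)
  finite_S : S.Finite
  generates : Subgroup.closure S = ⊤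
  loop : S → Path b b
  loop_class : ∀ s : S, loopClass f b (loop s) = s

open Classical in
/-- The endpoint of the lift under `g` of the path `η` that starts at `p` (by convention `p`
itself, if there is no lift). -/
def liftEnd (g : Sphere2 → Sphere2) (η : I → Sphere2) (p : Sphere2) : Sphere2 :=
  if h : ∃ ζ : C(I, Sphere2), ζ 0 = p ∧ ∀ t, g (ζ t) = η t then h.choose 1 else p

namespace DefiningData

variable {f : Sphere2 → Sphere2} (𝒟 : DefiningData f)

/-- The point `Λ(w)` of `f^{-n}(b)` coded by the word `w` of length `n`: `Λ(∅) = b`, and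
`Λ(xw)` is the endpoint of the lift under `f^{|w|}`, starting at `Λ(w)`, of the arc of `x`. -/
def Lam : List 𝒟.X → Sphere2
  | [] => 𝒟.b
  | x :: w => liftEnd f^[w.length] (𝒟.arc x) (Lam w)

open Classical in
/-- The action of a generator on words: `s.w` is the word of the same length as `w` such that the
lift under `f^{|w|}` of the loop of `s` starting at `Λ(w)` ends at `Λ(s.w)`. -/
def act (s : 𝒟.S) (w : List 𝒟.X) : List 𝒟.X :=
  if h : ∃ v : List 𝒟.X, v.length = w.length ∧
      𝒟.Lam v = liftEnd f^[w.length] (fun t => (𝒟.loop s t : Sphere2)) (𝒟.Lam w)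
  then h.choose else w

/-- The selfsimilarity complex: its vertices are the words; a horizontal edge labelled `s` joins
`w` to `s.w`, and a vertical edge labelled `x` joins `w` to `xw`.  (The Boolean is the
orientation of the edge.) -/
def complex : OneComplex where
  V := List 𝒟.X
  D := ((𝒟.S × List 𝒟.X) ⊕ (𝒟.X × List 𝒟.X)) × Bool
  src
    | (Sum.inl (_, w), true) => w
    | (Sum.inl (s, w), false) => 𝒟.act s w
    | (Sum.inr (_, w), true) => w
    | (Sum.inr (x, w), false) => x :: w
  rev d := (d.1, !d.2)
  rev_rev d := by simp
  rev_ne d h := by simpa using congrArg Prod.snd h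

/-- The level of a word is its length. -/
def level (w : 𝒟.complex.V) : ℤ := List.length (α := 𝒟.X) w

/-- The subcomplex determined by the nonempty words. -/
def complex' : OneComplex := 𝒟.complex.full fun w => 1 ≤ 𝒟.level w

/-- The map `f_Σ` induced by the right shift, which deletes the last letter of a word and keeps
the labels of the edges. -/
def shift : OneComplex.CellMap 𝒟.complex' 𝒟.complex where
  onV w := List.dropLast (α := 𝒟.X) w.1
  onD d := (Sum.map (Prod.map id List.dropLast) (Prod.map id List.dropLast) d.1.1, d.1.2)
  onD_rev _ := rfl

end DefiningData

/-! ## The covering graph -/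

/-- A finite cover of the sphere by open balls of radius less than `δ`, each of which contains at
most one point of `P`, and if it contains one then this is its centre. -/
structure BallCover (P : Set Sphere2) (δ : ℝ) where
  sets : Set (Set Sphere2)
  finite : sets.Finite
  covers : ⋃₀ sets = univ
  isBall : ∀ B ∈ sets, ∃ (c : Sphere2) (r : ℝ), 0 < r ∧ r < δ ∧ B = Metric.ball c r ∧
    ∀ p ∈ P, p ∈ B → p = c

/-- The cover at level `n`: the connected components of the sets `f^{-n}(U)`, where `U` runs
through the given cover. -/
def pullbackCover (f : Sphere2 → Sphere2) (𝒰 : Set (Set Sphere2)) (n : ℕ) : Set (Set Sphere2) :=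
  {C | ∃ U ∈ 𝒰, ∃ x ∈ f^[n] ⁻¹' U, C = connectedComponentIn (f^[n] ⁻¹' U) x}

/-- The vertices of the covering graph: the root, which stands for the whole sphere, and for each
`n ≥ 0` one vertex for each element of the cover at level `n`. -/
inductive CoverVertex (f : Sphere2 → Sphere2) (𝒰 : Set (Set Sphere2)) : Type
  | root : CoverVertex f 𝒰
  | piece (n : ℕ) (C : Set Sphere2) (hC : C ∈ pullbackCover f 𝒰 n) : CoverVertex f 𝒰

namespace CoverVertex

variable {f : Sphere2 → Sphere2} {𝒰 : Set (Set Sphere2)}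

/-- The subset of the sphere that corresponds to a vertex. -/
def carrier : CoverVertex f 𝒰 → Set Sphere2
  | root => univ
  | piece _ C _ => C

/-- The level of a vertex; the root has level `-1`. -/
def level : CoverVertex f 𝒰 → ℤ
  | root => -1
  | piece n _ _ => n

end CoverVertex

/-- The covering graph as a simple graph: distinct vertices whose levels are equal (horizontal
edges) or differ by one (vertical edges) are adjacent if their sets intersect. -/
def coverSimpleGraph (f : Sphere2 → Sphere2) (𝒰 : Set (Set Sphere2)) :
    SimpleGraph (CoverVertex f 𝒰) where
  Adj v w := v ≠ w ∧ |v.level - w.level| ≤ 1 ∧ (v.carrier ∩ w.carrier).Nonempty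
  symm := ⟨fun v w h => ⟨h.1.symm, by rw [abs_sub_comm]; exact h.2.1,
    by rw [inter_comm]; exact h.2.2⟩⟩
  loopless := ⟨fun _ h => h.1 rfl⟩

/-- The covering graph as a one-complex. -/
def coverComplex (f : Sphere2 → Sphere2) (𝒰 : Set (Set Sphere2)) : OneComplex where
  V := CoverVertex f 𝒰
  D := (coverSimpleGraph f 𝒰).Dart
  src d := d.fst
  rev d := d.symm
  rev_rev d := d.symm_symm
  rev_ne d := d.symm_ne

/-- The subgraph on the vertices at levels at least one. -/
def coverComplex' (f : Sphere2 → Sphere2) (𝒰 : Set (Set Sphere2)) : OneComplex :=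
  (coverComplex f 𝒰).full fun v => 1 ≤ CoverVertex.level v

instance : LocallyConnectedSpace Sphere2 :=
  haveI : Fact (Module.finrank ℝ Space3 = 2 + 1) := ⟨by simp⟩
  ChartedSpace.locallyConnectedSpace (EuclideanSpace ℝ (Fin 2)) Sphere2

/-- A branched covering is an open map. -/
theorem IsBranchedCovering.isOpenMap {f : Sphere2 → Sphere2} (hf : IsBranchedCovering f) :
    IsOpenMap f := by
  rw [isOpenMap_iff_nhds_le]
  intro x
  obtain ⟨k, φ, ψ, hk, hx, hfx, hφ, hψ, -, -, hm, he⟩ := hf.local_model x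
  have h1 : 𝓝 (0 : ℂ) ≤ map (fun z : ℂ => z ^ k) (𝓝 0) := by
    have ha : AnalyticAt ℂ (fun z : ℂ => z ^ k) 0 := by fun_prop
    rcases ha.eventually_constant_or_nhds_le_map_nhds with h | h
    · exfalso
      have h2 : ∀ᶠ z : ℂ in 𝓝[≠] 0, False := by
        filter_upwards [nhdsWithin_le_nhds h, self_mem_nhdsWithin] with z hz hz'
        rw [zero_pow hk] at hz
        exact hz' (pow_eq_zero_iff hk |>.1 hz)
      simp at h2
      exact (inferInstance : (𝓝[≠] (0 : ℂ)).NeBot).ne h2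
    · simpa [zero_pow hk] using h
  have h3 : map ψ.symm (𝓝 (0 : ℂ)) = 𝓝 (f x) := by
    have := ψ.symm.map_nhds_eq (ψ.map_source hfx)
    rw [hψ] at this
    rw [this, ← hψ, ψ.left_inv hfx]
  have h4 : map φ (𝓝 x) = 𝓝 (0 : ℂ) := by rw [φ.map_nhds_eq hx, hφ]
  calc 𝓝 (f x) = map ψ.symm (𝓝 (0 : ℂ)) := h3.symm
    _ ≤ map ψ.symm (map (fun z : ℂ => z ^ k) (map φ (𝓝 x))) := by
        rw [h4]; exact map_mono h1
    _ = map f (𝓝 x) := by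
        rw [map_map, map_map]
        apply Filter.map_congr
        filter_upwards [φ.open_source.mem_nhds hx] with y hy
        simp only [Function.comp_apply]
        rw [← he y hy, ψ.left_inv (hm hy)]

/-- A continuous open self-map of the sphere maps components of preimages onto components. -/
theorem image_component {f : Sphere2 → Sphere2} (hc : Continuous f) (ho : IsOpenMap f)
    {V : Set Sphere2} (hV : IsOpen V) {x : Sphere2} (hx : f x ∈ V) :
    f '' connectedComponentIn (f ⁻¹' V) x = connectedComponentIn V (f x) := by
  set W := connectedComponentIn V (f x) with hW
  set C := connectedComponentIn (f ⁻¹' V) x with hC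
  have hVo : IsOpen (f ⁻¹' V) := hV.preimage hc
  have hxC : x ∈ C := mem_connectedComponentIn hx
  have hsub : f '' C ⊆ W := by
    refine (isPreconnected_connectedComponentIn.image f hc.continuousOn).subset_connectedComponentIn
      ⟨x, hxC, rfl⟩ ?_
    rintro _ ⟨y, hy, rfl⟩
    have hy' : y ∈ f ⁻¹' V := connectedComponentIn_subset _ _ hy
    exact hy'
  refine hsub.antisymm ?_
  have hopen : IsOpen (f '' C) := ho _ hVo.connectedComponentIn
  refine (isPreconnected_connectedComponentIn (x := f x) (F := V)).subset_of_closure_inter_subset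
    hopen ⟨f x, mem_connectedComponentIn hx, x, hxC, rfl⟩ ?_
  rintro y ⟨hy, hyW⟩
  have hcl : closure (f '' C) ⊆ f '' closure C :=
    closure_minimal (image_mono subset_closure)
      (isClosed_closure.isCompact.image hc).isClosed
  obtain ⟨z, hz, rfl⟩ := hcl hy
  have hfz : f z ∈ V := connectedComponentIn_subset _ _ hyW
  have hzV : z ∈ f ⁻¹' V := hfz
  have hn : connectedComponentIn (f ⁻¹' V) z ∈ 𝓝 z :=
    hVo.connectedComponentIn.mem_nhds (mem_connectedComponentIn hzV)
  obtain ⟨w, hw, hwC⟩ := mem_closure_iff_nhds.1 hz _ hn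
  refine ⟨z, ?_, rfl⟩
  rw [hC, connectedComponentIn_eq hwC, ← connectedComponentIn_eq hw]
  exact mem_connectedComponentIn hzV

theorem BallCover.isOpen {P : Set Sphere2} {δ : ℝ} (𝒰 : BallCover P δ) {U : Set Sphere2}
    (hU : U ∈ 𝒰.sets) : IsOpen U := by
  obtain ⟨c, r, -, -, rfl, -⟩ := 𝒰.isBall U hU
  exact Metric.isOpen_ball

/-- The image of an element of the cover at level `n + 1` is an element of the cover at level `n`,
and the former is a component of the preimage of the latter. -/
theorem image_mem_pullbackCover {f : Sphere2 → Sphere2} (hf : IsBranchedCovering f)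
    {P : Set Sphere2} {δ : ℝ} (𝒰 : BallCover P δ) {n : ℕ} {C : Set Sphere2}
    (hC : C ∈ pullbackCover f 𝒰.sets (n + 1)) :
    f '' C ∈ pullbackCover f 𝒰.sets n ∧
      ∀ y ∈ C, C = connectedComponentIn (f ⁻¹' (f '' C)) y := by
  obtain ⟨U, hU, x, hx, rfl⟩ := hC
  have hx' : f x ∈ f^[n] ⁻¹' U := by simpa [Function.iterate_succ_apply] using hx
  have hpre : f^[n + 1] ⁻¹' U = f ⁻¹' (f^[n] ⁻¹' U) := by
    rw [Function.iterate_succ, preimage_comp]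
  have hVo : IsOpen (f^[n] ⁻¹' U) := (𝒰.isOpen hU).preimage (hf.continuous.iterate n)
  have himg := image_component hf.continuous hf.isOpenMap hVo hx'
  rw [← hpre] at himg
  refine ⟨⟨U, hU, f x, hx', himg⟩, fun y hy => ?_⟩
  apply Subset.antisymm
  · exact isPreconnected_connectedComponentIn.subset_connectedComponentIn hy
      (subset_preimage_image _ _)
  · conv_rhs => rw [connectedComponentIn_eq hy]
    apply connectedComponentIn_mono
    rw [himg, hpre]
    exact preimage_mono (connectedComponentIn_subset _ _)

/-- The map `U ↦ f(U)`, from level `n + 1` to level `n`, on vertices of the covering graph. (The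
values at levels `-1` and `0` are irrelevant.) -/
def coverImage {f : Sphere2 → Sphere2} (hf : IsBranchedCovering f) {P : Set Sphere2} {δ : ℝ}
    (𝒰 : BallCover P δ) : CoverVertex f 𝒰.sets → CoverVertex f 𝒰.sets
  | .piece (n + 1) C hC => .piece n (f '' C) (image_mem_pullbackCover hf 𝒰 hC).1
  | v => v

theorem coverImage_adj {f : Sphere2 → Sphere2} (hf : IsBranchedCovering f) {P : Set Sphere2}
    {δ : ℝ} (𝒰 : BallCover P δ) {v w : CoverVertex f 𝒰.sets}
    (h : (coverSimpleGraph f 𝒰.sets).Adj v w) (hv : 1 ≤ v.level) (hw : 1 ≤ w.level) :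
    (coverSimpleGraph f 𝒰.sets).Adj (coverImage hf 𝒰 v) (coverImage hf 𝒰 w) := by
  rcases v with _ | ⟨_ | n, C, hC⟩
  · simp [CoverVertex.level] at hv
  · simp [CoverVertex.level] at hv
  rcases w with _ | ⟨_ | m, E, hE⟩
  · simp [CoverVertex.level] at hw
  · simp [CoverVertex.level] at hw
  obtain ⟨hne, hl, y, hyC, hyE⟩ := h
  refine ⟨fun heq => hne ?_, by simpa [CoverVertex.level, coverImage] using hl,
    f y, ⟨y, hyC, rfl⟩, ⟨y, hyE, rfl⟩⟩
  simp only [coverImage, CoverVertex.piece.injEq] at heq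
  obtain ⟨rfl, him⟩ := heq
  have h1 := (image_mem_pullbackCover hf 𝒰 hC).2 y hyC
  have h2 := (image_mem_pullbackCover hf 𝒰 hE).2 y hyE
  have : C = E := by rw [h1, him]; exact h2.symm
  subst this
  rfl

/-- The map `f_Γ` induced by `f`, defined on the subgraph of the vertices at levels at least
one. -/
def coverShift {f : Sphere2 → Sphere2} (hf : IsBranchedCovering f) {P : Set Sphere2} {δ : ℝ}
    (𝒰 : BallCover P δ) :
    OneComplex.CellMap (coverComplex' f 𝒰.sets) (coverComplex f 𝒰.sets) where
  onV v := coverImage hf 𝒰 v.1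
  onD d := ⟨(coverImage hf 𝒰 d.1.fst, coverImage hf 𝒰 d.1.snd),
    coverImage_adj hf 𝒰 d.1.adj d.2.1 d.2.2⟩
  onD_rev _ := rfl

end

/-!
Write `P` for the postcritical set. Off `P` every iterate `f^n` is a covering
(`isCoveringMapOn_iterate`), so that classes of paths in the punctured sphere transport points of
the fibres of `f^n`, with `n` arbitrary (`Transport`). Words of length `n` are in bijection with
`f^{-n}(b)` by `Λ`, and the map `Φ` sends a word `w` of length `n` to the component of `f^{-n}(B)`
which contains `Λ(w)`, for one ball `B` of the cover which contains `b` (`toCover`). It sends the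
points of an open edge to the image of one end of the edge: quasi-isometries need not be continuous.
Since `f(Λ(w)) = Λ(w')`, where `w'` is `w` without its last letter, `Φ` commutes with the shift maps
(`coverImage_toCover`), and by `isQuasiIsometry_of_vertices` it is enough to compare distances of
vertices.

*Upper bound and coarse surjectivity.* A subdivision of a path subordinate to the cover at level
zero shows that its lifts under all the iterates cross a bounded number of elements of the covers
(`exists_dist_le_of_transport`). This applies to the finitely many loops and arcs of the defining
data, and to a path to `b` from a point of each ball.

*Lower bound.* The punctured sphere has a finite cover by spherically convex sets `V i`: balls
without postcritical points, and half balls. Paths inside `V i` with the same ends are homotopic, so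
that one may choose compatible classes of paths from `b` to the points of `V i` (`BasedCover`); a
point `y` with `f^n(y)` in `V i` is then coded by the word at whose point the lift of such a class
ending at `y` starts (`Codes`). A fixed element of the fundamental group moves words by a bounded
amount (`exists_wordDist_le`), because it is, up to the orbifold relations, a product of the given
generators, and the orbifold relations act trivially (`orbifoldRelations_le`). Hence words coding
the same point are at bounded distance, as there are finitely many transitions between the `V i`.
The main step, `exists_wordDist_le_of_codes_component`, is that words coding points of the same
component of `f^{-n}(U)` are at bounded distance: the component minus `f^{-n}(P)` is connected, so
that these words form a chain, and their number is bounded because the component has boundedly many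
sheets over `U` (`encard_component_le`). The bound on the sheets is where the absence of periodic
critical points enters: it bounds the local degrees of all iterates
(`exists_localDegree_iterate_le`). Together with a comparison of consecutive levels
(`exists_wordDist_le_of_codes_succ`) this makes the choice of a coding word for each vertex of the
covering graph a Lipschitz coarse inverse of `Φ` (`exists_wordDist_le_dist_toCover`).

*Over a puncture.* The number of sheets and the triviality of the orbifold relations both come from
`IsMercLift.exists_localDegree`: in Mercator coordinates a punctured round cap is a half plane, on
which `f^n` has an inverse branch `L`, and `L` is periodic with period `2πi` times the local degree
of `f^n` at a point over the puncture.

The same convex cover shows that the fundamental group of the punctured sphere is finitely generated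
(`BasedCover.closure_generators`), which provides the generating set of the defining data.
-/

/-! ### The round sphere: caps, stereographic and Mercator coordinates -/

instance : LocallyPathConnectedSpace Sphere2 :=
  haveI : Fact (Module.finrank ℝ Space3 = 2 + 1) := ⟨by simp⟩
  ChartedSpace.locallyPathConnectedSpace (EuclideanSpace ℝ (Fin 2)) Sphere2

instance : ConnectedSpace Sphere2 :=
  isConnected_iff_connectedSpace.1 (isConnected_sphere (by
    rw [← Module.finrank_eq_rank]; simp) 0 zero_le_one)

theorem Sphere2.norm_coe (x : Sphere2) : ‖(x : Space3)‖ = 1 := by simp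

theorem Sphere2.inner_self (x : Sphere2) : inner ℝ (x : Space3) (x : Space3) = 1 := by
  rw [real_inner_self_eq_norm_sq, x.norm_coe]; norm_num

instance : Nontrivial Sphere2 := by
  have e : (EuclideanSpace.single (0 : Fin 3) (1 : ℝ)) ∈ Metric.sphere (0 : Space3) 1 := by simp
  refine ⟨⟨⟨_, e⟩, -⟨_, e⟩, fun h => ?_⟩⟩
  have h1 := congrArg (fun x : Sphere2 => (x : Space3) 0) h
  norm_num at h1

/-- The open spherical cap of the points whose inner product with the pole `p` exceeds `a`. -/
def cap (p : Sphere2) (a : ℝ) : Set Sphere2 := {x | a < inner ℝ (p : Space3) (x : Space3)}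

theorem mem_cap {p : Sphere2} {a : ℝ} {x : Sphere2} :
    x ∈ cap p a ↔ a < inner ℝ (p : Space3) (x : Space3) := Iff.rfl

theorem isOpen_cap (p : Sphere2) (a : ℝ) : IsOpen (cap p a) :=
  isOpen_lt continuous_const (by fun_prop)

theorem pole_mem_cap {p : Sphere2} {a : ℝ} (ha : a < 1) : p ∈ cap p a := by
  rw [mem_cap, p.inner_self]; exact ha

theorem ball_eq_cap (p : Sphere2) {r : ℝ} (hr : 0 < r) :
    Metric.ball p r = cap p (1 - r ^ 2 / 2) := by
  ext x
  rw [Metric.mem_ball, mem_cap, Subtype.dist_eq, dist_eq_norm, ← sq_lt_sq₀ (norm_nonneg _) hr.le,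
    @norm_sub_sq_real, x.norm_coe, p.norm_coe, real_inner_comm]
  constructor <;> intro h <;> linarith

/-- Every neighbourhood of `p` contains a small cap with pole `p`. -/
theorem exists_cap_subset {p : Sphere2} {W : Set Sphere2} (hW : W ∈ 𝓝 p) {a : ℝ} (ha : a < 1) :
    ∃ a', a ≤ a' ∧ a' < 1 ∧ cap p a' ⊆ W := by
  obtain ⟨r, hr, hrW⟩ := Metric.mem_nhds_iff.1 hW
  refine ⟨max a (1 - r ^ 2 / 2), le_max_left _ _, max_lt ha (by nlinarith [sq_pos_of_pos hr]), ?_⟩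
  refine Subset.trans ?_ hrW
  rw [ball_eq_cap p hr]
  exact fun x hx => (le_max_right _ _).trans_lt (mem_cap.1 hx)

theorem inner_eq_one_iff {p x : Sphere2} : inner ℝ (p : Space3) (x : Space3) = 1 ↔ x = p := by
  rw [inner_eq_one_iff_of_norm_eq_one p.norm_coe x.norm_coe, Subtype.coe_inj, eq_comm]

/-- An orthonormal basis of the tangent plane at `p`. -/
structure TangentFrame (p : Sphere2) where
  /-- The first tangent vector. -/
  u : Space3
  /-- The second tangent vector. -/
  v : Space3
  orthonormal : Orthonormal ℝ ![(p : Space3), u, v]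

instance (p : Sphere2) : Nonempty (TangentFrame p) := by
  have h : Orthonormal ℝ (({0} : Set (Fin 3)).domRestrict ![(p : Space3), 0, 0]) := by
    constructor
    · rintro ⟨i, hi⟩
      obtain rfl : i = 0 := hi
      exact p.norm_coe
    · rintro ⟨i, hi⟩ ⟨j, hj⟩ hij
      exact absurd (Subtype.ext ((show i = 0 from hi).trans (show j = 0 from hj).symm)) hij
  obtain ⟨B, hB⟩ := h.exists_orthonormalBasis_extension_of_card_eq (by simp)
  refine ⟨⟨B 1, B 2, ?_⟩⟩
  have h0 : B 0 = (p : Space3) := hB 0 rfl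
  have : ![(p : Space3), B 1, B 2] = B := by
    funext i; fin_cases i <;> simp [h0]
  rw [this]; exact B.orthonormal

namespace TangentFrame

variable {p : Sphere2} (F : TangentFrame p)

theorem inner_pu : inner ℝ (p : Space3) F.u = 0 := F.orthonormal.2 (show (0 : Fin 3) ≠ 1 by decide)
theorem inner_pv : inner ℝ (p : Space3) F.v = 0 := F.orthonormal.2 (show (0 : Fin 3) ≠ 2 by decide)
theorem inner_uv : inner ℝ F.u F.v = 0 := F.orthonormal.2 (show (1 : Fin 3) ≠ 2 by decide)
theorem inner_uu : inner ℝ F.u F.u = 1 := by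
  rw [real_inner_self_eq_norm_sq, show ‖F.u‖ = 1 from F.orthonormal.1 1]; norm_num
theorem inner_vv : inner ℝ F.v F.v = 1 := by
  rw [real_inner_self_eq_norm_sq, show ‖F.v‖ = 1 from F.orthonormal.1 2]; norm_num

theorem expand (x : Space3) : x = inner ℝ (p : Space3) x • (p : Space3) + inner ℝ F.u x • F.u +
    inner ℝ F.v x • F.v := by
  have hs := F.orthonormal.linearIndependent.span_eq_top_of_card_eq_finrank' (by simp)
  have := (OrthonormalBasis.mk F.orthonormal hs.ge).sum_repr x
  simp only [OrthonormalBasis.repr_apply_apply, OrthonormalBasis.coe_mk, Fin.sum_univ_three] at this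
  exact this.symm

theorem norm_sq_comb (a b c : ℝ) : ‖a • (p : Space3) + b • F.u + c • F.v‖ ^ 2 =
    a ^ 2 + b ^ 2 + c ^ 2 := by
  rw [← real_inner_self_eq_norm_sq]
  simp only [inner_add_left, inner_add_right, real_inner_smul_left, real_inner_smul_right,
    F.inner_uu, F.inner_vv, F.inner_pu, F.inner_pv, F.inner_uv, p.inner_self,
    real_inner_comm (p : Space3) F.u, real_inner_comm (p : Space3) F.v, real_inner_comm F.u F.v]
  ring

theorem sum_sq (x : Sphere2) : inner ℝ (p : Space3) (x : Space3) ^ 2 +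
    inner ℝ F.u (x : Space3) ^ 2 + inner ℝ F.v (x : Space3) ^ 2 = 1 := by
  rw [← F.norm_sq_comb, ← F.expand, x.norm_coe]; norm_num

theorem inner_p_comb (a b c : ℝ) :
    inner ℝ (p : Space3) (a • (p : Space3) + b • F.u + c • F.v) = a := by
  simp [inner_add_right, real_inner_smul_right, F.inner_pu, F.inner_pv]

theorem inner_u_comb (a b c : ℝ) : inner ℝ F.u (a • (p : Space3) + b • F.u + c • F.v) = b := by
  rw [inner_add_right, inner_add_right, real_inner_smul_right, real_inner_smul_right,
    real_inner_smul_right, F.inner_uu, F.inner_uv, real_inner_comm, F.inner_pu]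
  ring

theorem inner_v_comb (a b c : ℝ) : inner ℝ F.v (a • (p : Space3) + b • F.u + c • F.v) = c := by
  rw [inner_add_right, inner_add_right, real_inner_smul_right, real_inner_smul_right,
    real_inner_smul_right, F.inner_vv, real_inner_comm, F.inner_pv, real_inner_comm, F.inner_uv]
  ring

/-- Inverse stereographic projection from the antipode of `p`; the origin is mapped to `p`. -/
noncomputable def point (z : ℂ) : Sphere2 :=
  ⟨((1 - ‖z‖ ^ 2) / (1 + ‖z‖ ^ 2)) • (p : Space3) + (2 * z.re / (1 + ‖z‖ ^ 2)) • F.u +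
    (2 * z.im / (1 + ‖z‖ ^ 2)) • F.v, by
    rw [mem_sphere_zero_iff_norm, ← sq_eq_sq₀ (norm_nonneg _) zero_le_one, F.norm_sq_comb]
    have h : (1 + ‖z‖ ^ 2) ≠ 0 := by positivity
    have h2 : ‖z‖ ^ 2 = z.re ^ 2 + z.im ^ 2 := by rw [Complex.sq_norm, Complex.normSq_apply]; ring
    field_simp
    rw [h2]; ring⟩

/-- Stereographic projection from the antipode of `p`. -/
noncomputable def coord (x : Sphere2) : ℂ :=
  ⟨inner ℝ F.u (x : Space3) / (1 + inner ℝ (p : Space3) (x : Space3)),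
    inner ℝ F.v (x : Space3) / (1 + inner ℝ (p : Space3) (x : Space3))⟩

theorem continuous_point : Continuous F.point := by
  refine Continuous.subtype_mk ?_ _
  have h : ∀ z : ℂ, (1 + ‖z‖ ^ 2) ≠ 0 := fun z => by positivity
  have h1 : Continuous fun z : ℂ => ‖z‖ := continuous_norm
  refine (((Continuous.div (by fun_prop) (by fun_prop) h).smul continuous_const).add
    ((Continuous.div ?_ (by fun_prop) h).smul continuous_const)).add
    ((Continuous.div ?_ (by fun_prop) h).smul continuous_const)
  · exact continuous_const.mul Complex.continuous_re
  · exact continuous_const.mul Complex.continuous_im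

theorem inner_point (z : ℂ) :
    inner ℝ (p : Space3) (F.point z : Space3) = (1 - ‖z‖ ^ 2) / (1 + ‖z‖ ^ 2) :=
  F.inner_p_comb _ _ _

theorem coord_point (z : ℂ) : F.coord (F.point z) = z := by
  have h : (1 + ‖z‖ ^ 2) ≠ 0 := by positivity
  have h1 : 1 + (1 - ‖z‖ ^ 2) / (1 + ‖z‖ ^ 2) = 2 / (1 + ‖z‖ ^ 2) := by field_simp; ring
  apply Complex.ext
  · simp only [coord, point, F.inner_p_comb, F.inner_u_comb]
    rw [h1]; field_simp
  · simp only [coord, point, F.inner_p_comb, F.inner_v_comb]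
    rw [h1]; field_simp

theorem norm_coord_sq {x : Sphere2} (hx : inner ℝ (p : Space3) (x : Space3) ≠ -1) :
    ‖F.coord x‖ ^ 2 = (1 - inner ℝ (p : Space3) (x : Space3)) /
      (1 + inner ℝ (p : Space3) (x : Space3)) := by
  have h : 1 + inner ℝ (p : Space3) (x : Space3) ≠ 0 := fun h => hx (by linarith)
  rw [Complex.sq_norm, Complex.normSq_apply, coord]
  field_simp
  nlinarith [F.sum_sq x]

theorem point_coord {x : Sphere2} (hx : inner ℝ (p : Space3) (x : Space3) ≠ -1) :
    F.point (F.coord x) = x := by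
  have h : 1 + inner ℝ (p : Space3) (x : Space3) ≠ 0 := fun h => hx (by linarith)
  have h1 : 1 + ‖F.coord x‖ ^ 2 = 2 / (1 + inner ℝ (p : Space3) (x : Space3)) := by
    rw [F.norm_coord_sq hx]; field_simp; ring
  have h2 : 1 - ‖F.coord x‖ ^ 2 = 2 * inner ℝ (p : Space3) (x : Space3) /
      (1 + inner ℝ (p : Space3) (x : Space3)) := by
    rw [F.norm_coord_sq hx]; field_simp; ring
  apply Subtype.ext
  conv_rhs => rw [F.expand (x : Space3)]
  simp only [point, h1, h2]
  simp only [coord]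
  congr 1
  · congr 1
    · congr 1; field_simp
    · congr 1; field_simp
  · congr 1; field_simp

theorem coord_eq_zero {x : Sphere2} (hx : inner ℝ (p : Space3) (x : Space3) ≠ -1) :
    F.coord x = 0 ↔ x = p := by
  have h : 1 + inner ℝ (p : Space3) (x : Space3) ≠ 0 := fun h => hx (by linarith)
  rw [← norm_eq_zero, ← sq_eq_zero_iff, F.norm_coord_sq hx, div_eq_zero_iff, or_iff_left h,
    sub_eq_zero, eq_comm, inner_eq_one_iff]

/-- Mercator coordinates on the sphere without the points `p` and `-p`: the composition of the
exponential map with inverse stereographic projection.  The real part tends to `-∞` at `p`. -/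
noncomputable def merc (ω : ℂ) : Sphere2 := F.point (Complex.exp ω)

theorem continuous_merc : Continuous F.merc := F.continuous_point.comp Complex.continuous_exp

theorem merc_eq_iff {ω ω' : ℂ} :
    F.merc ω = F.merc ω' ↔ ∃ n : ℤ, ω = ω' + n * (2 * Real.pi * Complex.I) := by
  rw [← Complex.exp_eq_exp_iff_exists_int]
  refine ⟨fun h => ?_, fun h => by rw [merc, merc, h]⟩
  rw [← F.coord_point (Complex.exp ω), ← F.coord_point (Complex.exp ω')]
  exact congrArg F.coord h

theorem merc_ne (ω : ℂ) : F.merc ω ≠ p := by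
  intro h
  have h1 := inner_eq_one_iff.2 h
  rw [merc, F.inner_point] at h1
  have h2 : (1 + ‖Complex.exp ω‖ ^ 2) ≠ 0 := by positivity
  rw [div_eq_one_iff_eq h2] at h1
  have h3 : ‖Complex.exp ω‖ = 0 := by nlinarith [norm_nonneg (Complex.exp ω)]
  simp at h3

/-- The cap `cap p a` without `p` is the half plane of the points with real part less than
`capWidth a` in Mercator coordinates. -/
noncomputable def _root_.capWidth (a : ℝ) : ℝ := Real.log ((1 - a) / (1 + a)) / 2

theorem merc_mem_cap {a : ℝ} (ha : -1 < a) (ha' : a < 1) {ω : ℂ} :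
    F.merc ω ∈ cap p a ↔ ω.re < capWidth a := by
  rw [mem_cap, merc, F.inner_point, Complex.norm_exp, capWidth, lt_div_iff₀ (by positivity),
    lt_div_iff₀ (by norm_num), Real.lt_log_iff_exp_lt (div_pos (by linarith) (by linarith)),
    lt_div_iff₀ (by linarith), mul_comm, mul_two ω.re, Real.exp_add, ← sq]
  constructor <;> intro h <;> linarith

theorem inner_ne_of_mem_cap {a : ℝ} (ha : -1 < a) {x : Sphere2} (hx : x ∈ cap p a) :
    inner ℝ (p : Space3) (x : Space3) ≠ -1 := (ha.trans hx).ne'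

theorem exists_merc_eq {x : Sphere2} (hx : inner ℝ (p : Space3) (x : Space3) ≠ -1) (hx' : x ≠ p) :
    ∃ ω, F.merc ω = x :=
  ⟨Complex.log (F.coord x), by
    rw [merc, Complex.exp_log (mt (F.coord_eq_zero hx).1 hx'), F.point_coord hx]⟩

/-- Paths that avoid `p` and `-p` lift to Mercator coordinates. -/
theorem exists_lift_merc (η : C(I, Sphere2)) (h : ∀ t, inner ℝ (p : Space3) (η t : Space3) ≠ -1)
    (h' : ∀ t, η t ≠ p) {ω : ℂ} (hω : F.merc ω = η 0) :
    ∃ α : C(I, ℂ), α 0 = ω ∧ ∀ t, F.merc (α t) = η t := by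
  have hc : Continuous fun t => F.coord (η t) := by
    have h1 : ∀ t, 1 + inner ℝ (p : Space3) (η t : Space3) ≠ 0 := fun t ht => h t (by linarith)
    have : (fun t => F.coord (η t)) = fun t =>
        ((inner ℝ F.u (η t : Space3) / (1 + inner ℝ (p : Space3) (η t : Space3)) : ℝ) : ℂ) +
        ((inner ℝ F.v (η t : Space3) / (1 + inner ℝ (p : Space3) (η t : Space3)) : ℝ) : ℂ) *
          Complex.I := by
      funext t
      apply Complex.ext <;> simp [coord, -Complex.ofReal_div]
    rw [this]
    refine Continuous.add (Complex.continuous_ofReal.comp ?_)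
      ((Complex.continuous_ofReal.comp ?_).mul continuous_const)
    · exact Continuous.div (by fun_prop) (by fun_prop) h1
    · exact Continuous.div (by fun_prop) (by fun_prop) h1
  let β : C(I, {z : ℂ // z ≠ 0}) :=
    ⟨fun t => ⟨F.coord (η t), mt (F.coord_eq_zero (h t)).1 (h' t)⟩, hc.subtype_mk _⟩
  have hβ : β 0 = ⟨_, ω.exp_ne_zero⟩ := by
    apply Subtype.ext
    change F.coord (η 0) = Complex.exp ω
    rw [← hω, merc, F.coord_point]
  obtain ⟨α, hα, hα0⟩ := Complex.isCoveringMap_exp.exists_path_lifts β ω hβ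
  refine ⟨α, hα0, fun t => ?_⟩
  have := congrArg Subtype.val (congrFun hα t)
  change Complex.exp (α t) = F.coord (η t) at this
  rw [merc, this, F.point_coord (h t)]

theorem image_merc_halfPlane {a : ℝ} (ha : -1 < a) (ha' : a < 1) :
    F.merc '' {ω | ω.re < capWidth a} = cap p a \ {p} := by
  ext x
  constructor
  · rintro ⟨ω, hω, rfl⟩
    exact ⟨(F.merc_mem_cap ha ha').2 hω, F.merc_ne ω⟩
  · rintro ⟨hx, hx'⟩
    obtain ⟨ω, rfl⟩ := F.exists_merc_eq (inner_ne_of_mem_cap ha hx) hx'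
    exact ⟨ω, (F.merc_mem_cap ha ha').1 hx, rfl⟩

end TangentFrame

theorem isPreconnected_halfPlane (c : ℝ) : IsPreconnected {ω : ℂ | ω.re < c} :=
  (convex_halfSpace_re_lt c).isPreconnected

theorem nonempty_halfPlane (c : ℝ) : {ω : ℂ | ω.re < c}.Nonempty := ⟨(c - 1 : ℝ), by simp⟩

theorem isConnected_cap_diff {p : Sphere2} {a : ℝ} (ha : -1 < a) (ha' : a < 1) :
    IsConnected (cap p a \ {p}) := by
  obtain ⟨F⟩ : Nonempty (TangentFrame p) := inferInstance
  rw [← F.image_merc_halfPlane ha ha']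
  exact ⟨(nonempty_halfPlane _).image _,
    (isPreconnected_halfPlane _).image _ F.continuous_merc.continuousOn⟩

theorem isConnected_cap {p : Sphere2} {a : ℝ} (ha : -1 < a) (ha' : a < 1) :
    IsConnected (cap p a) := by
  refine (isConnected_cap_diff ha ha').subset_closure sdiff_subset ?_
  intro x hx
  by_cases hxp : x = p
  · subst hxp
    rw [mem_closure_iff_nhdsWithin_neBot, sdiff_eq, inter_comm,
      nhdsWithin_inter_of_mem']
    · infer_instance
    · exact mem_nhdsWithin_of_mem_nhds ((isOpen_cap x a).mem_nhds hx)
  · exact subset_closure ⟨hx, hxp⟩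

/-- Removing a point from a connected open subset of the sphere leaves a connected set. -/
theorem IsPreconnected.diff_singleton_sphere {U : Set Sphere2} (hU : IsPreconnected U)
    (hUo : IsOpen U) (x : Sphere2) : IsPreconnected (U \ {x}) := by
  by_cases hx : x ∈ U
  swap
  · rwa [sdiff_singleton_eq_self hx]
  obtain ⟨a, ha, ha', hc⟩ := exists_cap_subset (hUo.mem_nhds hx) (zero_lt_one (α := ℝ))
  have hconn := (isConnected_cap_diff (p := x) (neg_one_lt_zero.trans_le ha) ha')
  have hsub : cap x a \ {x} ⊆ U \ {x} := sdiff_subset_sdiff_left hc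
  have hUo' : IsOpen (U \ {x}) := hUo.sdiff isClosed_singleton
  -- a clopen piece of `U \ {x}` which contains the punctured cap about `x` can be filled in at `x`
  have key : ∀ A B : Set Sphere2, IsOpen A → IsOpen B → U \ {x} ⊆ A ∪ B →
      ((U \ {x}) ∩ B).Nonempty → cap x a \ {x} ⊆ A → ((U \ {x}) ∩ (A ∩ B)).Nonempty := by
    intro A B hA hB hAB hBn hcA
    obtain ⟨y, hyU, hy⟩ := hU (((U \ {x}) ∩ A) ∪ cap x a) ((U \ {x}) ∩ B)
      ((hUo'.inter hA).union (isOpen_cap x a)) (hUo'.inter hB) (fun y hy => by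
        by_cases hyx : y = x
        · subst hyx; exact Or.inl (Or.inr (pole_mem_cap ha'))
        · rcases hAB ⟨hy, hyx⟩ with h | h
          · exact Or.inl (Or.inl ⟨⟨hy, hyx⟩, h⟩)
          · exact Or.inr ⟨⟨hy, hyx⟩, h⟩)
      ⟨x, hx, Or.inr (pole_mem_cap ha')⟩ (hBn.imp fun z hz => ⟨hz.1.1, hz⟩)
    refine ⟨y, hy.2.1, ?_, hy.2.2⟩
    rcases hy.1 with h | h
    · exact h.2
    · exact hcA ⟨h, hy.2.1.2⟩
  by_contra hnot
  simp only [IsPreconnected, not_forall] at hnot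
  obtain ⟨A, B, hA, hB, hAB, hAn, hBn, hne⟩ := hnot
  by_cases h1 : ((cap x a \ {x}) ∩ A).Nonempty
  · by_cases h2 : ((cap x a \ {x}) ∩ B).Nonempty
    · obtain ⟨y, hy, hy'⟩ := hconn.isPreconnected A B hA hB (hsub.trans hAB) h1 h2
      exact hne ⟨y, hsub hy, hy'⟩
    · refine hne (key A B hA hB hAB hBn fun y hy => ?_)
      exact (hAB (hsub hy)).resolve_right fun h => h2 ⟨y, hy, h⟩
  · rw [inter_comm A B] at hne
    refine hne (key B A hB hA (by rwa [union_comm]) hAn fun y hy => ?_)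
    exact (hAB (hsub hy)).resolve_left fun h => h1 ⟨y, hy, h⟩

theorem IsPreconnected.diff_finite_sphere {U : Set Sphere2} (hU : IsPreconnected U)
    (hUo : IsOpen U) {s : Set Sphere2} (hs : s.Finite) : IsPreconnected (U \ s) := by
  induction s, hs using Set.Finite.induction_on with
  | empty => simpa
  | @insert a s _ hs ih =>
    rw [show insert a s = s ∪ {a} by rw [union_comm]; rfl, ← sdiff_sdiff]
    exact ih.diff_singleton_sphere (hUo.sdiff hs.isClosed) a

/-- A nonempty open subset of the sphere is not contained in a finite set. -/
theorem IsOpen.exists_notMem_finite {U : Set Sphere2} (hU : IsOpen U) (hn : U.Nonempty)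
    {s : Set Sphere2} (hs : s.Finite) : ∃ x ∈ U, x ∉ s := by
  obtain ⟨x, hx⟩ := hn
  have h : (𝓝[≠] x).NeBot := inferInstance
  by_contra! hsub
  have : U ∩ {x}ᶜ ∈ 𝓝[≠] x := inter_mem (mem_nhdsWithin_of_mem_nhds (hU.mem_nhds hx))
    self_mem_nhdsWithin
  have hfin : (s \ {x})ᶜ ∈ 𝓝[≠] x :=
    mem_nhdsWithin_of_mem_nhds ((hs.sdiff.isClosed.isOpen_compl).mem_nhds (by simp))
  obtain ⟨y, hy1, hy2⟩ := h.nonempty_of_mem (inter_mem this hfin)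
  exact hy2 ⟨hsub y hy1.1, hy1.2⟩

/-! ### Spherically convex sets -/

/-- The trace on the sphere of a convex cone (without apex); such sets are spherically convex. -/
def IsConvexTrace (V : Set Sphere2) : Prop :=
  ∃ K : Set Space3, Convex ℝ K ∧ (0 : Space3) ∉ K ∧ (∀ x ∈ K, ∀ t : ℝ, 0 < t → t • x ∈ K) ∧
    V = {x : Sphere2 | (x : Space3) ∈ K}

theorem IsConvexTrace.inter {V W : Set Sphere2} (hV : IsConvexTrace V) (hW : IsConvexTrace W) :
    IsConvexTrace (V ∩ W) := by
  obtain ⟨K, h1, h2, h3, rfl⟩ := hV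
  obtain ⟨L, k1, k2, k3, rfl⟩ := hW
  exact ⟨K ∩ L, h1.inter k1, fun h => h2 h.1, fun x hx t ht => ⟨h3 x hx.1 t ht, k3 x hx.2 t ht⟩,
    rfl⟩

theorem isConvexTrace_cap (p : Sphere2) {a : ℝ} (ha : 0 ≤ a) : IsConvexTrace (cap p a) := by
  refine ⟨{x | a * ‖x‖ < inner ℝ (p : Space3) x}, ?_, by simp, ?_, ?_⟩
  · intro x hx y hy s t hs ht hst
    simp only [mem_ofPred_eq, inner_add_right, real_inner_smul_right] at *
    have h1 : ‖s • x + t • y‖ ≤ s * ‖x‖ + t * ‖y‖ := by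
      refine (norm_add_le _ _).trans_eq ?_
      rw [norm_smul, norm_smul, Real.norm_of_nonneg hs, Real.norm_of_nonneg ht]
    have h2 := mul_le_mul_of_nonneg_left h1 ha
    rcases hs.eq_or_lt with rfl | hs
    · have : t = 1 := by linarith
      subst this; nlinarith
    · nlinarith [mul_lt_mul_of_pos_left hx hs, mul_le_mul_of_nonneg_left hy.le ht]
  · intro x hx t ht
    simp only [mem_ofPred_eq, real_inner_smul_right, norm_smul, Real.norm_of_nonneg ht.le] at *
    nlinarith [mul_lt_mul_of_pos_left hx ht]
  · ext x
    simp [mem_cap]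

theorem isConvexTrace_halfSpace (w : Space3) :
    IsConvexTrace {x : Sphere2 | 0 < inner ℝ w (x : Space3)} := by
  refine ⟨{x | 0 < inner ℝ w x}, ?_, by simp, fun x hx t ht => ?_, rfl⟩
  · exact convex_halfSpace_gt (innerₛₗ ℝ w).isLinear 0
  · simp only [mem_ofPred_eq, real_inner_smul_right] at *
    positivity

/-- The normalized linear homotopy inside a convex trace. -/
theorem IsConvexTrace.exists_homotopy {V : Set Sphere2} (hV : IsConvexTrace V)
    (η η' : C(I, Sphere2)) (hη : ∀ t, η t ∈ V) (hη' : ∀ t, η' t ∈ V) :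
    ∃ H : C(I × I, Sphere2), (∀ x, H x ∈ V) ∧ (∀ t, H (0, t) = η t) ∧ (∀ t, H (1, t) = η' t) ∧
      ∀ s t, η t = η' t → H (s, t) = η t := by
  obtain ⟨K, h1, h2, h3, rfl⟩ := hV
  let L : I × I → Space3 := fun x => (1 - (x.1 : ℝ)) • (η x.2 : Space3) + (x.1 : ℝ) • (η' x.2 : Space3)
  have hL : ∀ x, L x ∈ K := fun x => h1 (hη x.2) (hη' x.2) (by linarith [x.1.2.2]) x.1.2.1 (by ring)
  have hLn : ∀ x, 0 < ‖L x‖ := fun x => norm_pos_iff.2 fun h => h2 (h ▸ hL x)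
  have hLc : Continuous L := by fun_prop
  have hLs : ∀ x, ‖L x‖⁻¹ • L x ∈ Metric.sphere (0 : Space3) 1 := fun x => by
    rw [mem_sphere_zero_iff_norm, norm_smul, norm_inv, norm_norm, inv_mul_cancel₀ (hLn x).ne']
  have hLc' : Continuous fun x => ‖L x‖⁻¹ • L x := (hLc.norm.inv₀ fun x => (hLn x).ne').smul hLc
  let H : C(I × I, Sphere2) := ⟨fun x => ⟨‖L x‖⁻¹ • L x, hLs x⟩, hLc'.subtype_mk hLs⟩
  have hs : ∀ x, ∀ y : Sphere2, L x = y → H x = y := fun x y h => Subtype.ext (by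
    change ‖L x‖⁻¹ • L x = y
    rw [h, y.norm_coe, inv_one, one_smul])
  refine ⟨H, fun x => h3 _ (hL x) _ (inv_pos.2 (hLn x)), fun t => hs _ _ (by simp [L]),
    fun t => hs _ _ (by simp [L]), fun s t h => hs _ _ ?_⟩
  simp only [L, ← h, ← add_smul]
  simp

/-! ### Covers by relatively simply connected sets -/

/-- An open cover of a space `X` with base point `b` by sets `V i` which are path connected, have
path connected intersections, and are simply connected relative to `X`: this is expressed by a
choice of classes `cls i v` of paths from `b` to the points `v` of `V i` that is compatible with
all paths inside `V i`. -/
structure BasedCover (X : Type) [TopologicalSpace X] (b : X) (ι : Type) where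
  /-- The sets of the cover. -/
  V : ι → Set X
  isOpen : ∀ i, IsOpen (V i)
  cover : ∀ x, ∃ i, x ∈ V i
  joined : ∀ i j v v', v ∈ V i → v ∈ V j → v' ∈ V i → v' ∈ V j →
    ∃ η : Path v v', ∀ t, η t ∈ V i ∧ η t ∈ V j
  /-- The chosen class of paths from the base point to a point. -/
  cls : ∀ (_ : ι) (v : X), Path.Homotopic.Quotient b v
  cls_trans : ∀ (i : ι) (v v' : X) (η : Path v v'), (∀ t, η t ∈ V i) →
    (cls i v).trans (.mk η) = cls i v'

namespace BasedCover

variable {X : Type} [TopologicalSpace X] {b : X} {ι : Type} (𝒱 : BasedCover X b ι)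

/-- The class of loops that leaves `b` inside `V i` and returns inside `V j`. -/
noncomputable def transition (i j : ι) (v : X) : FundamentalGroup X b :=
  FundamentalGroup.fromPath ((𝒱.cls i v).trans (𝒱.cls j v).symm)

theorem transition_eq {i j : ι} {v v' : X} (h1 : v ∈ 𝒱.V i) (h2 : v ∈ 𝒱.V j) (h3 : v' ∈ 𝒱.V i)
    (h4 : v' ∈ 𝒱.V j) : 𝒱.transition i j v = 𝒱.transition i j v' := by
  obtain ⟨η, hη⟩ := 𝒱.joined i j v v' h1 h2 h3 h4
  have hi := 𝒱.cls_trans i v v' η fun t => (hη t).1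
  have hj := 𝒱.cls_trans j v' v η.symm fun t => (hη _).2
  rw [transition, transition, ← hi, ← hj, Path.Homotopic.Quotient.mk_symm]
  congr 1
  have : ∀ q : Path.Homotopic.Quotient b v',
      (q.trans (Path.Homotopic.Quotient.mk η).symm).symm =
        (Path.Homotopic.Quotient.mk η).trans q.symm := by
    intro q
    induction q using Path.Homotopic.Quotient.ind with
    | mk q => simp [← Path.Homotopic.Quotient.mk_trans, ← Path.Homotopic.Quotient.mk_symm]
  rw [this, Path.Homotopic.Quotient.trans_assoc]

/-- The finitely many transition classes together with the classes of the base point. -/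
def generators : Set (FundamentalGroup X b) :=
  {g | ∃ i j v, v ∈ 𝒱.V i ∧ v ∈ 𝒱.V j ∧ g = 𝒱.transition i j v} ∪
    range fun i => FundamentalGroup.fromPath (𝒱.cls i b)

theorem finite_generators [Finite ι] : 𝒱.generators.Finite := by
  refine Finite.union ?_ (finite_range _)
  refine (finite_iUnion (ι := ι × ι) (f := fun ij => {g | ∃ v, v ∈ 𝒱.V ij.1 ∧ v ∈ 𝒱.V ij.2 ∧
    g = 𝒱.transition ij.1 ij.2 v}) fun ij => ?_).subset ?_
  · refine Subsingleton.finite ?_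
    rintro _ ⟨v, h1, h2, rfl⟩ _ ⟨v', h3, h4, rfl⟩
    exact 𝒱.transition_eq h1 h2 h3 h4
  · rintro g ⟨i, j, v, h⟩
    exact mem_iUnion.2 ⟨(i, j), v, h⟩

/-- The fundamental group is generated by the transitions, by subdivision of loops. -/
theorem closure_generators : Subgroup.closure 𝒱.generators = ⊤ := by
  set H := Subgroup.closure 𝒱.generators with hH
  have htr : ∀ i j v, v ∈ 𝒱.V i → v ∈ 𝒱.V j → 𝒱.transition i j v ∈ H := fun i j v h1 h2 =>
    Subgroup.subset_closure (Or.inl ⟨i, j, v, h1, h2, rfl⟩)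
  have hmul : ∀ p q : Path.Homotopic.Quotient b b, FundamentalGroup.fromPath p ∈ H →
      FundamentalGroup.fromPath q ∈ H → FundamentalGroup.fromPath (p.trans q) ∈ H :=
    fun p q hp hq => H.mul_mem hq hp
  let Q : ∀ x y : X, Path x y → Prop := fun x y γ => ∀ i j, x ∈ 𝒱.V i → y ∈ 𝒱.V j →
    FundamentalGroup.fromPath (((𝒱.cls i x).trans (.mk γ)).trans (𝒱.cls j y).symm) ∈ H
  have hcast : ∀ (x y x' y' : X) (γ : Path x y) (hx : x' = x) (hy : y' = y),
      Q x' y' (γ.cast hx hy) → Q x y γ := by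
    rintro x y _ _ γ rfl rfl h; exact h
  have hin : ∀ (x y : X) (γ : Path x y) k, (∀ t, γ t ∈ 𝒱.V k) → Q x y γ := by
    intro x y γ k hk i j hi hj
    have hx : x ∈ 𝒱.V k := by simpa using hk 0
    have hy : y ∈ 𝒱.V k := by simpa using hk 1
    have := hmul _ _ (htr i k x hi hx) (htr k j y hy hj)
    rw [transition, transition, ← 𝒱.cls_trans k x y γ hk] at this
    convert this using 2
    simp only [Path.Homotopic.Quotient.trans_assoc]
    congr 1
    rw [← Path.Homotopic.Quotient.trans_assoc (𝒱.cls k x).symm, Path.Homotopic.Quotient.symm_trans,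
      Path.Homotopic.Quotient.refl_trans]
  have htrans : ∀ (x y z : X) (γ : Path x y) (γ' : Path y z) (γ'' : Path x z),
      (γ.trans γ').Homotopic γ'' → Q x y γ → Q y z γ' → Q x z γ'' := by
    intro x y z γ γ' γ'' hγ h1 h2 i j hi hj
    obtain ⟨k, hk⟩ := 𝒱.cover y
    have := hmul _ _ (h1 i k hi hk) (h2 k j hk hj)
    rw [← Path.Homotopic.Quotient.eq.2 hγ, Path.Homotopic.Quotient.mk_trans]
    convert this using 2
    simp only [Path.Homotopic.Quotient.trans_assoc]
    congr 2
    rw [← Path.Homotopic.Quotient.trans_assoc (𝒱.cls k y).symm, Path.Homotopic.Quotient.symm_trans,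
      Path.Homotopic.Quotient.refl_trans]
  have hall : ∀ (x y : X) (γ : Path x y), Q x y γ := by
    intro x y γ
    obtain ⟨t, t0, tm, ⟨N, hN⟩, ht⟩ := exists_monotone_Icc_subset_open_cover_unitInterval
      (fun i => (𝒱.isOpen i).preimage γ.continuous)
      (fun s _ => mem_iUnion.2 (𝒱.cover (γ s)))
    have : ∀ n, Q _ _ (γ.subpath 0 (t n)) := by
      intro n
      induction n with
      | zero =>
        obtain ⟨k, hk⟩ := 𝒱.cover (γ 0)
        refine hin _ _ _ k fun s => ?_
        have : γ.subpath 0 (t 0) s = γ 0 := by simp [Path.subpath, t0]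
        rw [this]; exact hk
      | succ n ih =>
        refine htrans _ _ _ _ _ _ ⟨Path.Homotopy.subpathTransSubpath γ 0 (t n) (t (n + 1))⟩ ih ?_
        obtain ⟨k, hk⟩ := ht n
        refine hin _ _ _ k fun s => ?_
        have := mem_range_self (f := γ.subpath (t n) (t (n + 1))) s
        rw [Path.range_subpath_of_le _ _ _ (tm n.le_succ)] at this
        obtain ⟨r, hr, hr'⟩ := this
        rw [← hr']; exact hk hr
    have h1 := this N
    rw [hN N le_rfl, Path.subpath_zero_one] at h1
    exact hcast _ _ _ _ γ _ _ h1
  rw [eq_top_iff]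
  rintro g -
  obtain ⟨γ, rfl⟩ := Path.Homotopic.Quotient.mk_surjective g
  obtain ⟨i, hi⟩ := 𝒱.cover b
  have hib : FundamentalGroup.fromPath (𝒱.cls i b) ∈ H :=
    Subgroup.subset_closure (Or.inr ⟨i, rfl⟩)
  have h2 := hmul _ _ (hmul _ _ (H.inv_mem hib) (hall b b γ i i hi hi)) hib
  rw [FundamentalGroup.inv_def] at h2
  convert h2 using 1
  change Path.Homotopic.Quotient.mk γ = ((𝒱.cls i b).symm.trans
    (((𝒱.cls i b).trans (.mk γ)).trans (𝒱.cls i b).symm)).trans (𝒱.cls i b)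
  rw [Path.Homotopic.Quotient.trans_assoc, Path.Homotopic.Quotient.trans_assoc,
    Path.Homotopic.Quotient.trans_assoc,
    Path.Homotopic.Quotient.symm_trans, Path.Homotopic.Quotient.trans_refl,
    ← Path.Homotopic.Quotient.trans_assoc, Path.Homotopic.Quotient.symm_trans,
    Path.Homotopic.Quotient.refl_trans]

end BasedCover

/-- A cover of a path connected punctured sphere by convex traces gives a based cover: two paths
inside a convex trace with the same ends are homotopic by the normalized linear homotopy. -/
theorem exists_basedCover {f : Sphere2 → Sphere2} [PathConnectedSpace (PuncturedSphere f)]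
    (b : PuncturedSphere f) {ι : Type} (V : ι → Set Sphere2) (ho : ∀ i, IsOpen (V i))
    (hV : ∀ i, IsConvexTrace (V i)) (hd : ∀ i, ∀ x ∈ V i, x ∉ postcriticalSet f)
    (hc : ∀ x ∉ postcriticalSet f, ∃ i, x ∈ V i) :
    ∃ 𝒱 : BasedCover (PuncturedSphere f) b ι, ∀ i, 𝒱.V i = Subtype.val ⁻¹' V i := by
  have hjoin : ∀ W : Set Sphere2, IsConvexTrace W → (∀ x ∈ W, x ∉ postcriticalSet f) →
      ∀ v v' : PuncturedSphere f, (v : Sphere2) ∈ W → (v' : Sphere2) ∈ W →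
      ∃ η : Path v v', ∀ t, (η t : Sphere2) ∈ W := by
    intro W hW hWP v v' hv hv'
    obtain ⟨H, h1, h2, h3, -⟩ := hW.exists_homotopy (.const I (v : Sphere2)) (.const I (v' : Sphere2))
      (fun _ => hv) (fun _ => hv')
    exact ⟨⟨⟨fun t => ⟨H (t, 0), hWP _ (h1 _)⟩, by fun_prop⟩, Subtype.ext (h2 0),
      Subtype.ext (h3 0)⟩, fun t => h1 _⟩
  have hhom : ∀ i (v v' : PuncturedSphere f) (η η' : Path v v'), (∀ t, (η t : Sphere2) ∈ V i) →
      (∀ t, (η' t : Sphere2) ∈ V i) →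
      Path.Homotopic.Quotient.mk η = Path.Homotopic.Quotient.mk η' := by
    intro i v v' η η' h h'
    obtain ⟨H, h1, h2, h3, h4⟩ := (hV i).exists_homotopy ⟨fun t => (η t : Sphere2), by fun_prop⟩
      ⟨fun t => (η' t : Sphere2), by fun_prop⟩ h h'
    refine Path.Homotopic.Quotient.eq.2 ⟨⟨⟨⟨fun x => ⟨H x, hd i _ (h1 _)⟩, by fun_prop⟩,
      fun t => Subtype.ext (h2 t), fun t => Subtype.ext (h3 t)⟩, fun s t ht => Subtype.ext ?_⟩⟩
    refine h4 s t ?_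
    rcases ht with rfl | rfl <;> simp
  have hex : ∀ i, ∃ c : ∀ v : PuncturedSphere f, Path.Homotopic.Quotient b v,
      ∀ (v v' : PuncturedSphere f) (η : Path v v'), (∀ t, (η t : Sphere2) ∈ V i) →
        (c v).trans (.mk η) = c v' := by
    intro i
    rcases (V i).eq_empty_or_nonempty with he | ⟨x, hx⟩
    · refine ⟨fun v => .mk (PathConnectedSpace.somePath b v), fun v v' η h => ?_⟩
      exact absurd (h 0) (by simp [he])
    · let v0 : PuncturedSphere f := ⟨x, hd i x hx⟩
      have : ∀ v : PuncturedSphere f, Nonempty (Path v0 v) :=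
        fun v => ⟨PathConnectedSpace.somePath _ _⟩
      choose! η hη using fun (v : PuncturedSphere f) (hv : (v : Sphere2) ∈ V i) =>
        hjoin (V i) (hV i) (hd i) v0 v hx hv
      refine ⟨fun v => (Path.Homotopic.Quotient.mk (PathConnectedSpace.somePath b v0)).trans
        (.mk (η v)), fun v v' θ h => ?_⟩
      rw [Path.Homotopic.Quotient.trans_assoc, ← Path.Homotopic.Quotient.mk_trans]
      congr 1
      have hv : (v : Sphere2) ∈ V i := by simpa using h 0
      have hv' : (v' : Sphere2) ∈ V i := by simpa using h 1
      refine hhom i _ _ _ _ (fun t => ?_) (hη v' hv')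
      rw [Path.trans_apply]
      split_ifs
      · exact hη v hv _
      · exact h _
  choose c hcl using hex
  exact ⟨⟨fun i => Subtype.val ⁻¹' V i, fun i => (ho i).preimage continuous_subtype_val,
    fun x => hc x x.2, fun i j v v' h1 h2 h3 h4 => hjoin _ ((hV i).inter (hV j))
      (fun x hx => hd i x hx.1) v v' ⟨h1, h2⟩ ⟨h3, h4⟩, c, hcl⟩, fun _ => rfl⟩

/-! ### Local degrees, critical points and coverings -/

theorem Set.encard_le_mul_of_fibers {α β : Type*} {S : Set α} {T : Set β} {g : α → β} {k l : ℕ}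
    (hg : MapsTo g S T) (hT : T.encard ≤ l) (h : ∀ z ∈ T, (g ⁻¹' {z} ∩ S).encard ≤ k) :
    S.encard ≤ (k * l : ℕ) := by
  classical
  have hTf : T.Finite := finite_of_encard_le_coe hT
  have hfib : ∀ z ∈ T, (g ⁻¹' {z} ∩ S).Finite := fun z hz => finite_of_encard_le_coe (h z hz)
  have hS : S ⊆ ⋃ z ∈ T, g ⁻¹' {z} ∩ S := fun x hx => mem_biUnion (hg hx) ⟨rfl, hx⟩
  have hSf : S.Finite := (hTf.biUnion hfib).subset hS
  rw [hSf.encard_eq_coe_toFinset_card, Nat.cast_le]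
  rw [hTf.encard_eq_coe_toFinset_card, Nat.cast_le] at hT
  refine (Finset.card_le_mul_card_image_of_maps_to (f := g) (t := hTf.toFinset)
    (fun x hx => hTf.mem_toFinset.2 (hg (hSf.mem_toFinset.1 hx))) k fun z hz => ?_).trans
    (Nat.mul_le_mul_left k hT)
  have h1 := h z (hTf.mem_toFinset.1 hz)
  rw [← Nat.cast_le (α := ℕ∞), ← encard_coe_eq_coe_finsetCard]
  refine (encard_le_encard ?_).trans h1
  intro x hx
  simp only [Finset.coe_filter, Finite.mem_toFinset] at hx
  exact ⟨hx.2, hx.1⟩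

theorem encard_pow_fiber_le (k : ℕ) (hk : k ≠ 0) (a : ℂ) : {z : ℂ | z ^ k = a}.encard ≤ k := by
  classical
  have : {z : ℂ | z ^ k = a} = ((Polynomial.nthRoots k a).toFinset : Set ℂ) := by
    ext z
    simp [Polynomial.mem_nthRoots (Nat.pos_of_ne_zero hk)]
  rw [this, encard_coe_eq_coe_finsetCard, Nat.cast_le]
  exact (Multiset.toFinset_card_le _).trans (Polynomial.card_nthRoots k a)

theorem localDegree_le {g : Sphere2 → Sphere2} {x : Sphere2} {k : ℕ} {W : Set Sphere2}
    (hW : W ∈ 𝓝 x) (h : ∀ y, (g ⁻¹' {y} ∩ W).encard ≤ k) : localDegree g x ≤ k :=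
  Nat.sInf_le ⟨W, hW, h⟩

theorem exists_nhds_encard_le_localDegree {g : Sphere2 → Sphere2} {x : Sphere2} {k : ℕ}
    {W : Set Sphere2} (hW : W ∈ 𝓝 x) (h : ∀ y, (g ⁻¹' {y} ∩ W).encard ≤ k) :
    ∃ W ∈ 𝓝 x, ∀ y, (g ⁻¹' {y} ∩ W).encard ≤ localDegree g x :=
  Nat.sInf_mem (s := {k : ℕ | ∃ W ∈ 𝓝 x, ∀ y, (g ⁻¹' {y} ∩ W).encard ≤ k}) ⟨k, W, hW, h⟩

variable {f : Sphere2 → Sphere2}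

namespace IsBranchedCovering

variable (hf : IsBranchedCovering f)
include hf

theorem exists_nhds_encard_le (x : Sphere2) :
    ∃ W ∈ 𝓝 x, ∀ y, (f ⁻¹' {y} ∩ W).encard ≤ localDegree f x := by
  obtain ⟨k, φ, ψ, hk, hx, hfx, hφ, hψ, -, -, hm, he⟩ := hf.local_model x
  refine exists_nhds_encard_le_localDegree (φ.open_source.mem_nhds hx) (k := k) fun y => ?_
  refine (encard_le_encard_of_injOn (f := φ) (t := {z : ℂ | z ^ k = ψ y}) ?_ ?_).trans
    (encard_pow_fiber_le k hk _)
  · rintro z ⟨hz, hz'⟩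
    change φ z ^ k = ψ y
    rw [← he z hz', show f z = y from hz]
  · exact φ.injOn.mono inter_subset_right

/-- Near `x` the iterate is at most as many to one as the product of the local degrees along the
orbit of `x`. -/
theorem iterate_exists_nhds_encard_le (n : ℕ) (x : Sphere2) :
    ∃ W ∈ 𝓝 x, ∀ y, (f^[n] ⁻¹' {y} ∩ W).encard ≤
      (∏ i ∈ Finset.range n, localDegree f (f^[i] x) : ℕ) := by
  induction n with
  | zero =>
    refine ⟨univ, univ_mem, fun y => ?_⟩
    simp [preimage_id]
  | succ n ih =>
    obtain ⟨W, hW, h⟩ := ih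
    obtain ⟨W', hW', h'⟩ := hf.exists_nhds_encard_le (f^[n] x)
    refine ⟨W ∩ f^[n] ⁻¹' W', inter_mem hW ((hf.continuous.iterate n).continuousAt hW'),
      fun y => ?_⟩
    rw [Finset.prod_range_succ]
    refine Set.encard_le_mul_of_fibers (g := f^[n]) (T := f ⁻¹' {y} ∩ W') ?_ (h' y) fun z _ => ?_
    · rintro z ⟨hz, -, hz'⟩
      exact ⟨by rw [mem_preimage, ← Function.iterate_succ_apply' f]; exact hz, hz'⟩
    · refine (encard_le_encard ?_).trans (h z)
      exact fun w hw => ⟨hw.1, hw.2.2.1⟩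

/-- The exponent in the local model is `1` away from the centre of the chart, so critical points
are isolated. -/
theorem finite_criticalPoints : (criticalPoints f).Finite := by
  have hloc : ∀ x, ∃ W ∈ 𝓝 x, criticalPoints f ∩ W ⊆ {x} := by
    intro x
    obtain ⟨k, φ, ψ, hk, hx, hfx, hφ, hψ, -, -, hm, he⟩ := hf.local_model x
    refine ⟨φ.source, φ.open_source.mem_nhds hx, ?_⟩
    rintro y ⟨hy, hys⟩
    by_contra hyx
    have hy0 : φ y ≠ 0 := fun h => hyx (φ.injOn hys hx (h.trans hφ.symm))
    obtain ⟨e, hey, hee⟩ := (isCoveringMapOn_npow (𝕜 := ℂ) k (by exact_mod_cast hk)).isLocalHomeomorphOn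
      (φ y) (by simpa [hk] using hy0)
    have hW : φ.source ∩ φ ⁻¹' e.source ∈ 𝓝 y :=
      (φ.isOpen_inter_preimage e.open_source).mem_nhds ⟨hys, hey⟩
    have : localDegree f y ≤ 1 := by
      refine localDegree_le hW fun z => ?_
      rw [Nat.cast_one, encard_le_one_iff]
      rintro a b ⟨ha, has, hae⟩ ⟨hb, hbs, hbe⟩
      refine φ.injOn has hbs (e.injOn hae hbe ?_)
      rw [← hee]
      change φ a ^ k = φ b ^ k
      rw [← he a has, ← he b hbs, show f a = z from ha, show f b = z from hb]
    exact absurd hy (not_lt.2 this)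
  choose W hW h using hloc
  obtain ⟨t, -, ht⟩ := isCompact_univ.elim_nhds_subcover W fun x _ => hW x
  refine t.finite_toSet.subset fun x hx => ?_
  obtain ⟨y, hy, hxy⟩ := mem_iUnion₂.1 (ht (mem_univ x))
  obtain rfl : x = y := h y ⟨hx, hxy⟩
  exact hy

theorem finite_fiber (n : ℕ) (y : Sphere2) : (f^[n] ⁻¹' {y}).Finite := by
  choose W hW h using hf.iterate_exists_nhds_encard_le n
  obtain ⟨t, -, ht⟩ := isCompact_univ.elim_nhds_subcover W fun x _ => hW x
  refine (t.finite_toSet.biUnion fun x _ => finite_of_encard_le_coe (h x y)).subset fun z hz => ?_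
  obtain ⟨x, hx, hxz⟩ := mem_iUnion₂.1 (ht (mem_univ z))
  exact mem_biUnion hx ⟨hz, hxz⟩

theorem isOpenMap_iterate (n : ℕ) : IsOpenMap f^[n] := by
  induction n with
  | zero => exact IsOpenMap.id
  | succ n ih => rw [Function.iterate_succ']; exact hf.isOpenMap.comp ih

theorem isClosedMap_iterate (n : ℕ) : IsClosedMap f^[n] := (hf.continuous.iterate n).isClosedMap

/-- Without periodic critical points an orbit meets every critical point at most once, so that
the local degrees of all iterates are bounded by one constant. -/
theorem exists_localDegree_iterate_le
    (hper : ∀ x ∈ criticalPoints f, ∀ n : ℕ, 0 < n → f^[n] x ≠ x) :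
    ∃ N : ℕ, ∀ n x, localDegree f^[n] x ≤ N := by
  classical
  -- the product over the critical points, each of which contributes at most once to an orbit
  set C := hf.finite_criticalPoints.toFinset
  refine ⟨∏ c ∈ C, localDegree f c, fun n x => ?_⟩
  obtain ⟨W, hW, h⟩ := hf.iterate_exists_nhds_encard_le n x
  refine (localDegree_le hW h).trans ?_
  set R := (Finset.range n).filter fun i => f^[i] x ∈ criticalPoints f
  have h1 : ∏ i ∈ Finset.range n, localDegree f (f^[i] x) ≤ ∏ i ∈ R, localDegree f (f^[i] x) := by
    rw [← Finset.prod_filter_mul_prod_filter_not (Finset.range n)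
      fun i => f^[i] x ∈ criticalPoints f]
    refine (Nat.mul_le_mul_left _ (Finset.prod_le_one' fun i hi => ?_)).trans_eq (mul_one _)
    exact not_lt.1 (Finset.mem_filter.1 hi).2
  refine h1.trans ?_
  have hinj : Set.InjOn (fun i => f^[i] x) R := by
    have key : ∀ i j, i ∈ R → i < j → f^[i] x ≠ f^[j] x := by
      intro i j hi hij heq
      refine hper _ (Finset.mem_filter.1 hi).2 (j - i) (Nat.sub_pos_of_lt hij) ?_
      rw [← Function.iterate_add_apply, Nat.sub_add_cancel hij.le, ← heq]
    intro i hi j hj hij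
    rcases lt_trichotomy i j with h | h | h
    · exact absurd hij (key i j hi h)
    · exact h
    · exact absurd hij.symm (key j i hj h)
  rw [← Finset.prod_image (f := fun c => localDegree f c) hinj]
  refine Finset.prod_le_prod_of_subset_of_one_le' ?_ fun c hc _ => ?_
  · intro c hc
    obtain ⟨i, hi, rfl⟩ := Finset.mem_image.1 hc
    exact hf.finite_criticalPoints.mem_toFinset.2 (Finset.mem_filter.1 hi).2
  · exact (show 1 < localDegree f c from hf.finite_criticalPoints.mem_toFinset.1 hc).le

end IsBranchedCovering

theorem apply_mem_postcriticalSet {p : Sphere2} (hp : p ∈ postcriticalSet f) :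
    f p ∈ postcriticalSet f := by
  obtain ⟨n, c, hc, rfl⟩ := mem_iUnion.1 hp
  exact mem_iUnion.2 ⟨n + 1, c, hc, Function.iterate_succ_apply' f _ _⟩

theorem iterate_notMem_of_le {m n : ℕ} (h : m ≤ n) {x : Sphere2}
    (hx : f^[n] x ∉ postcriticalSet f) : f^[m] x ∉ postcriticalSet f := by
  induction n, h using Nat.le_induction with
  | base => exact hx
  | succ n _ ih =>
    refine ih fun h => hx ?_
    rw [Function.iterate_succ_apply']
    exact apply_mem_postcriticalSet h

theorem notMem_criticalPoints_of_iterate {i n : ℕ} (h : i < n) {x : Sphere2}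
    (hx : f^[n] x ∉ postcriticalSet f) : f^[i] x ∉ criticalPoints f := by
  refine fun hc => hx (mem_iUnion.2 ⟨n - i - 1, _, hc, ?_⟩)
  rw [← Function.iterate_add_apply]
  congr 1
  omega

namespace IsBranchedCovering

variable (hf : IsBranchedCovering f)
include hf

/-- An orbit which ends off the postcritical set meets no critical points, so that the iterate is
open and locally injective along it. -/
theorem isLocalHomeomorphOn_iterate (n : ℕ) :
    IsLocalHomeomorphOn f^[n] (f^[n] ⁻¹' (postcriticalSet f)ᶜ) := by
  intro x hx
  obtain ⟨W, hW, h⟩ := hf.iterate_exists_nhds_encard_le n x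
  have h1 : (∏ i ∈ Finset.range n, localDegree f (f^[i] x)) ≤ 1 :=
    Finset.prod_le_one' fun i hi =>
      not_lt.1 (notMem_criticalPoints_of_iterate (Finset.mem_range.1 hi) hx)
  have hinj : InjOn f^[n] (interior W) := by
    intro a ha b hb hab
    have h2 := (h (f^[n] b)).trans (Nat.cast_le.2 h1)
    rw [Nat.cast_one, encard_le_one_iff] at h2
    exact h2 a b ⟨hab, interior_subset ha⟩ ⟨rfl, interior_subset hb⟩
  exact ⟨OpenPartialHomeomorph.ofContinuousOpen (hinj.toPartialEquiv)
    (hf.continuous.iterate n).continuousOn (hf.isOpenMap_iterate n) isOpen_interior,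
    mem_interior_iff_mem_nhds.2 hW, rfl⟩

theorem isCoveringMapOn_iterate (n : ℕ) : IsCoveringMapOn f^[n] (postcriticalSet f)ᶜ :=
  .of_isLocalHomeomorphOn (hf.continuous.iterate n) (hf.isLocalHomeomorphOn_iterate n)

/-- Uniqueness of lifts under iterates, away from the postcritical set. -/
theorem eq_of_iterate_eq {A : Type*} [TopologicalSpace A] [PreconnectedSpace A] {n : ℕ}
    {g g' : A → Sphere2} (hg : Continuous g) (hg' : Continuous g')
    (h : ∀ a, f^[n] (g a) = f^[n] (g' a)) (hP : ∀ a, f^[n] (g a) ∉ postcriticalSet f)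
    {a : A} (ha : g a = g' a) (x : A) : g x = g' x := by
  have := (hf.isCoveringMapOn_iterate n).isCoveringMap_restrictPreimage.eq_of_comp_eq
    (g₁ := fun a => ⟨g a, hP a⟩)
    (g₂ := fun a => ⟨g' a, show f^[n] (g' a) ∈ (postcriticalSet f)ᶜ from (h a) ▸ hP a⟩)
    (hg.subtype_mk _) (hg'.subtype_mk _) (funext fun a => Subtype.ext (h a)) a (Subtype.ext ha)
  exact congrArg Subtype.val (congrFun this x)

end IsBranchedCovering

/-! ### Transport of points along classes of paths -/

/-- `Transport n c y z`: some path in the class `c` has a lift under `f^n` that leads from `y`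
to `z`. -/
def Transport {f : Sphere2 → Sphere2} (n : ℕ) {a a' : PuncturedSphere f}
    (c : Path.Homotopic.Quotient a a') (y z : Sphere2) : Prop :=
  ∃ (η : Path a a') (ζ : Path y z), Path.Homotopic.Quotient.mk η = c ∧ ∀ t, f^[n] (ζ t) = η t

namespace Transport

variable {n : ℕ} {a a' a'' : PuncturedSphere f} {c : Path.Homotopic.Quotient a a'}
  {c' : Path.Homotopic.Quotient a' a''} {y z w : Sphere2}

theorem iterate_left (h : Transport n c y z) : f^[n] y = a := by
  obtain ⟨η, ζ, -, h⟩ := h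
  simpa using h 0

theorem iterate_right (h : Transport n c y z) : f^[n] z = a' := by
  obtain ⟨η, ζ, -, h⟩ := h
  simpa using h 1

theorem refl (h : f^[n] y = a) : Transport n (Path.Homotopic.Quotient.refl a) y y :=
  ⟨Path.refl a, Path.refl y, rfl, fun _ => h⟩

theorem symm (h : Transport n c y z) : Transport n c.symm z y := by
  obtain ⟨η, ζ, rfl, h⟩ := h
  exact ⟨η.symm, ζ.symm, Path.Homotopic.Quotient.mk_symm η, fun t => h _⟩

theorem of_symm (h : Transport n c.symm y z) : Transport n c z y := by
  induction c using Path.Homotopic.Quotient.ind with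
  | mk η =>
    have := h.symm
    rwa [← Path.Homotopic.Quotient.mk_symm, ← Path.Homotopic.Quotient.mk_symm,
      Path.symm_symm] at this

theorem trans (h : Transport n c y z) (h' : Transport n c' z w) :
    Transport n (c.trans c') y w := by
  obtain ⟨η, ζ, rfl, h⟩ := h
  obtain ⟨η', ζ', rfl, h'⟩ := h'
  refine ⟨η.trans η', ζ.trans ζ', Path.Homotopic.Quotient.mk_trans η η', fun t => ?_⟩
  rw [Path.trans_apply, Path.trans_apply]
  split_ifs
  · exact h _
  · exact h' _

end Transport

namespace IsBranchedCovering

variable (hf : IsBranchedCovering f) {n : ℕ} {a a' a'' : PuncturedSphere f}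
include hf

theorem exists_lift (η : Path a a') {y : Sphere2} (hy : f^[n] y = a) :
    ∃ (z : Sphere2) (ζ : Path y z), ∀ t, f^[n] (ζ t) = η t := by
  have cov := (hf.isCoveringMapOn_iterate n).isCoveringMap_restrictPreimage
  obtain ⟨Γ, h1, h0⟩ := cov.exists_path_lifts ⟨fun t => (⟨η t, (η t).2⟩ : ↥(postcriticalSet f)ᶜ),
    by fun_prop⟩ ⟨y, by rw [mem_preimage, hy]; exact a.2⟩ (Subtype.ext (by simp [hy]))
  exact ⟨Γ 1, ⟨⟨fun t => Γ t, by fun_prop⟩, congrArg Subtype.val h0, rfl⟩,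
    fun t => congrArg Subtype.val (congrFun h1 t)⟩

theorem exists_transport (c : Path.Homotopic.Quotient a a') {y : Sphere2} (hy : f^[n] y = a) :
    ∃ z, Transport n c y z := by
  obtain ⟨η, rfl⟩ := Path.Homotopic.Quotient.mk_surjective c
  obtain ⟨z, ζ, h⟩ := hf.exists_lift η hy
  exact ⟨z, η, ζ, rfl, h⟩

/-- The end point of a lift depends on the homotopy class only. -/
theorem transport_unique {c : Path.Homotopic.Quotient a a'} {y z z' : Sphere2}
    (h : Transport n c y z) (h' : Transport n c y z') : z = z' := by
  obtain ⟨η, ζ, rfl, h⟩ := h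
  obtain ⟨η', ζ', hη, h'⟩ := h'
  have cov := (hf.isCoveringMapOn_iterate n).isCoveringMap_restrictPreimage
  obtain ⟨H⟩ := Path.Homotopic.Quotient.eq.1 hη
  have hP : ∀ t, ζ t ∈ f^[n] ⁻¹' (postcriticalSet f)ᶜ := fun t => by
    rw [mem_preimage, h]; exact (η t).2
  have hP' : ∀ t, ζ' t ∈ f^[n] ⁻¹' (postcriticalSet f)ᶜ := fun t => by
    rw [mem_preimage, h']; exact (η' t).2
  let γ : C(I, ↥(postcriticalSet f)ᶜ) := ⟨fun t => ⟨η t, (η t).2⟩, by fun_prop⟩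
  let γ' : C(I, ↥(postcriticalSet f)ᶜ) := ⟨fun t => ⟨η' t, (η' t).2⟩, by fun_prop⟩
  let Γ : C(I, f^[n] ⁻¹' (postcriticalSet f)ᶜ) := ⟨fun t => ⟨ζ t, hP t⟩, by fun_prop⟩
  let Γ' : C(I, f^[n] ⁻¹' (postcriticalSet f)ᶜ) := ⟨fun t => ⟨ζ' t, hP' t⟩, by fun_prop⟩
  have h0 : Γ' 0 = Γ 0 := Subtype.ext (by simp [Γ, Γ'])
  have hγ : (postcriticalSet f)ᶜ.restrictPreimage f^[n] ∘ Γ = γ :=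
    funext fun t => Subtype.ext (h t)
  have hγ' : (postcriticalSet f)ᶜ.restrictPreimage f^[n] ∘ Γ' = γ' :=
    funext fun t => Subtype.ext (h' t)
  have e0 : γ 0 = (postcriticalSet f)ᶜ.restrictPreimage f^[n] (Γ 0) := (congrFun hγ 0).symm
  have e0' : γ' 0 = (postcriticalSet f)ᶜ.restrictPreimage f^[n] (Γ 0) := by
    rw [← h0]; exact (congrFun hγ' 0).symm
  have hH : γ'.HomotopicRel γ {0, 1} := ⟨H⟩
  have := cov.liftPath_apply_one_eq_of_homotopicRel hH (Γ 0) e0' e0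
  rw [← (cov.eq_liftPath_iff' e0).2 ⟨hγ, rfl⟩, ← (cov.eq_liftPath_iff' e0').2 ⟨hγ', h0⟩] at this
  simpa [Γ, Γ'] using (congrArg Subtype.val this).symm

theorem transport_unique_left {c : Path.Homotopic.Quotient a a'} {y y' z : Sphere2}
    (h : Transport n c y z) (h' : Transport n c y' z) : y = y' :=
  hf.transport_unique h.symm h'.symm

end IsBranchedCovering

/-! ### Iterates over a punctured cap -/

/-- `L` lifts Mercator coordinates on the punctured cap `cap p a` through `f^n`. -/
structure IsMercLift (f : Sphere2 → Sphere2) (n : ℕ) {p : Sphere2} (F : TangentFrame p) (a : ℝ)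
    (L : ℂ → Sphere2) : Prop where
  continuousOn : ContinuousOn L {ω | ω.re < capWidth a}
  apply_eq : ∀ ω, ω.re < capWidth a → f^[n] (L ω) = F.merc ω

/-- Multiples of the period of Mercator coordinates. -/
noncomputable def turn (k : ℤ) : ℂ := k * (2 * Real.pi * Complex.I)

@[simp] theorem turn_re (k : ℤ) : (turn k).re = 0 := by simp [turn]
@[simp] theorem turn_zero : turn 0 = 0 := by simp [turn]
theorem turn_add (k l : ℤ) : turn (k + l) = turn k + turn l := by simp [turn, add_mul]
theorem turn_neg (k : ℤ) : turn (-k) = -turn k := by simp [turn]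

theorem TangentFrame.merc_add_turn {p : Sphere2} (F : TangentFrame p) (ω : ℂ) (k : ℤ) :
    F.merc (ω + turn k) = F.merc ω := F.merc_eq_iff.2 ⟨k, rfl⟩

theorem capWidth_anti {a b : ℝ} (ha : -1 < a) (hab : a ≤ b) (hb : b < 1) :
    capWidth b ≤ capWidth a := by
  refine div_le_div_of_nonneg_right (Real.log_le_log ?_ ?_) (by norm_num)
  · exact div_pos (by linarith) (by linarith)
  · rw [div_le_div_iff₀ (by linarith) (by linarith)]; nlinarith

section Lift

variable {n : ℕ} {p : Sphere2} {F : TangentFrame p} {a : ℝ}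

/-- Lifts exist because `f^n` is a covering over the punctured cap and the half plane is simply
connected. -/
theorem IsBranchedCovering.exists_mercLift (hf : IsBranchedCovering f) (ha : -1 < a) (ha' : a < 1)
    (hP : ∀ q ∈ postcriticalSet f, q ∈ cap p a → q = p) {y : Sphere2} {ω : ℂ}
    (hω : ω.re < capWidth a) (hy : f^[n] y = F.merc ω) : ∃ L, IsMercLift f n F a L ∧ L ω = y := by
  set A : Set ℂ := {ω | ω.re < capWidth a}
  have hA : Convex ℝ A := convex_halfSpace_re_lt _
  have : ContractibleSpace A := hA.contractibleSpace (nonempty_halfPlane _)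
  have : LocallyPathConnectedSpace A := hA.locallyPathConnectedSpace
  obtain ⟨G, ⟨h0, h1⟩, -⟩ := (hf.isCoveringMapOn_iterate n).existsUnique_continuousMap_lifts
    (A := A) ⟨fun ω => F.merc ω, F.continuous_merc.comp continuous_subtype_val⟩ (a₀ := ⟨ω, hω⟩)
    (e₀ := y) hy (fun ω' hq => F.merc_ne _ (hP _ hq ((F.merc_mem_cap ha ha').2 ω'.2)))
  classical
  refine ⟨fun ω => if h : ω ∈ A then G ⟨ω, h⟩ else p, ⟨?_, fun ω' hω' => ?_⟩, ?_⟩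
  · rw [continuousOn_iff_continuous_domRestrict]
    convert G.continuous using 1
    funext x
    simp
  · rw [dif_pos (show ω' ∈ A from hω')]
    exact congrFun h1 ⟨ω', hω'⟩
  · exact (dif_pos (show ω ∈ A from hω)).trans h0

variable (hf : IsBranchedCovering f) (ha : -1 < a) (ha' : a < 1)
  (hP : ∀ q ∈ postcriticalSet f, q ∈ cap p a → q = p) {L : ℂ → Sphere2}
  (hL : IsMercLift f n F a L)

namespace IsMercLift

include ha ha' hP hL in
theorem notMem {ω : ℂ} (hω : ω.re < capWidth a) : f^[n] (L ω) ∉ postcriticalSet f := by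
  rw [hL.apply_eq ω hω]
  exact fun hq => F.merc_ne _ (hP _ hq ((F.merc_mem_cap ha ha').2 hω))

include hf ha ha' hP hL in
/-- Paths over a punctured cap that start in the image of `L` stay there and lift to Mercator
coordinates. -/
theorem exists_lift_path {b : ℝ} (hab : a ≤ b) (hb : b < 1) (ζ : C(I, Sphere2))
    (hζ : ∀ t, f^[n] (ζ t) ∈ cap p b \ {p}) {ω : ℂ} (hω : ω.re < capWidth a) (h0 : L ω = ζ 0) :
    ∃ α : C(I, ℂ), α 0 = ω ∧ ∀ t, (α t).re < capWidth b ∧ L (α t) = ζ t := by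
  have hab' : -1 < b := ha.trans_le hab
  obtain ⟨α, hα0, hα⟩ := F.exists_lift_merc
    ⟨fun t => f^[n] (ζ t), (hf.continuous.iterate n).comp ζ.continuous⟩
    (fun t => TangentFrame.inner_ne_of_mem_cap hab' (hζ t).1) (fun t => (hζ t).2) (ω := ω)
    (by rw [← hL.apply_eq ω hω, h0]; rfl)
  have hαb : ∀ t, (α t).re < capWidth b := fun t =>
    (F.merc_mem_cap hab' hb).1 (by rw [hα]; exact (hζ t).1)
  have hαa : ∀ t, (α t).re < capWidth a := fun t => (hαb t).trans_le (capWidth_anti ha hab hb)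
  refine ⟨α, hα0, fun t => ⟨hαb t, ?_⟩⟩
  refine hf.eq_of_iterate_eq (n := n) (g := fun t => L (α t)) (g' := ζ)
    (hL.continuousOn.comp_continuous α.continuous hαa) ζ.continuous (fun t => ?_)
    (fun t => hL.notMem ha ha' hP (hαa t)) (a := 0) (by rw [hα0, h0]) t
  rw [hL.apply_eq _ (hαa t), hα]; rfl

include hf ha ha' hP hL in
/-- A connected open set over a punctured cap which meets the image of `L` is contained in it. -/
theorem subset_image {b : ℝ} (hab : a ≤ b) (hb : b < 1) {Y : Set Sphere2} (hYo : IsOpen Y)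
    (hYc : IsPreconnected Y) (hY : Y ⊆ f^[n] ⁻¹' (cap p b \ {p})) {ω : ℂ}
    (hω : ω.re < capWidth a) (hωY : L ω ∈ Y) : Y ⊆ L '' {ω | ω.re < capWidth b} := by
  intro y hy
  have hpc : IsPathConnected Y := hYo.isConnected_iff_isPathConnected.1 ⟨⟨y, hy⟩, hYc⟩
  obtain ⟨γ, hγ⟩ := hpc.joinedIn _ hωY _ hy
  obtain ⟨α, -, hα⟩ := hL.exists_lift_path hf ha ha' hP hab hb γ (fun t => hY (hγ t)) hω
    γ.source.symm
  exact ⟨α 1, (hα 1).1, (hα 1).2.trans γ.target⟩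

include hf ha ha' hP hL in
/-- A translation which preserves `L` at one point preserves it everywhere, by the uniqueness of
lifts. -/
theorem add_turn_eq {k : ℤ} {ω ω' : ℂ} (hω : ω.re < capWidth a) (hω' : ω'.re < capWidth a)
    (h : L (ω + turn k) = L ω) : L (ω' + turn k) = L ω' := by
  have : PreconnectedSpace {ω : ℂ | ω.re < capWidth a} :=
    isPreconnected_iff_preconnectedSpace.1 (isPreconnected_halfPlane _)
  have hk : ∀ ω : {ω : ℂ | ω.re < capWidth a}, (ω + turn k : ℂ) ∈ {ω : ℂ | ω.re < capWidth a} := by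
    rintro ⟨ω, hω⟩
    simpa using hω
  refine hf.eq_of_iterate_eq (n := n) (A := {ω : ℂ | ω.re < capWidth a})
    (g := fun ω => L (ω + turn k)) (g' := fun ω => L ω)
    (hL.continuousOn.comp_continuous (by fun_prop) hk)
    (hL.continuousOn.comp_continuous (by fun_prop) fun ω => ω.2) (fun ω => ?_)
    (fun ω => hL.notMem ha ha' hP (hk ω)) (a := ⟨ω, hω⟩) h ⟨ω', hω'⟩
  rw [hL.apply_eq _ (hk ω), hL.apply_eq _ ω.2, F.merc_add_turn]

include hf ha ha' hP hL in
/-- The fibres of `L` are the orbits of a translation by a positive multiple of the period. -/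
theorem exists_period : ∃ m : ℕ, 0 < m ∧ ∀ ω ω', ω.re < capWidth a → ω'.re < capWidth a →
    (L ω = L ω' ↔ ∃ k : ℤ, ω = ω' + turn (k * m)) := by
  obtain ⟨ω₀, hω₀⟩ := nonempty_halfPlane (capWidth a)
  have hre : ∀ {ω : ℂ} (k : ℤ), ω.re < capWidth a → (ω + turn k).re < capWidth a := by
    intro ω k h; simpa using h
  let Per : AddSubgroup ℤ :=
    { carrier := {k | L (ω₀ + turn k) = L ω₀}
      zero_mem' := by simp
      add_mem' := by
        intro k l hk hl
        change L (ω₀ + turn (k + l)) = L ω₀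
        rw [turn_add, ← add_assoc]
        exact (hL.add_turn_eq hf ha ha' hP hω₀ (hre k hω₀) hl).trans hk
      neg_mem' := by
        intro k hk
        change L (ω₀ + turn (-k)) = L ω₀
        have h1 := hL.add_turn_eq hf ha ha' hP hω₀ (hre (-k) hω₀) hk
        rw [← h1, turn_neg, neg_add_cancel_right] }
  obtain ⟨m₀, hm₀⟩ := Int.subgroup_cyclic Per
  rw [← AddSubgroup.zmultiples_eq_closure] at hm₀
  have hmem : ∀ k : ℤ, L (ω₀ + turn k) = L ω₀ ↔ m₀ ∣ k := fun k => by
    rw [← Int.mem_zmultiples_iff, ← hm₀]; rfl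
  -- the fibre of `f^n` over `F.merc ω₀` is finite, hence some nonzero translation is a period
  have hne : m₀ ≠ 0 := by
    rintro rfl
    have hinj : Function.Injective fun k : ℕ => L (ω₀ + turn k) := by
      intro k l hkl
      simp only at hkl
      have h1 := hL.add_turn_eq hf ha ha' hP (k := k - l) (ω := ω₀ + turn l) (hre l hω₀) hω₀ (by
        rw [add_assoc, ← turn_add, add_sub_cancel]; exact hkl)
      have := (hmem _).1 h1
      rw [zero_dvd_iff, sub_eq_zero] at this
      exact_mod_cast this
    refine infinite_range_of_injective hinj ((hf.finite_fiber n (F.merc ω₀)).subset ?_)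
    rintro _ ⟨k, rfl⟩
    change f^[n] _ = _
    rw [hL.apply_eq _ (hre k hω₀), F.merc_add_turn]
  refine ⟨m₀.natAbs, Int.natAbs_pos.2 hne, fun ω ω' hω hω' => ⟨fun h => ?_, ?_⟩⟩
  · have h1 := congrArg f^[n] h
    rw [hL.apply_eq ω hω, hL.apply_eq ω' hω'] at h1
    obtain ⟨k, hk⟩ := F.merc_eq_iff.1 h1
    have h2 : m₀ ∣ k := (hmem k).1 (hL.add_turn_eq hf ha ha' hP hω' hω₀ (by
      rw [turn, ← hk, h]))
    obtain ⟨l, hl⟩ := Int.natAbs_dvd.2 h2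
    exact ⟨l, by rw [hk, hl, turn, mul_comm l]⟩
  · rintro ⟨k, rfl⟩
    exact hL.add_turn_eq hf ha ha' hP hω₀ hω' ((hmem _).2
      ((Int.dvd_natAbs.2 dvd_rfl).mul_left k))

end IsMercLift

/-- If `m` is the period of `L`, in full turns, then `L` takes exactly `m` values on the translates
of a point by full turns. -/
theorem encard_image_turn {L : ℂ → Sphere2} {c : ℝ} {m : ℕ} (hm : 0 < m)
    (h : ∀ ω ω' : ℂ, ω.re < c → ω'.re < c → (L ω = L ω' ↔ ∃ k : ℤ, ω = ω' + turn (k * m)))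
    {ω : ℂ} (hω : ω.re < c) : (range fun k : ℤ => L (ω + turn k)).encard = m := by
  have hre : ∀ k : ℤ, (ω + turn k).re < c := by intro k; simpa using hω
  have hinj : ∀ k : ℤ, turn k = 0 → k = 0 := by
    intro k hk
    simpa [turn, Real.pi_ne_zero] using hk
  have himg : (range fun k : ℤ => L (ω + turn k)) =
      (fun k : ℕ => L (ω + turn k)) '' (Finset.range m : Set ℕ) := by
    ext y
    constructor
    · rintro ⟨k, rfl⟩
      refine ⟨(k % m).toNat, ?_, ?_⟩
      · have h1 := Int.emod_lt_of_pos k (show (0 : ℤ) < m by exact_mod_cast hm)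
        have h2 := Int.emod_nonneg k (show (m : ℤ) ≠ 0 by exact_mod_cast hm.ne')
        simp only [Finset.coe_range, mem_Iio]
        omega
      · have h2 := Int.emod_nonneg k (show (m : ℤ) ≠ 0 by exact_mod_cast hm.ne')
        refine (h _ _ (hre _) (hre _)).2 ⟨-(k / m), ?_⟩
        rw [add_assoc, ← turn_add, Int.toNat_of_nonneg h2]
        congr 2
        have := Int.emod_add_mul_ediv k m
        linarith
    · rintro ⟨k, -, rfl⟩
      exact ⟨k, rfl⟩
  rw [himg, InjOn.encard_image, encard_coe_eq_coe_finsetCard, Finset.card_range]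
  intro k hk l hl hkl
  simp only [Finset.coe_range, mem_Iio] at hk hl
  obtain ⟨j, hj⟩ := (h _ _ (hre _) (hre _)).1 hkl
  rw [add_assoc, ← turn_add, add_right_inj] at hj
  have h3 : (k : ℤ) - (l + j * m) = 0 := hinj _ (by rw [sub_eq_add_neg, turn_add, turn_neg, hj]; ring)
  have h4 : (m : ℤ) ∣ (k : ℤ) - l := ⟨j, by linarith⟩
  have h5 : |(k : ℤ) - l| < m := by rw [abs_lt]; omega
  have := Int.eq_zero_of_abs_lt_dvd h4 h5
  omega

theorem IsBranchedCovering.image_component_iterate (hf : IsBranchedCovering f) {V : Set Sphere2}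
    (hV : IsOpen V) (hVc : IsPreconnected V) {x : Sphere2} (hx : f^[n] x ∈ V) :
    f^[n] '' connectedComponentIn (f^[n] ⁻¹' V) x = V := by
  rw [image_component (hf.continuous.iterate n) (hf.isOpenMap_iterate n) hV hx,
    hVc.connectedComponentIn hx]

namespace IsMercLift

include hf ha ha' hP hL in
/-- Near the puncture the image of `L` is a punctured neighbourhood of a point over `p`: a small
half plane is mapped onto a component of the preimage of a small cap, minus its point `x` over
`p`. -/
theorem exists_small_component (O : Sphere2 → Set Sphere2) (hO : ∀ x, f^[n] x = p → IsOpen (O x))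
    (hxO : ∀ x, f^[n] x = p → x ∈ O x)
    (hd : ∀ x x', f^[n] x = p → f^[n] x' = p → (O x ∩ O x').Nonempty → x = x') :
    ∃ b, a ≤ b ∧ b < 1 ∧ ∃ x, f^[n] x = p ∧ ∃ C : Set Sphere2, IsOpen C ∧ x ∈ C ∧ C ⊆ O x ∧
      C \ {x} = L '' {ω | ω.re < capWidth b} ∧ C ∩ f^[n] ⁻¹' {p} = {x} := by
  set T := f^[n] ⁻¹' {p}
  have hOo : IsOpen (⋃ x ∈ T, O x) := isOpen_biUnion fun x hx => hO x hx
  have hcl : IsClosed (f^[n] '' (⋃ x ∈ T, O x)ᶜ) := hf.isClosedMap_iterate n _ hOo.isClosed_compl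
  have hpn : (f^[n] '' (⋃ x ∈ T, O x)ᶜ)ᶜ ∈ 𝓝 p := by
    refine hcl.isOpen_compl.mem_nhds ?_
    rintro ⟨x, hx, hxp⟩
    exact hx (mem_biUnion (show x ∈ T from hxp) (hxO x hxp))
  obtain ⟨b, hab, hb, hbO⟩ := exists_cap_subset hpn ha'
  have hab' : -1 < b := ha.trans_le hab
  have hca := capWidth_anti ha hab hb
  set V := f^[n] ⁻¹' cap p b
  have hVO : V ⊆ ⋃ x ∈ T, O x := by
    intro x hx
    by_contra hxO
    exact hbO hx ⟨x, hxO, rfl⟩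
  have hVo : IsOpen V := (isOpen_cap p b).preimage (hf.continuous.iterate n)
  obtain ⟨ω, hω⟩ := nonempty_halfPlane (capWidth b)
  have hYV : L '' {ω | ω.re < capWidth b} ⊆ V := by
    rintro _ ⟨ω, hω, rfl⟩
    change f^[n] (L ω) ∈ cap p b
    rw [hL.apply_eq ω (lt_of_lt_of_le hω hca), F.merc_mem_cap hab' hb]
    exact hω
  have hYc : IsPreconnected (L '' {ω | ω.re < capWidth b}) :=
    (isPreconnected_halfPlane _).image _ (hL.continuousOn.mono fun _ h => lt_of_lt_of_le h hca)
  have hωV : L ω ∈ V := hYV ⟨ω, hω, rfl⟩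
  set C := connectedComponentIn V (L ω) with hC
  have hYC : L '' {ω | ω.re < capWidth b} ⊆ C :=
    hYc.subset_connectedComponentIn ⟨ω, hω, rfl⟩ hYV
  obtain ⟨x, hxC, hxp⟩ : p ∈ f^[n] '' C := by
    rw [hf.image_component_iterate (isOpen_cap p b) (isConnected_cap hab' hb).isPreconnected hωV]
    exact pole_mem_cap hb
  have hCo : IsOpen C := hVo.connectedComponentIn
  have hCc : IsPreconnected C := isPreconnected_connectedComponentIn
  have hCO : C ⊆ O x := by
    refine hCc.subset_left_of_subset_union (v := ⋃ x' ∈ T \ {x}, O x') (hO x hxp)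
      (isOpen_biUnion fun x' hx' => hO x' hx'.1) ?_ ?_ ⟨x, hxC, hxO x hxp⟩
    · rw [Set.disjoint_left]
      intro z hz hz'
      obtain ⟨x', hx', hzx'⟩ := mem_iUnion₂.1 hz'
      exact hx'.2 (hd x x' hxp hx'.1 ⟨z, hz, hzx'⟩).symm
    · intro z hz
      obtain ⟨x', hx', hzx'⟩ := mem_iUnion₂.1 (hVO (connectedComponentIn_subset _ _ hz))
      by_cases h : x' = x
      · subst h; exact Or.inl hzx'
      · exact Or.inr (mem_biUnion (show x' ∈ T \ {x} from ⟨hx', h⟩) hzx')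
  have hCT : C ∩ f^[n] ⁻¹' {p} = {x} := by
    refine Subset.antisymm ?_ (singleton_subset_iff.2 ⟨hxC, hxp⟩)
    rintro z ⟨hzC, hzp⟩
    exact hd z x hzp hxp ⟨z, hxO z hzp, hCO hzC⟩
  refine ⟨b, hab, hb, x, hxp, C, hCo, hxC, hCO, Subset.antisymm ?_ ?_, hCT⟩
  · refine hL.subset_image hf ha ha' hP hab hb (hCo.sdiff isClosed_singleton)
      (hCc.diff_singleton_sphere hCo x) ?_ (lt_of_lt_of_le hω hca)
      ⟨mem_connectedComponentIn hωV, ?_⟩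
    · rintro z ⟨hzC, hzx⟩
      exact ⟨(connectedComponentIn_subset _ _ hzC : z ∈ V), fun hzp => hzx (hCT.subset ⟨hzC, hzp⟩)⟩
    · intro h
      have : f^[n] (L ω) = p := by rw [show L ω = x from h, hxp]
      rw [hL.apply_eq ω (lt_of_lt_of_le hω hca)] at this
      exact F.merc_ne _ this
  · intro z hz
    refine ⟨hYC hz, ?_⟩
    rintro rfl
    obtain ⟨ω', hω', rfl⟩ := hz
    rw [hL.apply_eq ω' (lt_of_lt_of_le hω' hca)] at hxp
    exact F.merc_ne _ hxp

include hf ha ha' hP hL in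
/-- The period of `L`, counted in full turns, is the local degree of `f^n` at some point over the
puncture. -/
theorem exists_localDegree : ∃ x, f^[n] x = p ∧ 0 < localDegree f^[n] x ∧
    ∀ ω ω', ω.re < capWidth a → ω'.re < capWidth a →
      (L ω = L ω' ↔ ∃ k : ℤ, ω = ω' + turn (k * localDegree f^[n] x)) := by
  obtain ⟨m, hm, hper⟩ := hL.exists_period hf ha ha' hP
  obtain ⟨U, hU, hUd⟩ := (hf.finite_fiber n p).t2_separation
  have hUd' : ∀ x x', f^[n] x = p → f^[n] x' = p → (U x ∩ U x').Nonempty → x = x' := by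
    intro x x' hx hx' hn
    by_contra hne
    exact (not_disjoint_iff_nonempty_inter.2 hn) (hUd hx hx' hne)
  obtain ⟨b, hab, hb, x, hxp, C, hCo, hxC, hCU, hCL, hCT⟩ := hL.exists_small_component hf ha ha' hP U
    (fun x _ => (hU x).2) (fun x _ => (hU x).1) hUd'
  have hca := capWidth_anti ha hab hb
  -- the fibre over a point near the puncture, inside the image of `L`
  have hfib : ∀ ω : ℂ, ω.re < capWidth a → ∀ ω' : ℂ, ω'.re < capWidth a →
      f^[n] (L ω') = F.merc ω → L ω' ∈ range fun k : ℤ => L (ω + turn k) := by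
    intro ω hω ω' hω' h
    rw [hL.apply_eq ω' hω'] at h
    obtain ⟨k, rfl⟩ := F.merc_eq_iff.1 h
    exact ⟨k, rfl⟩
  -- on `C` every point other than `p` has at most one preimage for each turn modulo the period
  have hle : localDegree f^[n] x ≤ m := by
    refine localDegree_le (hCo.mem_nhds hxC) fun y => ?_
    by_cases hy : y = p
    · rw [hy, inter_comm, hCT, encard_singleton]
      exact_mod_cast hm
    rcases (f^[n] ⁻¹' {y} ∩ C).eq_empty_or_nonempty with he | ⟨z, hzy, hzC⟩
    · rw [he]; simp
    have key : ∀ z, f^[n] z = y → z ∈ C → ∃ ω, ω.re < capWidth a ∧ L ω = z := by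
      intro z hz hzC
      have : z ∈ C \ {x} := ⟨hzC, fun h => hy (by rw [← hz, show z = x from h, hxp])⟩
      rw [hCL] at this
      obtain ⟨ω, hω, h⟩ := this
      exact ⟨ω, lt_of_lt_of_le hω hca, h⟩
    obtain ⟨ω, hω, rfl⟩ := key z hzy hzC
    rw [← encard_image_turn hm hper hω]
    refine encard_le_encard ?_
    rintro z' ⟨hz', hzC'⟩
    obtain ⟨ω', hω', rfl⟩ := key z' hz' hzC'
    refine hfib ω hω ω' hω' ?_
    rw [← hL.apply_eq ω hω, show f^[n] (L ω) = y from hzy]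
    exact hz'
  -- conversely, a small half plane is mapped into any given neighbourhood of `x`, and contains
  -- all `m` preimages of the points which it covers
  have hge : m ≤ localDegree f^[n] x := by
    classical
    obtain ⟨W₀, hW₀, h₀⟩ := hf.iterate_exists_nhds_encard_le n x
    obtain ⟨W, hW, hWm⟩ := exists_nhds_encard_le_localDegree hW₀ h₀
    set O : Sphere2 → Set Sphere2 := fun z => if z = x then U x ∩ interior W else U z with hOdef
    have hOU : ∀ z, O z ⊆ U z := by
      intro z
      simp only [hOdef]
      split_ifs with h
      · rw [h]; exact inter_subset_left
      · exact subset_rfl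
    obtain ⟨b', hab', hb', x', hxp', C', -, -, hCO', hCL', -⟩ :=
      hL.exists_small_component hf ha ha' hP O
      (fun z _ => by
        simp only [hOdef]; split_ifs
        · exact (hU x).2.inter isOpen_interior
        · exact (hU z).2)
      (fun z _ => by
        simp only [hOdef]; split_ifs with h
        · subst h; exact ⟨(hU z).1, mem_interior_iff_mem_nhds.2 hW⟩
        · exact (hU z).1)
      (fun z z' hz hz' h => hUd' z z' hz hz' (h.mono (inter_subset_inter (hOU z) (hOU z'))))
    have hca' := capWidth_anti ha hab' hb'
    obtain ⟨ω, hω⟩ := nonempty_halfPlane (min (capWidth b) (capWidth b'))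
    have hω1 : ω.re < capWidth b := lt_of_lt_of_le hω (min_le_left _ _)
    have hω2 : ω.re < capWidth b' := lt_of_lt_of_le hω (min_le_right _ _)
    have hωC : L ω ∈ C := (hCL.symm.subset ⟨ω, hω1, rfl⟩ : _ ∈ C \ {x}).1
    have hωC' : L ω ∈ C' := (hCL'.symm.subset ⟨ω, hω2, rfl⟩ : _ ∈ C' \ {x'}).1
    obtain rfl : x = x' := hUd' x x' hxp hxp' ⟨L ω, hCU hωC, hOU _ (hCO' hωC')⟩
    have h1 := hWm (F.merc ω)
    rw [← Nat.cast_le (α := ℕ∞), ← encard_image_turn hm hper (lt_of_lt_of_le hω2 hca')]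
    refine (encard_le_encard ?_).trans h1
    rintro _ ⟨k, rfl⟩
    have hk : (ω + turn k).re < capWidth b' := by simpa using hω2
    refine ⟨?_, ?_⟩
    · change f^[n] (L (ω + turn k)) = F.merc ω
      rw [hL.apply_eq _ (lt_of_lt_of_le hk hca'), F.merc_add_turn]
    · have h2 : L (ω + turn k) ∈ C' := (hCL'.symm.subset ⟨_, hk, rfl⟩ : _ ∈ C' \ {x}).1
      have h3 := hCO' h2
      simp only [hOdef, if_true] at h3
      exact interior_subset h3.2
  obtain rfl : localDegree f^[n] x = m := le_antisymm hle hge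
  exact ⟨x, hxp, hm, hper⟩

end IsMercLift

include hf ha ha' hP in
/-- A component of the preimage of a cap under `f^n` has at most as many sheets, away from the
pole, as the bound for the local degrees. -/
theorem IsBranchedCovering.encard_component_le {N : ℕ} (hN : ∀ x, localDegree f^[n] x ≤ N)
    {y v : Sphere2} (hv : v ≠ p) :
    (connectedComponentIn (f^[n] ⁻¹' cap p a) y ∩ f^[n] ⁻¹' {v}).encard ≤ N := by
  rcases (connectedComponentIn (f^[n] ⁻¹' cap p a) y ∩ f^[n] ⁻¹' {v}).eq_empty_or_nonempty with
    he | ⟨z, hz, hzv⟩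
  · rw [he]; simp
  set C := connectedComponentIn (f^[n] ⁻¹' cap p a) y
  have hCsub : C ⊆ f^[n] ⁻¹' cap p a := connectedComponentIn_subset _ _
  have hCo : IsOpen C := ((isOpen_cap p a).preimage (hf.continuous.iterate n)).connectedComponentIn
  have hfin := hf.finite_fiber n p
  have hzv' : f^[n] z = v := hzv
  have hzc : f^[n] z ∈ cap p a := hCsub hz
  obtain ⟨F⟩ : Nonempty (TangentFrame p) := inferInstance
  obtain ⟨ω, hω⟩ := F.exists_merc_eq (TangentFrame.inner_ne_of_mem_cap ha hzc)
    (by rw [hzv']; exact hv)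
  have hωa : ω.re < capWidth a := (F.merc_mem_cap ha ha').1 (by rw [hω]; exact hzc)
  obtain ⟨L, hL, hLω⟩ := hf.exists_mercLift (n := n) ha ha' hP hωa hω.symm
  obtain ⟨x, -, hm, hper⟩ := hL.exists_localDegree hf ha ha' hP
  refine le_trans ?_ (Nat.cast_le.2 (hN x))
  rw [← encard_image_turn hm hper hωa]
  refine encard_le_encard ?_
  have hsub := hL.subset_image hf ha ha' hP le_rfl ha' (hCo.sdiff hfin.isClosed)
    (isPreconnected_connectedComponentIn.diff_finite_sphere hCo hfin)
    (fun w hw => ⟨hCsub hw.1, hw.2⟩) hωa (by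
      rw [hLω]; exact ⟨hz, fun h => hv (hzv'.symm.trans h)⟩)
  rintro w ⟨hwC, hwv⟩
  have hwv' : f^[n] w = v := hwv
  obtain ⟨ω', hω', rfl⟩ := hsub ⟨hwC, fun h => hv (hwv'.symm.trans h)⟩
  rw [hL.apply_eq ω' hω', ← hzv', ← hω] at hwv'
  obtain ⟨k, rfl⟩ := F.merc_eq_iff.1 hwv'
  exact ⟨k, rfl⟩

end Lift

/-! ### The monodromy action factors through the orbifold group -/

/-- A round circle about `p` is a vertical line in Mercator coordinates. -/
theorem TangentFrame.merc_eq_circle {p : Sphere2} (F : TangentFrame p) {θ : ℝ} (hθ : 0 < θ)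
    (hθ' : θ < Real.pi) (t : ℝ) :
    (F.merc (Real.log (Real.tan (θ / 2)) + t * Complex.I) : Space3) =
      Real.cos θ • (p : Space3) + Real.sin θ • (Real.cos t • F.u + Real.sin t • F.v) := by
  have hC : 0 < Real.cos (θ / 2) := Real.cos_pos_of_mem_Ioo ⟨by linarith, by linarith⟩
  have hT : 0 < Real.tan (θ / 2) := Real.tan_pos_of_pos_of_lt_pi_div_two (by linarith) (by linarith)
  set T := Real.tan (θ / 2) with hTdef
  have hexp : Complex.exp (Real.log T + t * Complex.I) = T * Complex.exp (t * Complex.I) := by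
    rw [Complex.exp_add, ← Complex.ofReal_exp, Real.exp_log hT]
  have hn : ‖Complex.exp (Real.log T + t * Complex.I)‖ = T := by
    rw [hexp, norm_mul, Complex.norm_exp_ofReal_mul_I, mul_one, Complex.norm_real,
      Real.norm_of_nonneg hT.le]
  have hre : (Complex.exp (Real.log T + t * Complex.I)).re = T * Real.cos t := by
    rw [hexp, Complex.re_ofReal_mul, Complex.exp_ofReal_mul_I_re]
  have him : (Complex.exp (Real.log T + t * Complex.I)).im = T * Real.sin t := by
    rw [hexp, Complex.im_ofReal_mul, Complex.exp_ofReal_mul_I_im]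
  have hTT : 1 + T ^ 2 = (Real.cos (θ / 2) ^ 2)⁻¹ := by
    rw [hTdef, ← Real.inv_one_add_tan_sq hC.ne', inv_inv]
  have hTC : T * Real.cos (θ / 2) = Real.sin (θ / 2) := Real.tan_mul_cos hC.ne'
  have hcos : (1 - T ^ 2) / (1 + T ^ 2) = Real.cos θ := by
    have h2 : Real.cos θ = Real.cos (θ / 2) ^ 2 - Real.sin (θ / 2) ^ 2 := by
      rw [← Real.cos_two_mul', mul_div_cancel₀ θ two_ne_zero]
    rw [hTT, div_inv_eq_mul, h2, ← hTC]; ring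
  have hsin : 2 * T / (1 + T ^ 2) = Real.sin θ := by
    have h2 : Real.sin θ = 2 * Real.sin (θ / 2) * Real.cos (θ / 2) := by
      rw [← Real.sin_two_mul, mul_div_cancel₀ θ two_ne_zero]
    rw [hTT, div_inv_eq_mul, h2, ← hTC]; ring
  simp only [TangentFrame.merc, TangentFrame.point, hn, hre, him]
  rw [hcos, ← hsin]
  module

/-- The loops all of whose lifts to preimages of the base point are closed. -/
def liftKernel (f : Sphere2 → Sphere2) (b : PuncturedSphere f) :
    Subgroup (FundamentalGroup (PuncturedSphere f) b) where
  carrier := {g | ∀ n y, f^[n] y = b → Transport (f := f) n (a := b) (a' := b) g y y}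
  one_mem' := fun _ _ h => Transport.refl h
  mul_mem' := fun hg hh n y hy => (hh n y hy).trans (hg n y hy)
  inv_mem' := fun hg n y hy => (hg n y hy).symm

theorem IsBranchedCovering.normal_liftKernel (hf : IsBranchedCovering f) (b : PuncturedSphere f) :
    (liftKernel f b).Normal := by
  constructor
  intro g hg h n y hy
  obtain ⟨z, hz⟩ := hf.exists_transport (n := n) (h⁻¹ : FundamentalGroup (PuncturedSphere f) b) hy
  have h1 : Transport (f := f) n (a := b) (a' := b) h z y := by
    have := hz.symm
    rw [← FundamentalGroup.inv_def, inv_inv] at this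
    exact this
  exact hz.trans ((hg n z hz.iterate_right).trans h1)

/-- Powers of peripheral loops by the weight of the puncture lift to closed loops, since the
number of turns after which a lift closes up is a local degree, which divides the weight. -/
theorem IsBranchedCovering.peripheral_pow_mem (hf : IsBranchedCovering f)
    (hfin : (postcriticalSet f).Finite) {b : PuncturedSphere f} {p : Sphere2}
    {g : FundamentalGroup (PuncturedSphere f) b} (hg : g ∈ peripheralClasses f b p) :
    g ^ orbifoldWeight f p ∈ liftKernel f b := by
  obtain ⟨θ, u, v, c, hθ, hθ', ⟨horth, hc⟩, hq, a₀, δ, κ, hκ, rfl⟩ := hg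
  intro n y hy
  let F : TangentFrame p := ⟨u, v, horth⟩
  obtain ⟨a, ⟨haP, ha⟩, hac⟩ : ∃ a, ((∀ q ∈ postcriticalSet f, q ≠ p →
      inner ℝ (p : Space3) (q : Space3) < a) ∧ -1 < a) ∧ a < Real.cos θ := by
    have h1 : ∀ᶠ a in 𝓝[<] Real.cos θ, ∀ q ∈ postcriticalSet f, q ≠ p →
        inner ℝ (p : Space3) (q : Space3) < a := by
      rw [eventually_all_finite hfin]
      intro q hqP
      by_cases hqp : q = p
      · exact .of_forall fun _ h => absurd hqp h
      · filter_upwards [mem_nhdsWithin_of_mem_nhds (lt_mem_nhds (hq q hqP hqp))] with a ha _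
        exact ha
    have h2 : ∀ᶠ a in 𝓝[<] Real.cos θ, -1 < a := by
      refine mem_nhdsWithin_of_mem_nhds (lt_mem_nhds ?_)
      rw [← Real.cos_pi]
      exact Real.cos_lt_cos_of_nonneg_of_le_pi hθ.le le_rfl hθ'
    exact ((h1.and h2).and self_mem_nhdsWithin).exists
  have ha' : a < 1 := hac.trans_le (Real.cos_le_one θ)
  have hP : ∀ q ∈ postcriticalSet f, q ∈ cap p a → q = p := by
    intro q hqP hqa
    by_contra hqp
    exact (haP q hqP hqp).asymm hqa
  set s : ℝ := Real.log (Real.tan (θ / 2))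
  have hcm : ∀ t : ℝ, c t = F.merc (s + t * Complex.I) := fun t =>
    Subtype.ext ((hc t).trans (F.merc_eq_circle hθ hθ' t).symm)
  have hs : s < capWidth a := by
    have h1 : F.merc s ∈ cap p a := by
      have := hcm 0
      simp only [Complex.ofReal_zero, zero_mul, add_zero] at this
      rw [← this, mem_cap, hc 0, inner_add_right, real_inner_smul_right, p.inner_self,
        real_inner_smul_right, inner_add_right, real_inner_smul_right, real_inner_smul_right,
        show inner ℝ (p : Space3) u = 0 from F.inner_pu,
        show inner ℝ (p : Space3) v = 0 from F.inner_pv]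
      simpa using hac
    simpa using (F.merc_mem_cap ha ha').1 h1
  have ha₀ : (a₀ : Sphere2) = F.merc s := by
    have h1 := hκ 0
    have h2 := hcm 0
    simp only [Path.source, Icc.coe_zero, mul_zero] at h1
    simp only [Complex.ofReal_zero, zero_mul, add_zero] at h2
    rw [h1, h2]
  obtain ⟨y₁, hy₁⟩ := hf.exists_transport (n := n) (.mk δ) hy
  have hsre : (s : ℂ).re < capWidth a := by simpa using hs
  obtain ⟨L, hL, hLs⟩ := hf.exists_mercLift (n := n) (F := F) (y := y₁) ha ha' hP hsre
    (by rw [hy₁.iterate_right, ha₀])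
  obtain ⟨x, hxp, -, hper⟩ := hL.exists_localDegree hf ha ha' hP
  have hre : ∀ k : ℤ, (s + turn k : ℂ).re < capWidth a := by intro k; simpa using hs
  -- one turn around the circle moves the parameter of `L` by one period
  have hstep : ∀ k : ℤ, Transport n (.mk κ) (L (s + turn k)) (L (s + turn (k + 1))) := by
    intro k
    have hret : ∀ t : I, (s + turn k + t * (2 * Real.pi * Complex.I) : ℂ) ∈
        {ω : ℂ | ω.re < capWidth a} := by
      intro t
      have : ((t : ℂ) * (2 * Real.pi * Complex.I)).re = 0 := by simp
      simp only [mem_ofPred_eq, Complex.add_re, this, turn_re, Complex.ofReal_re]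
      linarith
    refine ⟨κ, ⟨⟨fun t => L (s + turn k + t * (2 * Real.pi * Complex.I)),
      hL.continuousOn.comp_continuous (by fun_prop) hret⟩, by simp, ?_⟩, rfl, fun t => ?_⟩
    · change L (s + turn k + ((1 : I) : ℝ) * _) = _
      congr 1
      simp [turn]; ring
    · change f^[n] (L _) = _
      rw [hL.apply_eq _ (hret t), hκ, hcm]
      rw [show (s + turn k + t * (2 * Real.pi * Complex.I) : ℂ) =
        s + ((2 * Real.pi * t : ℝ) : ℂ) * Complex.I + turn k by push_cast; ring, F.merc_add_turn]
  set g : FundamentalGroup (PuncturedSphere f) b :=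
    FundamentalGroup.fromPath (Path.Homotopic.Quotient.mk ((δ.trans κ).trans δ.symm))
  have hpow : ∀ k : ℕ, ∃ z, Transport (f := f) n (a := b) (a' := b) (g ^ k) y z ∧
      Transport n (.mk δ) z (L (s + turn k)) := by
    intro k
    induction k with
    | zero => exact ⟨y, Transport.refl hy, by simpa [hLs] using hy₁⟩
    | succ k ih =>
      obtain ⟨z, hz, hzδ⟩ := ih
      have h1 := hzδ.trans (hstep k)
      obtain ⟨z', hz'⟩ := hf.exists_transport (n := n) (a := a₀) (.mk δ.symm)
        (y := L (s + turn (k + 1))) (hstep k).iterate_right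
      refine ⟨z', ?_, ?_⟩
      · rw [pow_succ', FundamentalGroup.mul_def]
        refine hz.trans ?_
        have := h1.trans hz'
        rwa [← Path.Homotopic.Quotient.mk_trans, ← Path.Homotopic.Quotient.mk_trans] at this
      · have := hz'.symm
        rw [← Path.Homotopic.Quotient.mk_symm, Path.symm_symm] at this
        simpa using this
  obtain ⟨z, hz, hzδ⟩ := hpow (orbifoldWeight f p)
  -- if there is no common multiple then the weight is `0`, which every local degree divides
  have hdvd : localDegree f^[n] x ∣ orbifoldWeight f p := by
    rcases {k : ℕ | 0 < k ∧ ∀ (n : ℕ) (x : Sphere2), f^[n] x = p →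
      localDegree f^[n] x ∣ k}.eq_empty_or_nonempty with he | hne
    · rw [orbifoldWeight, he, Nat.sInf_empty]; exact dvd_zero _
    · exact (Nat.sInf_mem hne).2 n x hxp
  have hclose : L (s + turn (orbifoldWeight f p)) = y₁ := by
    rw [← hLs]
    obtain ⟨l, hl⟩ := hdvd
    refine (hper _ _ (hre _) hsre).2 ⟨l, ?_⟩
    rw [hl]; push_cast; rw [mul_comm]
  rw [hclose] at hzδ
  rwa [hf.transport_unique_left hzδ hy₁] at hz

theorem IsBranchedCovering.orbifoldRelations_le (hf : IsBranchedCovering f)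
    (hfin : (postcriticalSet f).Finite) (b : PuncturedSphere f) :
    orbifoldRelations f b ≤ liftKernel f b := by
  have := hf.normal_liftKernel b
  refine Subgroup.normalClosure_le_normal ?_
  rintro _ ⟨p, -, g, hg, rfl⟩
  exact hf.peripheral_pow_mem hfin hg

/-! ### Quasi-isometries between one-complexes -/

theorem SimpleGraph.Connected.dist_map_le {V W : Type*} {G : SimpleGraph V} {H : SimpleGraph W}
    (hG : G.Connected) (hH : H.Connected) {φ : V → W} {A : ℕ}
    (h : ∀ a a', G.Adj a a' → H.dist (φ a) (φ a') ≤ A) (a a' : V) :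
    H.dist (φ a) (φ a') ≤ A * G.dist a a' := by
  obtain ⟨w, hw⟩ := hG.exists_walk_length_eq_dist a a'
  rw [← hw]
  clear hw
  induction w with
  | nil => simp
  | cons hadj w ih =>
    refine hH.dist_triangle.trans ((add_le_add (h _ _ hadj) ih).trans_eq ?_)
    rw [SimpleGraph.Walk.length_cons]; ring

namespace OneComplex

variable {K L : OneComplex}

theorem dist_src_le (d : K.D) : K.graph.dist (K.src d) (K.src (K.rev d)) ≤ 1 := by
  by_cases h : K.src d = K.src (K.rev d)
  · rw [h, SimpleGraph.dist_self]; exact zero_le_one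
  · exact (SimpleGraph.dist_eq_one_iff_adj.2
      ((SimpleGraph.fromRel_adj _ _ _).2 ⟨h, Or.inl ⟨d, rfl, rfl⟩⟩)).le

theorem edgePoint_eq {d d' : K.D} {t t' : Ioo (0 : ℝ) 1} (h : edgePoint d t = edgePoint d' t') :
    d' = d ∨ d' = K.rev d := by
  let E : Quot K.EdgeRel → Set K.D := Quot.lift (fun p => {p.1, K.rev p.1}) (by
    rintro ⟨e, s⟩ ⟨e', s'⟩ ⟨h, -⟩
    obtain rfl : e' = K.rev e := h
    simp only [K.rev_rev]
    exact Set.pair_comm _ _)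
  have h1 : E (Quot.mk _ (d, t)) = E (Quot.mk _ (d', t')) := congrArg E (Sum.inr.inj h)
  have h2 : d' ∈ E (Quot.mk _ (d, t)) := by rw [h1]; exact Or.inl rfl
  exact h2

theorem At.dist_le {p : K.Point} {a a' : K.V} {s s' : ℝ} (h : At p a s) (h' : At p a' s') :
    K.graph.dist a a' ≤ 1 := by
  rcases h with ⟨rfl, -⟩ | ⟨d, t, rfl, rfl, -⟩
  · rcases h' with ⟨h, -⟩ | ⟨d', t', h, -⟩
    · obtain rfl : a = a' := Sum.inl.inj h
      simp
    · exact absurd h (by simp [vertex, edgePoint])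
  · rcases h' with ⟨h, -⟩ | ⟨d', t', h, rfl, -⟩
    · exact absurd h (by simp [vertex, edgePoint])
    · rcases edgePoint_eq h with rfl | rfl
      · simp
      · exact dist_src_le d

theorem At.mem_Icc {p : K.Point} {a : K.V} {s : ℝ} (h : At p a s) : 0 ≤ s ∧ s ≤ 1 := by
  rcases h with ⟨-, rfl⟩ | ⟨d, t, -, -, rfl⟩
  · norm_num
  · exact ⟨t.2.1.le, t.2.2.le⟩

theorem at_vertex (a : K.V) : At (vertex a) a 0 := Or.inl ⟨rfl, rfl⟩

theorem at_edgePoint (d : K.D) (t : Ioo (0 : ℝ) 1) : At (edgePoint d t) (K.src d) t :=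
  Or.inr ⟨d, t, rfl, rfl, rfl⟩

theorem exists_at (p : K.Point) : ∃ a s, At p a s := by
  rcases p with a | e
  · exact ⟨a, 0, at_vertex a⟩
  · induction e using Quot.ind with
    | mk x => exact ⟨_, _, at_edgePoint x.1 x.2⟩

theorem nonneg_of_mem {p q : K.Point} {r : ℝ}
    (hr : r ∈ ({r | ∃ (a a' : K.V) (s t : ℝ), At p a s ∧ At q a' t ∧
      r = s + K.graph.dist a a' + t} ∪ {r | ∃ (d : K.D) (s t : Ioo (0 : ℝ) 1),
      p = edgePoint d s ∧ q = edgePoint d t ∧ r = |(s : ℝ) - t|} : Set ℝ)) : 0 ≤ r := by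
  rcases hr with ⟨a, a', s, t, h, h', rfl⟩ | ⟨d, s, t, -, -, rfl⟩
  · have := h.mem_Icc
    have := h'.mem_Icc
    have : (0 : ℝ) ≤ K.graph.dist a a' := Nat.cast_nonneg _
    linarith
  · exact abs_nonneg _

theorem pointDist_nonneg (p q : K.Point) : 0 ≤ pointDist p q :=
  Real.sInf_nonneg fun _ => nonneg_of_mem

theorem pointDist_le {p q : K.Point} {a a' : K.V} {s t : ℝ} (h : At p a s) (h' : At q a' t) :
    pointDist p q ≤ K.graph.dist a a' + 2 := by
  refine (csInf_le ⟨0, fun r hr => nonneg_of_mem hr⟩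
    (Or.inl ⟨a, a', s, t, h, h', rfl⟩)).trans ?_
  linarith [h.mem_Icc.2, h'.mem_Icc.2]

theorem le_pointDist (hK : K.graph.Connected) {p q : K.Point} {a a' : K.V} {s t : ℝ}
    (h : At p a s) (h' : At q a' t) : (K.graph.dist a a' : ℝ) ≤ pointDist p q + 2 := by
  rw [← sub_le_iff_le_add]
  refine le_csInf ⟨_, Or.inl ⟨a, a', s, t, h, h', rfl⟩⟩ ?_
  rintro r (⟨a₁, a₁', s₁, t₁, h₁, h₁', rfl⟩ | ⟨d, s₁, t₁, rfl, rfl, rfl⟩)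
  · have h1 : K.graph.dist a a' ≤ 1 + K.graph.dist a₁ a₁' + 1 :=
      (hK.dist_triangle (v := a₁')).trans (add_le_add ((hK.dist_triangle (v := a₁)).trans
        (add_le_add (h.dist_le h₁) le_rfl)) (h₁'.dist_le h'))
    have h2 : (K.graph.dist a a' : ℝ) ≤ 1 + K.graph.dist a₁ a₁' + 1 := by exact_mod_cast h1
    linarith [h₁.mem_Icc.1, h₁'.mem_Icc.1]
  · have h1 : K.graph.dist a a' ≤ 1 + 1 :=
      (hK.dist_triangle (v := K.src d)).trans
        (add_le_add (h.dist_le (at_edgePoint d s₁)) ((at_edgePoint d t₁).dist_le h'))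
    have h2 : (K.graph.dist a a' : ℝ) ≤ 2 := by exact_mod_cast h1
    linarith [abs_nonneg ((s₁ : ℝ) - t₁)]

/-- A map of realizations which sends every point to the image of a nearby vertex is a
quasi-isometry if its restriction to the vertices is one. -/
theorem isQuasiIsometry_of_vertices (hK : K.graph.Connected) (hL : L.graph.Connected)
    {φ : K.V → L.V} {Φ : K.Point → L.Point} (hΦ : ∀ p, ∃ a s, At p a s ∧ Φ p = vertex (φ a))
    {A A' c B : ℕ} (hlip : ∀ a a', K.graph.Adj a a' → L.graph.dist (φ a) (φ a') ≤ A)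
    (hlow : ∀ a a', K.graph.dist a a' ≤ A' * L.graph.dist (φ a) (φ a') + c)
    (hsurj : ∀ v, ∃ a, L.graph.dist v (φ a) ≤ B) : IsQuasiIsometry Φ := by
  set M : ℝ := A + A' + 1
  have hM : 1 ≤ M := by
    have h1 : (0 : ℝ) ≤ A := Nat.cast_nonneg _
    have h2 : (0 : ℝ) ≤ A' := Nat.cast_nonneg _
    simp only [M]; linarith
  have hc : (0 : ℝ) ≤ c := Nat.cast_nonneg _
  refine ⟨M, 2 * M + c + 2, B + 2, hM, by linarith, by positivity, fun p q => ?_, fun y => ?_⟩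
  · obtain ⟨a, s, ha, hpa⟩ := hΦ p
    obtain ⟨a', s', ha', hqa'⟩ := hΦ q
    rw [hpa, hqa']
    have h1 := pointDist_le ha ha'
    have h2 := le_pointDist hK ha ha'
    have h3 := pointDist_le (at_vertex (φ a)) (at_vertex (φ a'))
    have h4 := le_pointDist hL (at_vertex (φ a)) (at_vertex (φ a'))
    have h5 := pointDist_nonneg p q
    have h6 := pointDist_nonneg (vertex (φ a)) (vertex (φ a'))
    have h7 : (L.graph.dist (φ a) (φ a') : ℝ) ≤ A * K.graph.dist a a' := by
      exact_mod_cast hK.dist_map_le hL hlip a a'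
    have h8 : (K.graph.dist a a' : ℝ) ≤ A' * L.graph.dist (φ a) (φ a') + c := by
      exact_mod_cast hlow a a'
    have hA : (0 : ℝ) ≤ A := Nat.cast_nonneg _
    have hA' : (0 : ℝ) ≤ A' := Nat.cast_nonneg _
    have hAM : (A : ℝ) ≤ M := by simp only [M]; linarith
    have hAM' : (A' : ℝ) ≤ M := by simp only [M]; linarith
    constructor
    · have h9 : (A' : ℝ) * L.graph.dist (φ a) (φ a') ≤
          M * (pointDist (vertex (φ a)) (vertex (φ a')) + 2) :=
        mul_le_mul hAM' h4 (Nat.cast_nonneg _) (by linarith)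
      have h10 : pointDist p q ≤ M * (pointDist (vertex (φ a)) (vertex (φ a')) +
          (2 * M + c + 2)) := by nlinarith
      rw [one_div, sub_le_iff_le_add, inv_mul_le_iff₀ (by linarith)]
      exact h10
    · have h9 : (A : ℝ) * K.graph.dist a a' ≤ M * (pointDist p q + 2) :=
        mul_le_mul hAM h2 (Nat.cast_nonneg _) (by linarith)
      linarith
  · obtain ⟨v, s, hv⟩ := exists_at y
    obtain ⟨a, ha⟩ := hsurj v
    obtain ⟨a₁, s₁, ha₁, h₁⟩ := hΦ (vertex a)
    obtain rfl : a₁ = a := by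
      rcases ha₁ with ⟨h, -⟩ | ⟨d, t, h, -⟩
      · exact (Sum.inl.inj h).symm
      · exact absurd h (by simp [vertex, edgePoint])
    refine ⟨vertex a₁, ?_⟩
    rw [h₁]
    have h2 : (L.graph.dist v (φ a₁) : ℝ) ≤ B := by exact_mod_cast ha
    linarith [pointDist_le hv (at_vertex (φ a₁))]

end OneComplex

/-! ### The selfsimilarity complex -/

theorem Transport.apply_succ {n : ℕ} {a a' : PuncturedSphere f}
    {c : Path.Homotopic.Quotient a a'} {y z : Sphere2} (hc : Continuous f)
    (h : Transport (n + 1) c y z) : Transport n c (f y) (f z) := by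
  obtain ⟨η, ζ, rfl, h⟩ := h
  exact ⟨η, ζ.map hc, rfl, h⟩

theorem IsBranchedCovering.liftEnd_eq (hf : IsBranchedCovering f) {n : ℕ} {a a' : PuncturedSphere f}
    {η : Path a a'} {ξ : I → Sphere2} (hξ : ∀ t, ξ t = η t) {y z : Sphere2}
    (h : Transport n (.mk η) y z) : liftEnd f^[n] ξ y = z := by
  obtain ⟨z', ζ, hζ⟩ := hf.exists_lift η h.iterate_left
  have hex : ∃ ζ : C(I, Sphere2), ζ 0 = y ∧ ∀ t, f^[n] (ζ t) = ξ t :=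
    ⟨ζ.toContinuousMap, ζ.source, fun t => (hζ t).trans (hξ t).symm⟩
  rw [liftEnd, dif_pos hex]
  refine hf.transport_unique ⟨η, ⟨hex.choose, hex.choose_spec.1, rfl⟩, rfl, fun t => ?_⟩ h
  exact (hex.choose_spec.2 t).trans (hξ t)

namespace DefiningData

variable (𝒟 : DefiningData f)

theorem code_notMem (x : 𝒟.X) : (𝒟.code x : Sphere2) ∉ postcriticalSet f := by
  have := 𝒟.arc_notMem x 1
  rwa [Path.target] at this

/-- The connecting path of a letter as a path in the punctured sphere. -/
def arcPath (x : 𝒟.X) : Path 𝒟.b (⟨𝒟.code x, 𝒟.code_notMem x⟩ : PuncturedSphere f) where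
  toFun t := ⟨𝒟.arc x t, 𝒟.arc_notMem x t⟩
  source' := Subtype.ext (𝒟.arc x).source
  target' := Subtype.ext (𝒟.arc x).target

theorem apply_code (x : 𝒟.X) : f (𝒟.code x) = 𝒟.b := (𝒟.code x).2

section

variable (hf : IsBranchedCovering f)
include hf

theorem iterate_Lam_and_transport (w : List 𝒟.X) : f^[w.length] (𝒟.Lam w) = 𝒟.b ∧
    ∀ x, Transport w.length (.mk (𝒟.arcPath x)) (𝒟.Lam w) (𝒟.Lam (x :: w)) := by
  have key : ∀ w : List 𝒟.X, f^[w.length] (𝒟.Lam w) = 𝒟.b →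
      ∀ x, Transport w.length (.mk (𝒟.arcPath x)) (𝒟.Lam w) (𝒟.Lam (x :: w)) := by
    intro w hw x
    obtain ⟨z, hz⟩ := hf.exists_transport (.mk (𝒟.arcPath x)) hw
    have : 𝒟.Lam (x :: w) = z := hf.liftEnd_eq (η := 𝒟.arcPath x) (fun _ => rfl) hz
    rwa [this]
  have h : f^[w.length] (𝒟.Lam w) = 𝒟.b := by
    induction w with
    | nil => rfl
    | cons x w ih =>
      rw [List.length_cons, Function.iterate_succ_apply', (key w ih x).iterate_right]
      exact 𝒟.apply_code x
  exact ⟨h, key w h⟩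

theorem iterate_Lam (w : List 𝒟.X) : f^[w.length] (𝒟.Lam w) = 𝒟.b :=
  (𝒟.iterate_Lam_and_transport hf w).1

theorem transport_arcPath (w : List 𝒟.X) (x : 𝒟.X) :
    Transport w.length (.mk (𝒟.arcPath x)) (𝒟.Lam w) (𝒟.Lam (x :: w)) :=
  (𝒟.iterate_Lam_and_transport hf w).2 x

theorem iterate_Lam_cons (w : List 𝒟.X) (x : 𝒟.X) :
    f^[w.length] (𝒟.Lam (x :: w)) = 𝒟.code x := (𝒟.transport_arcPath hf w x).iterate_right

theorem Lam_injective {w w' : List 𝒟.X} (hl : w.length = w'.length) (h : 𝒟.Lam w = 𝒟.Lam w') :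
    w = w' := by
  induction w generalizing w' with
  | nil => exact (List.length_eq_zero_iff.1 hl.symm).symm
  | cons x w ih =>
    rcases w' with _ | ⟨x', w'⟩
    · simp at hl
    have hl' : w.length = w'.length := by simpa using hl
    have h1 := 𝒟.iterate_Lam_cons hf w x
    rw [h, hl', 𝒟.iterate_Lam_cons hf w' x'] at h1
    obtain rfl : x' = x := 𝒟.code.injective (Subtype.ext h1)
    have h2 := 𝒟.transport_arcPath hf w x'
    have h3 := 𝒟.transport_arcPath hf w' x'
    rw [← h, ← hl'] at h3
    rw [ih hl' (hf.transport_unique_left h2 h3)]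

/-- Every point of `f^{-n}(b)` is `Λ(w)` for a word `w` of length `n`. -/
theorem exists_Lam_eq {n : ℕ} {y : Sphere2} (hy : f^[n] y = 𝒟.b) :
    ∃ w : List 𝒟.X, w.length = n ∧ 𝒟.Lam w = y := by
  induction n generalizing y with
  | zero => exact ⟨[], rfl, hy.symm⟩
  | succ n ih =>
    rw [Function.iterate_succ_apply'] at hy
    obtain ⟨x, hx⟩ := 𝒟.code.surjective ⟨f^[n] y, hy⟩
    obtain ⟨z, hz⟩ := hf.exists_transport (n := n) (y := y) (a := ⟨𝒟.code x, 𝒟.code_notMem x⟩)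
      (.mk (𝒟.arcPath x).symm) (congrArg Subtype.val hx).symm
    obtain ⟨w, rfl, rfl⟩ := ih hz.iterate_right
    refine ⟨x :: w, rfl, hf.transport_unique (𝒟.transport_arcPath hf w x) ?_⟩
    have := hz.symm
    rwa [← Path.Homotopic.Quotient.mk_symm, Path.symm_symm] at this

theorem apply_Lam (w : List 𝒟.X) (hw : w ≠ []) : f (𝒟.Lam w) = 𝒟.Lam w.dropLast := by
  induction w with
  | nil => exact absurd rfl hw
  | cons x w ih =>
    rcases w with _ | ⟨x', w⟩
    · exact 𝒟.iterate_Lam hf [x]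
    · have h1 := (𝒟.transport_arcPath hf (x' :: w) x).apply_succ hf.continuous
      rw [ih (by simp)] at h1
      have h2 := 𝒟.transport_arcPath hf (x' :: w).dropLast x
      rw [List.length_dropLast] at h2
      exact hf.transport_unique h1 h2

theorem act_spec (s : 𝒟.S) (w : List 𝒟.X) : (𝒟.act s w).length = w.length ∧
    Transport w.length (.mk (𝒟.loop s)) (𝒟.Lam w) (𝒟.Lam (𝒟.act s w)) := by
  obtain ⟨z, hz⟩ := hf.exists_transport (.mk (𝒟.loop s)) (𝒟.iterate_Lam hf w)
  obtain ⟨v, hv, hvz⟩ := 𝒟.exists_Lam_eq hf hz.iterate_right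
  have he := hf.liftEnd_eq (ξ := fun t => (𝒟.loop s t : Sphere2)) (fun _ => rfl) hz
  have h : ∃ v : List 𝒟.X, v.length = w.length ∧
      𝒟.Lam v = liftEnd f^[w.length] (fun t => (𝒟.loop s t : Sphere2)) (𝒟.Lam w) :=
    ⟨v, hv, by rw [he, hvz]⟩
  rw [act, dif_pos h]
  refine ⟨h.choose_spec.1, ?_⟩
  rw [h.choose_spec.2, he]
  exact hz

end

/-- The combinatorial distance of two words in the selfsimilarity complex. -/
noncomputable def wordDist (w w' : List 𝒟.X) : ℕ := 𝒟.complex.graph.dist w w'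

theorem wordDist_cons_le (w : List 𝒟.X) (x : 𝒟.X) : 𝒟.wordDist w (x :: w) ≤ 1 :=
  OneComplex.dist_src_le (K := 𝒟.complex) (Sum.inr (x, w), true)

theorem wordDist_act_le (s : 𝒟.S) (w : List 𝒟.X) : 𝒟.wordDist w (𝒟.act s w) ≤ 1 :=
  OneComplex.dist_src_le (K := 𝒟.complex) (Sum.inl (s, w), true)

theorem connected_graph : 𝒟.complex.graph.Connected := by
  have h : ∀ w : List 𝒟.X, 𝒟.complex.graph.Reachable ([] : List 𝒟.X) w := by
    intro w
    induction w with
    | nil => exact SimpleGraph.Reachable.refl _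
    | cons x w ih =>
      refine ih.trans (SimpleGraph.Adj.reachable ?_)
      refine (SimpleGraph.fromRel_adj _ _ _).2 ⟨?_, Or.inl ⟨(Sum.inr (x, w), true), rfl, rfl⟩⟩
      exact (List.cons_ne_self x w).symm
  have : Nonempty 𝒟.complex.V := ⟨([] : List 𝒟.X)⟩
  exact ⟨fun w w' => (h w).symm.trans (h w')⟩

theorem wordDist_triangle (w w' w'' : List 𝒟.X) :
    𝒟.wordDist w w'' ≤ 𝒟.wordDist w w' + 𝒟.wordDist w' w'' := 𝒟.connected_graph.dist_triangle

theorem wordDist_comm (w w' : List 𝒟.X) : 𝒟.wordDist w w' = 𝒟.wordDist w' w :=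
  SimpleGraph.dist_comm

@[simp] theorem wordDist_self (w : List 𝒟.X) : 𝒟.wordDist w w = 0 := SimpleGraph.dist_self

/-- The classes of loops which move every word by a bounded amount in the selfsimilarity
complex. -/
noncomputable def boundedSubgroup (hf : IsBranchedCovering f) :
    Subgroup (FundamentalGroup (PuncturedSphere f) 𝒟.b) where
  carrier := {g | ∃ K, ∀ w w' : List 𝒟.X, w'.length = w.length →
    Transport (f := f) w.length (a := 𝒟.b) (a' := 𝒟.b) g (𝒟.Lam w) (𝒟.Lam w') →
    𝒟.wordDist w w' ≤ K}
  one_mem' := by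
    refine ⟨0, fun w w' hl h => ?_⟩
    have := hf.transport_unique (Transport.refl (𝒟.iterate_Lam hf w)) h
    rw [𝒟.Lam_injective hf hl.symm this, wordDist_self]
  mul_mem' := by
    rintro g h ⟨K, hK⟩ ⟨K', hK'⟩
    refine ⟨K' + K, fun w w' hl hw => ?_⟩
    obtain ⟨z, hz⟩ := hf.exists_transport (h : Path.Homotopic.Quotient 𝒟.b 𝒟.b)
      (𝒟.iterate_Lam hf w)
    obtain ⟨v, hv, rfl⟩ := 𝒟.exists_Lam_eq hf hz.iterate_right
    obtain ⟨z', hz'⟩ := hf.exists_transport (g : Path.Homotopic.Quotient 𝒟.b 𝒟.b) hz.iterate_right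
    have h1 : z' = 𝒟.Lam w' := hf.transport_unique (hz.trans hz') hw
    rw [h1] at hz'
    exact (𝒟.wordDist_triangle w v w').trans
      (add_le_add (hK' w v hv hz) (hK v w' (hl.trans hv.symm) (by rw [hv]; exact hz')))
  inv_mem' := by
    rintro g ⟨K, hK⟩
    refine ⟨K, fun w w' hl hw => ?_⟩
    rw [wordDist_comm]
    refine hK w' w hl.symm ?_
    have := hw.symm
    rw [hl]
    rw [← FundamentalGroup.inv_def, inv_inv] at this
    exact this

/-- The orbifold relations act trivially and the generators move words to adjacent words. -/
theorem boundedSubgroup_eq_top (hf : IsBranchedCovering f) (hfin : (postcriticalSet f).Finite) :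
    𝒟.boundedSubgroup hf = ⊤ := by
  have hker : orbifoldRelations f 𝒟.b ≤ 𝒟.boundedSubgroup hf := by
    intro g hg
    refine ⟨0, fun w w' hl h => ?_⟩
    have := hf.transport_unique
      (hf.orbifoldRelations_le hfin 𝒟.b hg w.length _ (𝒟.iterate_Lam hf w)) h
    rw [𝒟.Lam_injective hf hl.symm this, wordDist_self]
  have hmap : (𝒟.boundedSubgroup hf).map (QuotientGroup.mk' (orbifoldRelations f 𝒟.b)) = ⊤ := by
    rw [eq_top_iff, ← 𝒟.generates, Subgroup.closure_le]
    intro s hs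
    refine ⟨FundamentalGroup.fromPath (.mk (𝒟.loop ⟨s, hs⟩)), ⟨1, fun w w' hl h => ?_⟩,
      𝒟.loop_class ⟨s, hs⟩⟩
    obtain ⟨h1, h2⟩ := 𝒟.act_spec hf ⟨s, hs⟩ w
    rw [𝒟.Lam_injective hf (hl.trans h1.symm) (hf.transport_unique h h2)]
    exact 𝒟.wordDist_act_le _ _
  have h1 := congrArg (Subgroup.comap (QuotientGroup.mk' (orbifoldRelations f 𝒟.b))) hmap
  rw [Subgroup.comap_map_eq, QuotientGroup.ker_mk', sup_eq_left.2 hker, Subgroup.comap_top] at h1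
  exact h1

theorem exists_wordDist_le (hf : IsBranchedCovering f) (hfin : (postcriticalSet f).Finite)
    (g : Path.Homotopic.Quotient 𝒟.b 𝒟.b) : ∃ K, ∀ (n : ℕ) (w w' : List 𝒟.X), w.length = n →
      w'.length = n → Transport n g (𝒟.Lam w) (𝒟.Lam w') → 𝒟.wordDist w w' ≤ K := by
  have : FundamentalGroup.fromPath g ∈ 𝒟.boundedSubgroup hf := by
    rw [𝒟.boundedSubgroup_eq_top hf hfin]; trivial
  obtain ⟨K, hK⟩ := this
  exact ⟨K, fun n w w' hw hw' h => hK w w' (hw'.trans hw.symm) (by rw [hw]; exact h)⟩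

end DefiningData

/-! ### The covering graph -/

theorem coverComplex_graph (𝒰 : Set (Set Sphere2)) :
    (coverComplex f 𝒰).graph = coverSimpleGraph f 𝒰 := by
  ext v w
  rw [OneComplex.graph, SimpleGraph.fromRel_adj]
  constructor
  · rintro ⟨-, ⟨d, rfl, rfl⟩ | ⟨d, rfl, rfl⟩⟩
    · exact SimpleGraph.Dart.adj (G := coverSimpleGraph f 𝒰) d
    · exact (SimpleGraph.Dart.adj (G := coverSimpleGraph f 𝒰) d).symm
  · intro h
    exact ⟨h.ne, Or.inl ⟨(⟨(v, w), h⟩ : (coverSimpleGraph f 𝒰).Dart), rfl, rfl⟩⟩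

/-- All elements of the cover are caps contained in open half spheres. -/
def BallCover.IsSmall {P : Set Sphere2} {δ : ℝ} (𝒰 : BallCover P δ) : Prop :=
  ∀ U ∈ 𝒰.sets, ∃ (c : Sphere2) (a : ℝ), 0 < a ∧ a < 1 ∧ U = cap c a ∧ ∀ p ∈ P, p ∈ U → p = c

theorem BallCover.exists_mem {P : Set Sphere2} {δ : ℝ} (𝒰 : BallCover P δ) (x : Sphere2) :
    ∃ U ∈ 𝒰.sets, x ∈ U := by
  have : x ∈ ⋃₀ 𝒰.sets := by rw [𝒰.covers]; trivial
  exact this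

theorem BallCover.IsSmall.isPreconnected {P : Set Sphere2} {δ : ℝ} {𝒰 : BallCover P δ}
    (h𝒰 : 𝒰.IsSmall) {U : Set Sphere2} (hU : U ∈ 𝒰.sets) : IsPreconnected U := by
  obtain ⟨c, a, ha, ha', rfl, -⟩ := h𝒰 U hU
  exact (isConnected_cap (by linarith) ha').isPreconnected

theorem BallCover.IsSmall.exists_notMem {P : Set Sphere2} {δ : ℝ} {𝒰 : BallCover P δ}
    (h𝒰 : 𝒰.IsSmall) (hP : P.Finite) {U : Set Sphere2} (hU : U ∈ 𝒰.sets) : ∃ q ∈ U, q ∉ P := by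
  obtain ⟨c, a, ha, ha', rfl, -⟩ := h𝒰 U hU
  exact (isOpen_cap c a).exists_notMem_finite ⟨c, pole_mem_cap ha'⟩ hP

section

variable {𝒰 : Set (Set Sphere2)}

/-- The vertex of the covering graph given by a component of the preimage of an element of the
cover. -/
def CoverVertex.component (n : ℕ) {U : Set Sphere2} (hU : U ∈ 𝒰) {x : Sphere2}
    (hx : f^[n] x ∈ U) : CoverVertex f 𝒰 :=
  .piece n (connectedComponentIn (f^[n] ⁻¹' U) x) ⟨U, hU, x, hx, rfl⟩

@[simp] theorem CoverVertex.level_component (n : ℕ) {U : Set Sphere2} (hU : U ∈ 𝒰) {x : Sphere2}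
    (hx : f^[n] x ∈ U) : (CoverVertex.component n hU hx).level = n := rfl

@[simp] theorem CoverVertex.level_root : (CoverVertex.root : CoverVertex f 𝒰).level = -1 := rfl

theorem CoverVertex.mem_component {n : ℕ} {U : Set Sphere2} (hU : U ∈ 𝒰) {x : Sphere2}
    (hx : f^[n] x ∈ U) : x ∈ (CoverVertex.component n hU hx).carrier :=
  mem_connectedComponentIn (F := f^[n] ⁻¹' U) hx

theorem CoverVertex.carrier_nonempty (v : CoverVertex f 𝒰) : v.carrier.Nonempty := by
  rcases v with _ | ⟨n, C, U, hU, x, hx, rfl⟩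
  · exact univ_nonempty
  · exact ⟨x, mem_connectedComponentIn (F := f^[n] ⁻¹' U) hx⟩

/-- Vertices at neighbouring levels whose sets meet are at distance at most one. -/
theorem coverSimpleGraph_dist_le_one {v w : CoverVertex f 𝒰} (hl : |v.level - w.level| ≤ 1)
    {x : Sphere2} (hv : x ∈ v.carrier) (hw : x ∈ w.carrier) :
    (coverSimpleGraph f 𝒰).dist v w ≤ 1 := by
  by_cases h : v = w
  · rw [h, SimpleGraph.dist_self]; exact zero_le_one
  · have hadj : (coverSimpleGraph f 𝒰).Adj v w := ⟨h, hl, x, hv, hw⟩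
    exact (SimpleGraph.dist_eq_one_iff_adj.2 hadj).le

theorem coverSimpleGraph_connected (h𝒰 : ⋃₀ 𝒰 = univ) : (coverSimpleGraph f 𝒰).Connected := by
  have key : ∀ (n : ℕ) (v : CoverVertex f 𝒰), v.level = n →
      (coverSimpleGraph f 𝒰).Reachable .root v := by
    intro n
    induction n with
    | zero =>
      intro v hv
      refine SimpleGraph.Adj.reachable ⟨?_, ?_, ?_⟩
      · rintro rfl; simp [CoverVertex.level] at hv
      · rw [hv]; simp [CoverVertex.level]
      · simpa [CoverVertex.carrier] using v.carrier_nonempty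
    | succ n ih =>
      intro v hv
      obtain ⟨x, hx⟩ := v.carrier_nonempty
      have hx' : f^[n] x ∈ ⋃₀ 𝒰 := by rw [h𝒰]; trivial
      obtain ⟨U, hU, hxU⟩ := hx'
      refine (ih (CoverVertex.component n hU hxU) rfl).trans (SimpleGraph.Adj.reachable ⟨?_, ?_, ?_⟩)
      · rintro rfl
        simp [CoverVertex.level, CoverVertex.component] at hv
      · rw [hv]; simp [CoverVertex.level, CoverVertex.component]
      · exact ⟨x, CoverVertex.mem_component hU hxU, hx⟩
  have h : ∀ v, (coverSimpleGraph f 𝒰).Reachable .root v := by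
    rintro (_ | ⟨n, C, hC⟩)
    · exact SimpleGraph.Reachable.refl _
    · exact key n _ rfl
  have : Nonempty (CoverVertex f 𝒰) := ⟨.root⟩
  exact ⟨fun v w => (h v).symm.trans (h w)⟩

end

section

variable {δ : ℝ} (𝒰 : BallCover (postcriticalSet f) δ)

/-- The lifts of a path under all iterates cross a uniformly bounded number of elements of the
covers: subdivide the path into pieces subordinate to the cover at level zero. -/
theorem BallCover.exists_dist_le_of_lift (η : C(I, Sphere2)) :
    ∃ K : ℕ, ∀ (n : ℕ) (ζ : C(I, Sphere2)), (∀ t, f^[n] (ζ t) = η t) →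
      ∀ v v' : CoverVertex f 𝒰.sets, v.level = n → v'.level = n → ζ 0 ∈ v.carrier →
        ζ 1 ∈ v'.carrier → (coverSimpleGraph f 𝒰.sets).dist v v' ≤ K := by
  obtain ⟨t, ht0, htm, ⟨m, hm⟩, ht⟩ := exists_monotone_Icc_subset_open_cover_unitInterval
    (c := fun U : 𝒰.sets => η ⁻¹' U) (fun U => (𝒰.isOpen U.2).preimage η.continuous)
    (fun s _ => by
      obtain ⟨U, hU, hs⟩ := 𝒰.exists_mem (η s)
      exact mem_iUnion.2 ⟨⟨U, hU⟩, hs⟩)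
  refine ⟨m + 1, fun n ζ hζ v v' hv hv' h0 h1 => ?_⟩
  have hconn := coverSimpleGraph_connected (f := f) 𝒰.covers
  have key : ∀ (k : ℕ) (v' : CoverVertex f 𝒰.sets), v'.level = n → ζ (t k) ∈ v'.carrier →
      (coverSimpleGraph f 𝒰.sets).dist v v' ≤ k + 1 := by
    intro k
    induction k with
    | zero =>
      intro v' hv' h
      rw [ht0] at h
      exact coverSimpleGraph_dist_le_one (by simp [hv, hv']) h0 h
    | succ k ih =>
      intro v' hv' h
      obtain ⟨⟨U, hU⟩, hUt⟩ := ht k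
      have hle : t k ≤ t (k + 1) := htm (Nat.le_succ k)
      have hx : f^[n] (ζ (t k)) ∈ U := by rw [hζ]; exact hUt ⟨le_rfl, hle⟩
      have hmem : ζ (t (k + 1)) ∈ (CoverVertex.component n hU hx).carrier := by
        refine (isPreconnected_Icc.image ζ ζ.continuous.continuousOn).subset_connectedComponentIn
          ⟨t k, ⟨le_rfl, hle⟩, rfl⟩ ?_ ⟨t (k + 1), ⟨hle, le_rfl⟩, rfl⟩
        rintro _ ⟨s, hs, rfl⟩
        change f^[n] (ζ s) ∈ U
        rw [hζ]
        exact hUt hs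
      refine hconn.dist_triangle.trans (add_le_add (ih (CoverVertex.component n hU hx) rfl
        (CoverVertex.mem_component hU hx)) (coverSimpleGraph_dist_le_one ?_ hmem h))
      simp [hv']
  exact key m v' hv' (by rw [hm m le_rfl]; exact h1)

theorem BallCover.exists_dist_le_of_transport (hf : IsBranchedCovering f) {a a' : PuncturedSphere f}
    (c : Path.Homotopic.Quotient a a') :
    ∃ K : ℕ, ∀ (n : ℕ) (y z : Sphere2), Transport n c y z →
      ∀ v v' : CoverVertex f 𝒰.sets, v.level = n → v'.level = n → y ∈ v.carrier →
        z ∈ v'.carrier → (coverSimpleGraph f 𝒰.sets).dist v v' ≤ K := by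
  induction c using Path.Homotopic.Quotient.ind with
  | mk η =>
  obtain ⟨K, hK⟩ := 𝒰.exists_dist_le_of_lift
    ⟨fun t => (η t : Sphere2), continuous_subtype_val.comp η.continuous⟩
  refine ⟨K, fun n y z h v v' hv hv' hy hz => ?_⟩
  obtain ⟨z', ζ, hζ⟩ := hf.exists_lift η h.iterate_left
  obtain rfl : z' = z := hf.transport_unique ⟨η, ζ, rfl, hζ⟩ h
  exact hK n ζ.toContinuousMap hζ v v' hv hv' (by simpa using hy) (by simpa using hz)

namespace DefiningData

variable (𝒟 : DefiningData f) (hf : IsBranchedCovering f)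
variable {𝒰} {B : Set Sphere2} (hB : B ∈ 𝒰.sets) (hb : (𝒟.b : Sphere2) ∈ B)

/-- The vertex of the covering graph assigned to a word `w` of length `n`: the component of
`f^{-n}(B)` which contains `Λ(w)`, where `B` is an element of the cover containing the base
point. -/
noncomputable def toCover (w : List 𝒟.X) : CoverVertex f 𝒰.sets :=
  .component w.length hB (x := 𝒟.Lam w) (by rw [𝒟.iterate_Lam hf]; exact hb)

theorem level_toCover (w : List 𝒟.X) : (𝒟.toCover hf hB hb w).level = w.length := rfl

theorem Lam_mem_toCover (w : List 𝒟.X) : 𝒟.Lam w ∈ (𝒟.toCover hf hB hb w).carrier :=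
  CoverVertex.mem_component _ _

theorem coverImage_toCover (w : List 𝒟.X) (hw : w ≠ []) :
    coverImage hf 𝒰 (𝒟.toCover hf hB hb w) = 𝒟.toCover hf hB hb w.dropLast := by
  obtain ⟨n, hn⟩ : ∃ n, w.length = n + 1 :=
    Nat.exists_eq_succ_of_ne_zero (by simpa using hw)
  have hl : w.dropLast.length = n := by rw [List.length_dropLast, hn]; rfl
  have h1 : ∀ (m : ℕ) (hm : w.length = m) (hx : f^[m] (𝒟.Lam w) ∈ B),
      𝒟.toCover hf hB hb w = .component m hB hx := by
    rintro _ rfl hx; rfl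
  have h2 : ∀ (m : ℕ) (hm : w.dropLast.length = m) (hx : f^[m] (𝒟.Lam w.dropLast) ∈ B),
      𝒟.toCover hf hB hb w.dropLast = .component m hB hx := by
    rintro _ rfl hx; rfl
  have hx : f^[n + 1] (𝒟.Lam w) ∈ B := by rw [← hn, 𝒟.iterate_Lam hf]; exact hb
  have hx' : f^[n] (𝒟.Lam w.dropLast) ∈ B := by rw [← 𝒟.apply_Lam hf w hw]; exact hx
  rw [h1 _ hn hx, h2 _ hl hx']
  have := image_component hf.continuous hf.isOpenMap
    ((𝒰.isOpen hB).preimage (hf.continuous.iterate n)) (x := 𝒟.Lam w) hx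
  rw [𝒟.apply_Lam hf w hw] at this
  exact (CoverVertex.piece.injEq ..).mpr ⟨rfl, this⟩

/-- The map `toCover` is Lipschitz on the vertices of the selfsimilarity complex. -/
theorem exists_dist_toCover_le : ∃ A : ℕ, ∀ w w' : List 𝒟.X, 𝒟.complex.graph.Adj w w' →
    (coverSimpleGraph f 𝒰.sets).dist (𝒟.toCover hf hB hb w) (𝒟.toCover hf hB hb w') ≤ A := by
  have := 𝒟.finite_X
  have := 𝒟.finite_S.to_subtype
  have hconn := coverSimpleGraph_connected (f := f) 𝒰.covers
  choose K hK using fun s : 𝒟.S => 𝒰.exists_dist_le_of_transport hf (.mk (𝒟.loop s))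
  choose L hL using fun x : 𝒟.X => 𝒰.exists_dist_le_of_transport hf (.mk (𝒟.arcPath x))
  obtain ⟨K', hK'⟩ := Finite.exists_le K
  obtain ⟨L', hL'⟩ := Finite.exists_le L
  have hact : ∀ s w, (coverSimpleGraph f 𝒰.sets).dist (𝒟.toCover hf hB hb w)
      (𝒟.toCover hf hB hb (𝒟.act s w)) ≤ K' + (L' + 1) := by
    intro s w
    obtain ⟨h1, h2⟩ := 𝒟.act_spec hf s w
    refine (hK s _ _ _ h2 _ _ (𝒟.level_toCover ..) ?_ (𝒟.Lam_mem_toCover ..)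
      (𝒟.Lam_mem_toCover ..)).trans ((hK' s).trans (by omega))
    rw [level_toCover, h1]
  have hcons : ∀ x w, (coverSimpleGraph f 𝒰.sets).dist (𝒟.toCover hf hB hb w)
      (𝒟.toCover hf hB hb (x :: w)) ≤ K' + (L' + 1) := by
    intro x w
    obtain ⟨U, hU, hxU⟩ := 𝒰.exists_mem (f^[w.length] (𝒟.Lam (x :: w)))
    refine (hconn.dist_triangle (v := .component w.length hU hxU)).trans
      ((add_le_add ((hL x _ _ _ (𝒟.transport_arcPath hf w x) _ _ (𝒟.level_toCover ..) rfl
        (𝒟.Lam_mem_toCover ..) (CoverVertex.mem_component ..)).trans (hL' x))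
        (coverSimpleGraph_dist_le_one ?_ (CoverVertex.mem_component ..)
          (𝒟.Lam_mem_toCover ..))).trans (by omega))
    simp [level_toCover]
  refine ⟨K' + (L' + 1), ?_⟩
  have key : ∀ d, (coverSimpleGraph f 𝒰.sets).dist (𝒟.toCover hf hB hb (𝒟.complex.src d))
      (𝒟.toCover hf hB hb (𝒟.complex.src (𝒟.complex.rev d))) ≤ K' + (L' + 1) := by
    rintro ⟨⟨s, w⟩ | ⟨x, w⟩, _ | _⟩
    · rw [SimpleGraph.dist_comm]; exact hact s w
    · exact hact s w
    · rw [SimpleGraph.dist_comm]; exact hcons x w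
    · exact hcons x w
  intro w w' h
  obtain ⟨-, ⟨d, rfl, rfl⟩ | ⟨d, rfl, rfl⟩⟩ := (SimpleGraph.fromRel_adj _ _ _).1 h
  · exact key d
  · rw [SimpleGraph.dist_comm]; exact key d

/-- Every vertex of the covering graph is within bounded distance of the image of a word: its set
contains a point over a chosen generic point of the ball below it, and a fixed path from there to
the base point lifts to a path which ends at some `Λ(w)`. -/
theorem exists_dist_le_toCover [PathConnectedSpace (PuncturedSphere f)]
    (hfin : (postcriticalSet f).Finite) (h𝒰 : 𝒰.IsSmall) :
    ∃ A : ℕ, ∀ v, ∃ w, (coverSimpleGraph f 𝒰.sets).dist v (𝒟.toCover hf hB hb w) ≤ A := by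
  have := 𝒰.finite.to_subtype
  choose q hqU hqP using fun U : 𝒰.sets => h𝒰.exists_notMem hfin U.2
  choose K hK using fun U : 𝒰.sets => 𝒰.exists_dist_le_of_transport hf
    (a := ⟨q U, hqP U⟩) (a' := 𝒟.b) (.mk (PathConnectedSpace.somePath _ _))
  obtain ⟨K', hK'⟩ := Finite.exists_le K
  refine ⟨K' + 1, fun v => ?_⟩
  rcases v with _ | ⟨n, C, U, hU, x, hx, rfl⟩
  · refine ⟨[], le_add_of_le_right (coverSimpleGraph_dist_le_one ?_ (mem_univ _)
      (𝒟.Lam_mem_toCover ..))⟩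
    simp [level_toCover]
  · have himg := hf.image_component_iterate (𝒰.isOpen hU) (h𝒰.isPreconnected hU) hx
    have hq : q ⟨U, hU⟩ ∈ U := hqU ⟨U, hU⟩
    obtain ⟨y, hy, hyq⟩ := himg.ge hq
    obtain ⟨z, hz⟩ := hf.exists_transport (n := n) (a := ⟨q ⟨U, hU⟩, hqP ⟨U, hU⟩⟩) (a' := 𝒟.b)
      (.mk (PathConnectedSpace.somePath _ _)) hyq
    obtain ⟨w, rfl, rfl⟩ := 𝒟.exists_Lam_eq hf hz.iterate_right
    exact ⟨w, (hK ⟨U, hU⟩ _ _ _ hz (.component _ hU hx) _ rfl rfl hy (𝒟.Lam_mem_toCover ..)).trans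
      ((hK' _).trans (Nat.le_succ _))⟩

end DefiningData

end

/-! ### Words coding the points of the sphere -/

theorem IsBranchedCovering.finite_preimage_iterate (hf : IsBranchedCovering f) (n : ℕ)
    {s : Set Sphere2} (hs : s.Finite) : (f^[n] ⁻¹' s).Finite := by
  rw [← biUnion_preimage_singleton]
  exact hs.biUnion fun y _ => hf.finite_fiber n y

namespace DefiningData

variable (𝒟 : DefiningData f) {ι : Type} (𝒱 : BasedCover (PuncturedSphere f) 𝒟.b ι)

/-- The word `w` of length `n` codes the point `y`, relative to the set `V i` of a based cover: the
image of `y` under `f^n` lies in `V i`, and the lift under `f^n` starting at `Λ(w)` of the class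
chosen for `V i` ends at `y`. -/
def Codes (i : ι) (w : List 𝒟.X) (y : Sphere2) : Prop :=
  ∃ v ∈ 𝒱.V i, Transport w.length (𝒱.cls i v) (𝒟.Lam w) y

variable {𝒟 𝒱}

theorem Codes.exists_mem {i : ι} {w : List 𝒟.X} {y : Sphere2} (h : 𝒟.Codes 𝒱 i w y) :
    ∃ v ∈ 𝒱.V i, f^[w.length] y = v := by
  obtain ⟨v, hv, h⟩ := h
  exact ⟨v, hv, h.iterate_right⟩

theorem Codes.notMem {i : ι} {w : List 𝒟.X} {y : Sphere2} (h : 𝒟.Codes 𝒱 i w y) :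
    f^[w.length] y ∉ postcriticalSet f := by
  obtain ⟨v, -, h⟩ := h.exists_mem
  rw [h]; exact v.2

/-- The coding word does not change along paths over `V i`. -/
theorem Codes.along {i : ι} {w : List 𝒟.X} {y z : Sphere2} (h : 𝒟.Codes 𝒱 i w y) (ζ : Path y z)
    (hζ : ∀ t, f^[w.length] (ζ t) ∈ Subtype.val '' 𝒱.V i) (hc : Continuous f) :
    𝒟.Codes 𝒱 i w z := by
  obtain ⟨v, hv, h⟩ := h
  choose u hu hu' using hζ
  have huc : Continuous u := by
    refine Topology.IsEmbedding.subtypeVal.continuous_iff.2 ?_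
    have : Subtype.val ∘ u = fun t => f^[w.length] (ζ t) := funext hu'
    rw [this]
    exact (hc.iterate _).comp ζ.continuous
  let η : Path v (u 1) := ⟨⟨u, huc⟩, Subtype.ext (by
    change (u 0 : Sphere2) = v
    rw [hu', ζ.source, h.iterate_right]), rfl⟩
  refine ⟨u 1, hu 1, ?_⟩
  rw [← 𝒱.cls_trans i v (u 1) η hu]
  exact h.trans ⟨η, ζ, rfl, fun t => (hu' t).symm⟩

section

variable (hf : IsBranchedCovering f)
include hf

variable (𝒟 𝒱) in
theorem exists_codes {n : ℕ} {y : Sphere2} {i : ι} (h : f^[n] y ∈ Subtype.val '' 𝒱.V i) :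
    ∃ w : List 𝒟.X, w.length = n ∧ 𝒟.Codes 𝒱 i w y := by
  obtain ⟨v, hv, hy⟩ := h
  obtain ⟨z, hz⟩ := hf.exists_transport (𝒱.cls i v).symm hy.symm
  obtain ⟨w, rfl, rfl⟩ := 𝒟.exists_Lam_eq hf hz.iterate_right
  exact ⟨w, rfl, v, hv, hz.of_symm⟩

theorem Codes.word_eq {i : ι} {w w' : List 𝒟.X} {y : Sphere2} (hl : w.length = w'.length)
    (h : 𝒟.Codes 𝒱 i w y) (h' : 𝒟.Codes 𝒱 i w' y) : w = w' := by
  obtain ⟨v, hv, h⟩ := h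
  obtain ⟨v', hv', h'⟩ := h'
  rw [← hl] at h'
  obtain rfl : v = v' := Subtype.ext (h.iterate_right.symm.trans h'.iterate_right)
  exact 𝒟.Lam_injective hf hl (hf.transport_unique_left h h')

/-- A word which codes a point over `V i` codes points over all elements of `V i`, in the same
component. -/
theorem Codes.exists_codes_over {i : ι} {w : List 𝒟.X} {y : Sphere2} (h : 𝒟.Codes 𝒱 i w y)
    {U : Set Sphere2} (hU : Subtype.val '' 𝒱.V i ⊆ U) {v' : PuncturedSphere f}
    (hv' : v' ∈ 𝒱.V i) :
    ∃ z, 𝒟.Codes 𝒱 i w z ∧ f^[w.length] z = v' ∧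
      z ∈ connectedComponentIn (f^[w.length] ⁻¹' U) y := by
  obtain ⟨v, hv, hy⟩ := h.exists_mem
  obtain ⟨η, hη⟩ := 𝒱.joined i i v v' hv hv hv' hv'
  obtain ⟨z, ζ, hζ⟩ := hf.exists_lift η hy
  have hmem : ∀ t, f^[w.length] (ζ t) ∈ Subtype.val '' 𝒱.V i :=
    fun t => ⟨η t, (hη t).1, (hζ t).symm⟩
  refine ⟨z, h.along ζ hmem hf.continuous, by simpa using hζ 1, ?_⟩
  refine (isPreconnected_range ζ.continuous).subset_connectedComponentIn ⟨0, ζ.source⟩ ?_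
    ⟨1, ζ.target⟩
  rintro _ ⟨t, rfl⟩
  exact hU (hmem t)

theorem Codes.eventually (hfin : (postcriticalSet f).Finite) {i : ι} {w : List 𝒟.X} {y : Sphere2}
    (h : 𝒟.Codes 𝒱 i w y) : ∀ᶠ z in 𝓝 y, 𝒟.Codes 𝒱 i w z := by
  have ho : IsOpen (f^[w.length] ⁻¹' (Subtype.val '' 𝒱.V i)) :=
    (hfin.isClosed.isOpen_compl.isOpenEmbedding_subtypeVal.isOpenMap _ (𝒱.isOpen i)).preimage
      (hf.continuous.iterate _)
  obtain ⟨v, hv, hy⟩ := h.exists_mem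
  have hmem : y ∈ f^[w.length] ⁻¹' (Subtype.val '' 𝒱.V i) := ⟨v, hv, hy.symm⟩
  have hn := (ho.pathComponentIn y).mem_nhds (mem_pathComponentIn_self hmem)
  filter_upwards [hn] with z hz
  obtain ⟨ζ, hζ⟩ := hz
  exact h.along ζ hζ hf.continuous

end

variable [Finite ι] (hf : IsBranchedCovering f) (hfin : (postcriticalSet f).Finite)
include hf hfin

variable (𝒟 𝒱) in
/-- Two words of the same length which code the same point are at bounded distance, since there
are only finitely many transitions. -/
theorem exists_wordDist_le_of_codes : ∃ K : ℕ, ∀ (i j : ι) (w w' : List 𝒟.X) (y : Sphere2),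
    w.length = w'.length → 𝒟.Codes 𝒱 i w y → 𝒟.Codes 𝒱 j w' y → 𝒟.wordDist w w' ≤ K := by
  choose K hK using fun g => 𝒟.exists_wordDist_le hf hfin g
  have hbd : ∀ ij : ι × ι, ∃ M, ∀ v, v ∈ 𝒱.V ij.1 → v ∈ 𝒱.V ij.2 →
      K (𝒱.transition ij.1 ij.2 v) ≤ M := by
    intro ij
    by_cases h : ∃ v, v ∈ 𝒱.V ij.1 ∧ v ∈ 𝒱.V ij.2
    · obtain ⟨v, h1, h2⟩ := h
      exact ⟨_, fun v' h1' h2' => (congrArg K (𝒱.transition_eq h1' h2' h1 h2)).le⟩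
    · exact ⟨0, fun v h1 h2 => absurd ⟨v, h1, h2⟩ h⟩
  choose M hM using hbd
  obtain ⟨M', hM'⟩ := Finite.exists_le M
  refine ⟨M', fun i j w w' y hl ⟨v, hv, h⟩ ⟨v', hv', h'⟩ => ?_⟩
  rw [← hl] at h'
  obtain rfl : v = v' := Subtype.ext (h.iterate_right.symm.trans h'.iterate_right)
  exact (hK _ _ _ _ rfl hl.symm (h.trans h'.symm)).trans ((hM (i, j) v hv hv').trans (hM' _))

variable (𝒟 𝒱) in
/-- The word `w` and a word coding the point `Λ(w)` are at bounded distance. They may differ, since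
the class chosen at the base point need not be trivial. -/
theorem exists_wordDist_le_of_codes_Lam : ∃ K : ℕ, ∀ (i : ι) (w w' : List 𝒟.X),
    w.length = w'.length → 𝒟.Codes 𝒱 i w' (𝒟.Lam w) → 𝒟.wordDist w w' ≤ K := by
  choose K hK using fun i => 𝒟.exists_wordDist_le hf hfin (𝒱.cls i 𝒟.b)
  obtain ⟨K', hK'⟩ := Finite.exists_le K
  refine ⟨K', fun i w w' hl ⟨v, hv, h⟩ => ?_⟩
  obtain rfl : v = 𝒟.b := Subtype.ext (h.iterate_right.symm.trans
    (by rw [← hl]; exact 𝒟.iterate_Lam hf w))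
  rw [wordDist_comm]
  exact (hK i _ _ _ rfl hl h).trans (hK' i)

omit [Finite ι] in
/-- Words of lengths `n` and `n + 1` which code the same point over a fixed point `q` are at
bounded distance: lift the class chosen at `f q` to a path from `q` to the fibre of the base point,
and return along the arc of the corresponding letter. -/
theorem exists_wordDist_le_of_codes_over (i j : ι) {q : Sphere2} (hq : f q ∉ postcriticalSet f) :
    ∃ K : ℕ, ∀ (w w' : List 𝒟.X) (y : Sphere2), w'.length = w.length + 1 → f^[w.length] y = q →
      𝒟.Codes 𝒱 i w y → 𝒟.Codes 𝒱 j w' y → 𝒟.wordDist w w' ≤ K := by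
  have hqP : q ∉ postcriticalSet f := fun h => hq (apply_mem_postcriticalSet h)
  obtain ⟨η, hη⟩ := Path.Homotopic.Quotient.mk_surjective (𝒱.cls j ⟨f q, hq⟩).symm
  obtain ⟨q', ξ, hξ⟩ := hf.exists_lift (n := 1) η (y := q) rfl
  have hξ' : ∀ t, f (ξ t) = η t := hξ
  have hq' : f q' = 𝒟.b := by simpa using hξ' 1
  obtain ⟨x, hx⟩ := 𝒟.code.surjective ⟨q', hq'⟩
  have hxq : (𝒟.code x : Sphere2) = q' := congrArg Subtype.val hx
  let ξM : Path (⟨q, hqP⟩ : PuncturedSphere f) ⟨𝒟.code x, 𝒟.code_notMem x⟩ :=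
    ⟨⟨fun t => ⟨ξ t, fun h => (η t).2 (by rw [← hξ']; exact apply_mem_postcriticalSet h)⟩,
      ξ.continuous.subtype_mk _⟩, Subtype.ext ξ.source, Subtype.ext (ξ.target.trans hxq.symm)⟩
  obtain ⟨K, hK⟩ := 𝒟.exists_wordDist_le hf hfin
    (((𝒱.cls i ⟨q, hqP⟩).trans (.mk ξM)).trans (Path.Homotopic.Quotient.mk (𝒟.arcPath x)).symm)
  refine ⟨K + 1, fun w w' y hl hy ⟨v, hv, h⟩ ⟨v', hv', h'⟩ => ?_⟩
  obtain rfl : v = ⟨q, hqP⟩ := Subtype.ext (h.iterate_right.symm.trans hy)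
  have hy' : f^[w'.length] y = f q := by rw [hl, Function.iterate_succ_apply', hy]
  obtain rfl : v' = ⟨f q, hq⟩ := Subtype.ext (h'.iterate_right.symm.trans hy')
  obtain ⟨z, ζ, hζ⟩ := hf.exists_lift (n := w.length) ξM (y := y) hy
  have h1 : Transport w'.length (𝒱.cls j ⟨f q, hq⟩).symm y z := by
    refine ⟨η, ζ, hη, fun t => ?_⟩
    rw [hl, Function.iterate_succ_apply', hζ]
    exact hξ' t
  obtain rfl : z = 𝒟.Lam w' := hf.transport_unique h1 h'.symm
  have h2 : Transport w.length (.mk ξM) y (𝒟.Lam w') := ⟨ξM, ζ, rfl, hζ⟩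
  obtain ⟨u, hu⟩ := hf.exists_transport (Path.Homotopic.Quotient.mk (𝒟.arcPath x)).symm
    h2.iterate_right
  obtain ⟨w'', hw'', rfl⟩ := 𝒟.exists_Lam_eq hf hu.iterate_right
  have h3 := 𝒟.transport_arcPath hf w'' x
  rw [hw''] at h3
  have h5 : x :: w'' = w' := 𝒟.Lam_injective hf (by rw [List.length_cons, hw'', hl])
    (hf.transport_unique h3 hu.of_symm)
  have h6 := hK _ w w'' rfl hw'' ((h.trans h2).trans hu)
  rw [← h5]
  exact (𝒟.wordDist_triangle w w'' _).trans (add_le_add h6 (𝒟.wordDist_cons_le w'' x))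

end DefiningData

/-! ### Words coding the points of a vertex of the covering graph -/

/-- A based cover refines a cover of the sphere if every point of an element `U` of the latter, off
the postcritical set, lies in an element of the former that is contained in `U`. -/
def BasedCover.Refines {b : PuncturedSphere f} {ι : Type}
    (𝒱 : BasedCover (PuncturedSphere f) b ι) (𝒰 : Set (Set Sphere2)) : Prop :=
  ∀ U ∈ 𝒰, ∀ v : PuncturedSphere f, (v : Sphere2) ∈ U →
    ∃ i, v ∈ 𝒱.V i ∧ Subtype.val '' 𝒱.V i ⊆ U

namespace DefiningData

variable (𝒟 : DefiningData f) {ι : Type} [Finite ι]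
  (𝒱 : BasedCover (PuncturedSphere f) 𝒟.b ι) (hf : IsBranchedCovering f)
  (hfin : (postcriticalSet f).Finite) {N : ℕ} (hN : ∀ n x, localDegree f^[n] x ≤ N)
  {δ : ℝ} {𝒰 : BallCover (postcriticalSet f) δ} (h𝒰 : 𝒰.IsSmall) (h𝒱 : 𝒱.Refines 𝒰.sets)

/-- The words of length `n` which code points of `C`, relative to sets contained in `U`. -/
def codingWords (n : ℕ) (U C : Set Sphere2) : Set (List 𝒟.X) :=
  {w | w.length = n ∧ ∃ i, ∃ y ∈ C, Subtype.val '' 𝒱.V i ⊆ U ∧ 𝒟.Codes 𝒱 i w y}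

include hf hfin hN h𝒰

/-- The number of words which code points of a component is bounded, independently of the level,
by the bound for the number of sheets. -/
theorem encard_codingWords_le {U : Set Sphere2} (hU : U ∈ 𝒰.sets) (n : ℕ) (x : Sphere2) :
    (𝒟.codingWords 𝒱 n U (connectedComponentIn (f^[n] ⁻¹' U) x)).encard ≤
      (N * Nat.card ι : ℕ) := by
  obtain ⟨c, a, ha, ha', rfl, hc⟩ := h𝒰 U hU
  have hι : Nonempty ι := ⟨(𝒱.cover 𝒟.b).choose⟩
  -- the number of sheets is bounded off the centre only, which need not be postcritical
  have hv : ∀ i, ∃ v : PuncturedSphere f, (𝒱.V i).Nonempty → v ∈ 𝒱.V i ∧ (v : Sphere2) ≠ c := by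
    intro i
    by_cases h : (𝒱.V i).Nonempty
    · obtain ⟨_, ⟨v, hv, rfl⟩, hvc⟩ := IsOpen.exists_notMem_finite
        (hfin.isClosed.isOpen_compl.isOpenEmbedding_subtypeVal.isOpenMap _ (𝒱.isOpen i))
        (h.image _) (finite_singleton c)
      exact ⟨v, fun _ => ⟨hv, hvc⟩⟩
    · exact ⟨𝒟.b, fun h' => absurd h' h⟩
  choose v hv using hv
  have hex : ∀ w ∈ 𝒟.codingWords 𝒱 n (cap c a) (connectedComponentIn (f^[n] ⁻¹' cap c a) x),
      ∃ i z, z ∈ connectedComponentIn (f^[n] ⁻¹' cap c a) x ∧ 𝒟.Codes 𝒱 i w z ∧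
        f^[n] z = v i ∧ (v i : Sphere2) ≠ c := by
    rintro w ⟨rfl, i, y, hy, hi, h⟩
    obtain ⟨u, hu, -⟩ := h.exists_mem
    obtain ⟨hvi, hvc⟩ := hv i ⟨u, hu⟩
    obtain ⟨z, h1, h2, h3⟩ := h.exists_codes_over hf hi hvi
    rw [← connectedComponentIn_eq hy] at h3
    exact ⟨i, z, h3, h1, h2, hvc⟩
  choose! i z hz hcode hzv hvc using hex
  refine encard_le_mul_of_fibers (g := i) (T := univ) (fun _ _ => mem_univ _)
    (by rw [encard_univ, ENat.card_eq_coe_natCard]) fun k _ => ?_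
  by_cases hk : (v k : Sphere2) = c
  · have : i ⁻¹' {k} ∩ 𝒟.codingWords 𝒱 n (cap c a)
        (connectedComponentIn (f^[n] ⁻¹' cap c a) x) = ∅ := by
      ext w
      simp only [mem_inter_iff, mem_preimage, mem_singleton_iff, mem_empty_iff_false, iff_false]
      rintro ⟨rfl, hw⟩
      exact hvc w hw hk
    rw [this]; simp
  refine (encard_le_encard_of_injOn (f := z) ?_ ?_).trans
    (hf.encard_component_le (by linarith) ha' hc (fun x => hN n x) (y := x) hk)
  · rintro w ⟨rfl, hw⟩
    exact ⟨hz w hw, hzv w hw⟩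
  · rintro w ⟨hwi, hw⟩ w' ⟨hwi', hw'⟩ he
    have h1 := hcode w hw
    have h2 := hcode w' hw'
    rw [← he, show i w' = i w from Eq.trans hwi' (Eq.symm hwi)] at h2
    exact h1.word_eq hf (hw.1.trans hw'.1.symm) h2

include h𝒱

/-- Words coding points of the same component are at uniformly bounded distance: the component
minus the preimage of the postcritical set is connected, so that the two words are joined by a
chain of words in which neighbours code a common point, and the length of a shortest chain is at
most the number of all words which occur. -/
theorem exists_wordDist_le_of_codes_component : ∃ K : ℕ, ∀ U ∈ 𝒰.sets, ∀ (n : ℕ)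
    (x y z : Sphere2) (i j : ι) (w w' : List 𝒟.X), w.length = n → w'.length = n →
    y ∈ connectedComponentIn (f^[n] ⁻¹' U) x → z ∈ connectedComponentIn (f^[n] ⁻¹' U) x →
    𝒟.Codes 𝒱 i w y → 𝒟.Codes 𝒱 j w' z → 𝒟.wordDist w w' ≤ K := by
  obtain ⟨K₀, hK₀⟩ := 𝒟.exists_wordDist_le_of_codes 𝒱 hf hfin
  refine ⟨K₀ + K₀ * (N * Nat.card ι) + K₀, fun U hU n x => ?_⟩
  set C := connectedComponentIn (f^[n] ⁻¹' U) x with hC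
  set Ω := 𝒟.codingWords 𝒱 n U C with hΩ
  have hCU : C ⊆ f^[n] ⁻¹' U := connectedComponentIn_subset _ _
  have hcard := 𝒟.encard_codingWords_le 𝒱 hf hfin hN h𝒰 hU n x
  have hΩf : Ω.Finite := finite_of_encard_le_coe hcard
  have : Fintype Ω := hΩf.fintype
  have hcard' : Fintype.card Ω ≤ N * Nat.card ι := by
    rw [← hC, ← hΩ, encard_eq_coe_toFinset_card, Nat.cast_le, toFinset_card] at hcard
    exact hcard
  -- every generic point of the component is coded by an element of `Ω`
  have hcodes : ∀ y ∈ C \ f^[n] ⁻¹' postcriticalSet f, ∃ w : Ω, ∃ i, 𝒟.Codes 𝒱 i w y := by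
    rintro y ⟨hy, hyP⟩
    obtain ⟨i, hi, hiU⟩ := h𝒱 U hU ⟨f^[n] y, hyP⟩ (hCU hy)
    obtain ⟨w, hw, h⟩ := 𝒟.exists_codes 𝒱 hf (n := n) (y := y) (i := i) ⟨_, hi, rfl⟩
    exact ⟨⟨w, hw, i, y, hy, hiU, h⟩, i, h⟩
  let G : SimpleGraph Ω := SimpleGraph.fromRel fun w w' => 𝒟.wordDist w w' ≤ K₀
  have hreach : ∀ (w w' : Ω) i j y, 𝒟.Codes 𝒱 i w y → 𝒟.Codes 𝒱 j w' y → G.Reachable w w' := by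
    intro w w' i j y h h'
    by_cases hww : w = w'
    · rw [hww]
    · exact SimpleGraph.Adj.reachable ((SimpleGraph.fromRel_adj _ _ _).2
        ⟨hww, Or.inl (hK₀ i j w w' y (w.2.1.trans w'.2.1.symm) h h')⟩)
  have hlen : ∀ (w w' : Ω) (p : G.Walk w w'), 𝒟.wordDist w w' ≤ K₀ * p.length := by
    intro w w' p
    induction p with
    | nil => simp
    | @cons u v w hadj p ih =>
      have h1 : 𝒟.wordDist u v ≤ K₀ := by
        rcases ((SimpleGraph.fromRel_adj _ _ _).1 hadj).2 with h | h
        · exact h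
        · rw [wordDist_comm]; exact h
      refine (𝒟.wordDist_triangle u v w).trans ((add_le_add h1 ih).trans_eq ?_)
      rw [SimpleGraph.Walk.length_cons]; ring
  have hE : IsPreconnected (C \ f^[n] ⁻¹' postcriticalSet f) :=
    isPreconnected_connectedComponentIn.diff_finite_sphere
      (((𝒰.isOpen hU).preimage (hf.continuous.iterate n)).connectedComponentIn)
      (hf.finite_preimage_iterate n hfin)
  have hconn : ∀ (w w' : Ω) i j, ∀ y ∈ C, ∀ z ∈ C, 𝒟.Codes 𝒱 i w y → 𝒟.Codes 𝒱 j w' z →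
      G.Reachable w w' := by
    intro w w' i j y hy z hz h h'
    have hyE : y ∈ C \ f^[n] ⁻¹' postcriticalSet f := ⟨hy, fun hP => h.notMem (by rwa [w.2.1])⟩
    have hzE : z ∈ C \ f^[n] ⁻¹' postcriticalSet f := ⟨hz, fun hP => h'.notMem (by rwa [w'.2.1])⟩
    have hopen : ∀ Q : Ω → Prop, IsOpen {t | ∃ u : Ω, Q u ∧ ∃ k, 𝒟.Codes 𝒱 k u t} := by
      intro Q
      rw [isOpen_iff_mem_nhds]
      rintro t ⟨u, hu, k, ht⟩
      filter_upwards [ht.eventually hf hfin] with t' ht'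
      exact ⟨u, hu, k, ht'⟩
    -- the points coded by words which can, or cannot, be reached from `w` form a separation
    have hsub := hE.subset_left_of_subset_union (hopen fun u => G.Reachable w u)
      (hopen fun u => ¬ G.Reachable w u) ?_ ?_ ⟨y, hyE, w, SimpleGraph.Reachable.refl _, i, h⟩
    · obtain ⟨u, hu, k, hk⟩ := hsub hzE
      exact hu.trans (hreach u w' k j z hk h')
    · rw [Set.disjoint_left]
      rintro t ⟨u, hu, k, hk⟩ ⟨u', hu', k', hk'⟩
      exact hu' (hu.trans (hreach u u' k k' t hk hk'))
    · intro t ht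
      obtain ⟨u, k, hk⟩ := hcodes t ht
      by_cases hu : G.Reachable w u
      · exact Or.inl ⟨u, hu, k, hk⟩
      · exact Or.inr ⟨u, hu, k, hk⟩
  have hdist : ∀ (w w' : Ω) i j, ∀ y ∈ C, ∀ z ∈ C, 𝒟.Codes 𝒱 i w y → 𝒟.Codes 𝒱 j w' z →
      𝒟.wordDist w w' ≤ K₀ * (N * Nat.card ι) := by
    classical
    intro w w' i j y hy z hz h h'
    obtain ⟨p⟩ := hconn w w' i j y hy z hz h h'
    exact (hlen w w' p.bypass).trans
      (Nat.mul_le_mul_left _ ((p.bypass_isPath.length_lt).le.trans hcard'))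
  intro y z i j w w' hw hw' hy hz h h'
  obtain ⟨u, k, hk⟩ := hcodes y ⟨hy, fun hP => h.notMem (by rwa [hw])⟩
  obtain ⟨u', k', hk'⟩ := hcodes z ⟨hz, fun hP => h'.notMem (by rwa [hw'])⟩
  refine (𝒟.wordDist_triangle w u' w').trans (add_le_add ((𝒟.wordDist_triangle w u u').trans
    (add_le_add (hK₀ i k w u y (hw.trans u.2.1.symm) h hk) (hdist u u' k k' y hy z hz hk hk')))
    (hK₀ k' j u' w' z (u'.2.1.trans hw'.symm) hk' h'))

/-- Words of lengths `n` and `n + 1` coding the same point are at uniformly bounded distance: move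
the point, inside components at both levels, to a point over one of finitely many chosen ones. -/
theorem exists_wordDist_le_of_codes_succ : ∃ K : ℕ, ∀ (i j : ι) (w w' : List 𝒟.X) (y : Sphere2),
    w'.length = w.length + 1 → 𝒟.Codes 𝒱 i w y → 𝒟.Codes 𝒱 j w' y → 𝒟.wordDist w w' ≤ K := by
  obtain ⟨K₁, hK₁⟩ := 𝒟.exists_wordDist_le_of_codes_component 𝒱 hf hfin hN h𝒰 h𝒱
  have hloc : ∀ x : Sphere2, ∃ W U U' : Set Sphere2, IsOpen W ∧ IsPreconnected W ∧ x ∈ W ∧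
      U ∈ 𝒰.sets ∧ W ⊆ U ∧ U' ∈ 𝒰.sets ∧ W ⊆ f ⁻¹' U' := by
    intro x
    obtain ⟨U, hU, hxU⟩ := 𝒰.exists_mem x
    obtain ⟨U', hU', hxU'⟩ := 𝒰.exists_mem (f x)
    have ho : IsOpen (U ∩ f ⁻¹' U') :=
      (𝒰.isOpen hU).inter ((𝒰.isOpen hU').preimage hf.continuous)
    have hs := connectedComponentIn_subset (U ∩ f ⁻¹' U') x
    exact ⟨_, U, U', ho.connectedComponentIn, isPreconnected_connectedComponentIn,
      mem_connectedComponentIn ⟨hxU, hxU'⟩, hU, fun t ht => (hs ht).1,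
      hU', fun t ht => (hs ht).2⟩
  choose W U U' hWo hWc hxW hU hWU hU' hWU' using hloc
  have hpre : (f ⁻¹' postcriticalSet f).Finite := hf.finite_preimage_iterate 1 hfin
  have hgen : ∀ x, ∃ q ∈ W x, f q ∉ postcriticalSet f :=
    fun x => (hWo x).exists_notMem_finite ⟨x, hxW x⟩ hpre
  choose q hqW hqP using hgen
  have hqP' : ∀ x, q x ∉ postcriticalSet f := fun x h => hqP x (apply_mem_postcriticalSet h)
  choose i₁ hi₁ using fun x => 𝒱.cover ⟨q x, hqP' x⟩
  choose j₁ hj₁ using fun x => 𝒱.cover ⟨f (q x), hqP x⟩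
  choose K hK using fun x => 𝒟.exists_wordDist_le_of_codes_over (𝒱 := 𝒱) hf hfin (i₁ x) (j₁ x)
    (hqP x)
  obtain ⟨T, -, hT⟩ := isCompact_univ.elim_nhds_subcover W
    fun x _ => (hWo x).mem_nhds (hxW x)
  refine ⟨K₁ + T.sup K + K₁, fun i j w w' y hl h h' => ?_⟩
  obtain ⟨x, hxT, hx⟩ := mem_iUnion₂.1 (hT (mem_univ (f^[w.length] y)))
  set D := connectedComponentIn (f^[w.length] ⁻¹' W x) y with hD
  have hyD : y ∈ D := mem_connectedComponentIn hx
  have hDc : IsPreconnected D := isPreconnected_connectedComponentIn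
  have hDs : D ⊆ f^[w.length] ⁻¹' W x := connectedComponentIn_subset _ _
  obtain ⟨y₁, hy₁, hyq⟩ := (hf.image_component_iterate (hWo x) (hWc x) hx).ge (hqW x)
  have hyq' : f^[w.length + 1] y₁ = f (q x) := by rw [Function.iterate_succ_apply', hyq]
  have hsub : D ⊆ connectedComponentIn (f^[w.length] ⁻¹' U x) y :=
    hDc.subset_connectedComponentIn hyD fun t ht => hWU x (hDs ht)
  have hsub' : D ⊆ connectedComponentIn (f^[w.length + 1] ⁻¹' U' x) y :=
    hDc.subset_connectedComponentIn hyD fun t ht => by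
      rw [mem_preimage, Function.iterate_succ_apply']
      exact hWU' x (hDs ht)
  obtain ⟨w₁, hw₁, h₁⟩ := 𝒟.exists_codes 𝒱 hf (n := w.length) (y := y₁) (i := i₁ x)
    ⟨_, hi₁ x, hyq.symm⟩
  obtain ⟨w₁', hw₁', h₁'⟩ := 𝒟.exists_codes 𝒱 hf (n := w.length + 1) (y := y₁) (i := j₁ x)
    ⟨_, hj₁ x, hyq'.symm⟩
  have e1 := hK₁ (U x) (hU x) _ y y y₁ i (i₁ x) w w₁ rfl hw₁ (hsub hyD) (hsub hy₁) h h₁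
  have e2 := hK₁ (U' x) (hU' x) _ y y₁ y (j₁ x) j w₁' w' hw₁' hl (hsub' hy₁) (hsub' hyD) h₁' h'
  have e3 := hK x w₁ w₁' y₁ (by rw [hw₁, hw₁']) (by rw [hw₁, hyq]) h₁ h₁'
  have e4 : K x ≤ T.sup K := Finset.le_sup hxT
  exact (𝒟.wordDist_triangle w w₁' w').trans (add_le_add ((𝒟.wordDist_triangle w w₁ w₁').trans
    (add_le_add e1 (e3.trans e4))) e2)

end DefiningData

/-! ### From the covering graph back to words -/

namespace DefiningData

variable (𝒟 : DefiningData f) {ι : Type} [Finite ι]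
  (𝒱 : BasedCover (PuncturedSphere f) 𝒟.b ι) (hf : IsBranchedCovering f)
  (hfin : (postcriticalSet f).Finite) {N : ℕ} (hN : ∀ n x, localDegree f^[n] x ≤ N)
  {δ : ℝ} {𝒰 : BallCover (postcriticalSet f) δ} (h𝒰 : 𝒰.IsSmall) (h𝒱 : 𝒱.Refines 𝒰.sets)

variable {𝒟} in
/-- The word `w` codes some point of the set given by a vertex of the covering graph at the level of
`w`; to the root the empty word is assigned. -/
def CodesVertex (w : List 𝒟.X) : CoverVertex f 𝒰.sets → Prop
  | .root => w = []
  | .piece n C _ => w.length = n ∧ ∃ i, ∃ y ∈ C, 𝒟.Codes 𝒱 i w y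

omit [Finite ι] in
include hf in
theorem exists_codes_generic {n : ℕ} {y : Sphere2} (hy : f^[n] y ∉ postcriticalSet f) :
    ∃ i, ∃ w : List 𝒟.X, w.length = n ∧ 𝒟.Codes 𝒱 i w y := by
  obtain ⟨i, hi⟩ := 𝒱.cover ⟨f^[n] y, hy⟩
  exact ⟨i, 𝒟.exists_codes 𝒱 hf (n := n) ⟨_, hi, rfl⟩⟩

theorem isOpen_carrier {P : Set Sphere2} {𝒰 : BallCover P δ} (hf : IsBranchedCovering f)
    (v : CoverVertex f 𝒰.sets) : IsOpen v.carrier := by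
  rcases v with _ | ⟨n, C, U, hU, x, hx, rfl⟩
  · exact isOpen_univ
  · exact ((𝒰.isOpen hU).preimage (hf.continuous.iterate n)).connectedComponentIn

omit [Finite ι] in
include hf hfin in
theorem exists_codesVertex (v : CoverVertex f 𝒰.sets) : ∃ w, CodesVertex 𝒱 w v := by
  have ho := isOpen_carrier hf v
  have hn := v.carrier_nonempty
  rcases v with _ | ⟨n, C, hC⟩
  · exact ⟨[], rfl⟩
  · obtain ⟨y, hy, hyP⟩ := ho.exists_notMem_finite hn (hf.finite_preimage_iterate n hfin)
    obtain ⟨i, w, hw, h⟩ := 𝒟.exists_codes_generic 𝒱 hf hyP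
    exact ⟨w, hw, i, y, hy, h⟩

include hf hfin hN h𝒰 h𝒱

/-- Words coding points of adjacent (or equal) vertices of the covering graph are at bounded
distance: compare both with the words which code a generic common point. -/
theorem exists_wordDist_le_of_codesVertex : ∃ K : ℕ, ∀ (v v' : CoverVertex f 𝒰.sets)
    (w w' : List 𝒟.X), |v.level - v'.level| ≤ 1 → (v.carrier ∩ v'.carrier).Nonempty →
    CodesVertex 𝒱 w v → CodesVertex 𝒱 w' v' → 𝒟.wordDist w w' ≤ K := by
  obtain ⟨K₁, hK₁⟩ := 𝒟.exists_wordDist_le_of_codes_component 𝒱 hf hfin hN h𝒰 h𝒱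
  obtain ⟨K₂, hK₂⟩ := 𝒟.exists_wordDist_le_of_codes_succ 𝒱 hf hfin hN h𝒰 h𝒱
  have hpiece : ∀ (n : ℕ) (C : Set Sphere2), C ∈ pullbackCover f 𝒰.sets n → ∀ y ∈ C, ∀ z ∈ C,
      ∀ (i j : ι) (w w' : List 𝒟.X), w.length = n → w'.length = n → 𝒟.Codes 𝒱 i w y →
      𝒟.Codes 𝒱 j w' z → 𝒟.wordDist w w' ≤ K₁ := by
    rintro n _ ⟨U, hU, x, hx, rfl⟩ y hy z hz i j w w' hw hw' h h'
    exact hK₁ U hU n x y z i j w w' hw hw' hy hz h h'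
  -- the case of neighbouring levels, in the order in which the second level is the larger one
  have hsucc : ∀ (v v' : CoverVertex f 𝒰.sets) (w w' : List 𝒟.X), v'.level = v.level + 1 →
      (v.carrier ∩ v'.carrier).Nonempty → CodesVertex 𝒱 w v → CodesVertex 𝒱 w' v' →
      𝒟.wordDist w w' ≤ K₁ + K₂ + K₁ := by
    intro v v' w w' hl hn h h'
    have ho := (isOpen_carrier hf v).inter (isOpen_carrier hf v')
    rcases v with _ | ⟨n, C, hC⟩ <;> rcases v' with _ | ⟨m, E, hE⟩
    · simp [CoverVertex.level] at hl
    · obtain rfl : m = 0 := by simpa [CoverVertex.level] using hl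
      obtain rfl : w = [] := h
      obtain rfl : w' = [] := List.length_eq_zero_iff.1 h'.1
      simp
    · simp only [CoverVertex.level] at hl; omega
    · obtain rfl : m = n + 1 := by
        simp only [CoverVertex.level] at hl; omega
      obtain ⟨y, ⟨hyC, hyE⟩, hyP⟩ := ho.exists_notMem_finite hn
        (hf.finite_preimage_iterate (n + 1) hfin)
      obtain ⟨i, w₁, hw₁, h₁⟩ := 𝒟.exists_codes_generic 𝒱 hf
        (iterate_notMem_of_le n.le_succ hyP)
      obtain ⟨j, w₁', hw₁', h₁'⟩ := 𝒟.exists_codes_generic 𝒱 hf hyP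
      obtain ⟨hw, k, z, hz, hk⟩ := h
      obtain ⟨hw', k', z', hz', hk'⟩ := h'
      refine (𝒟.wordDist_triangle w w₁' w').trans (add_le_add
        ((𝒟.wordDist_triangle w w₁ w₁').trans (add_le_add ?_ ?_)) ?_)
      · exact hpiece n C hC z hz y hyC k i w w₁ hw hw₁ hk h₁
      · exact hK₂ i j w₁ w₁' y (by rw [hw₁, hw₁']) h₁ h₁'
      · exact hpiece (n + 1) E hE y hyE z' hz' j k' w₁' w' hw₁' hw' h₁' hk'
  refine ⟨K₁ + K₂ + K₁, fun v v' w w' hl hn h h' => ?_⟩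
  rcases lt_trichotomy v.level v'.level with hlt | heq | hgt
  · exact hsucc v v' w w' (by have := (abs_le.1 hl).1; omega) hn h h'
  · have ho := (isOpen_carrier hf v).inter (isOpen_carrier hf v')
    rcases v with _ | ⟨n, C, hC⟩ <;> rcases v' with _ | ⟨m, E, hE⟩
    · obtain rfl : w = [] := h
      obtain rfl : w' = [] := h'
      simp
    · simp only [CoverVertex.level] at heq; omega
    · simp only [CoverVertex.level] at heq; omega
    · obtain rfl : m = n := by simp only [CoverVertex.level] at heq; omega
      obtain ⟨y, ⟨hyC, hyE⟩, hyP⟩ := ho.exists_notMem_finite hn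
        (hf.finite_preimage_iterate m hfin)
      obtain ⟨i, w₁, hw₁, h₁⟩ := 𝒟.exists_codes_generic 𝒱 hf hyP
      obtain ⟨hw, k, z, hz, hk⟩ := h
      obtain ⟨hw', k', z', hz', hk'⟩ := h'
      have e1 := hpiece m C hC z hz y hyC k i w w₁ hw hw₁ hk h₁
      have e2 := hpiece m E hE y hyE z' hz' i k' w₁ w' hw₁ hw' h₁ hk'
      have e3 := 𝒟.wordDist_triangle w w₁ w'
      omega
  · rw [wordDist_comm]
    exact hsucc v' v w' w (by have := (abs_le.1 hl).2; omega) (by rwa [inter_comm]) h' h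

/-- Distances in the selfsimilarity complex are bounded linearly by those in the covering graph:
choosing for every vertex of the covering graph a word which codes a point of it gives a coarse
inverse that is Lipschitz. -/
theorem exists_wordDist_le_dist_toCover {B : Set Sphere2} (hB : B ∈ 𝒰.sets)
    (hb : (𝒟.b : Sphere2) ∈ B) : ∃ A c : ℕ, ∀ w w' : List 𝒟.X, 𝒟.wordDist w w' ≤
      A * (coverSimpleGraph f 𝒰.sets).dist (𝒟.toCover hf hB hb w) (𝒟.toCover hf hB hb w') + c := by
  obtain ⟨A, hA⟩ := 𝒟.exists_wordDist_le_of_codesVertex 𝒱 hf hfin hN h𝒰 h𝒱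
  obtain ⟨K, hK⟩ := 𝒟.exists_wordDist_le_of_codes_Lam 𝒱 hf hfin
  choose θ hθ using fun v : CoverVertex f 𝒰.sets => 𝒟.exists_codesVertex 𝒱 hf hfin v
  have hlip : ∀ v v', 𝒟.wordDist (θ v) (θ v') ≤ A * (coverSimpleGraph f 𝒰.sets).dist v v' :=
    (coverSimpleGraph_connected 𝒰.covers).dist_map_le 𝒟.connected_graph
      fun v v' h => hA v v' _ _ h.2.1 h.2.2 (hθ v) (hθ v')
  have hnear : ∀ w, 𝒟.wordDist w (θ (𝒟.toCover hf hB hb w)) ≤ K + A := by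
    intro w
    obtain ⟨i, w₁, hw₁, h₁⟩ := 𝒟.exists_codes_generic 𝒱 hf (n := w.length) (y := 𝒟.Lam w)
      (by rw [𝒟.iterate_Lam hf]; exact 𝒟.b.2)
    refine (𝒟.wordDist_triangle w w₁ _).trans (add_le_add (hK i w w₁ hw₁.symm h₁) ?_)
    refine hA (𝒟.toCover hf hB hb w) _ w₁ _ (by simp) ?_ ?_ (hθ _)
    · rw [inter_self]; exact CoverVertex.carrier_nonempty _
    · exact ⟨hw₁, i, 𝒟.Lam w, 𝒟.Lam_mem_toCover hf hB hb w, h₁⟩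
  refine ⟨A, (K + A) + (K + A), fun w w' => ?_⟩
  have e1 := hnear w
  have e2 := hnear w'
  have e3 := hlip (𝒟.toCover hf hB hb w) (𝒟.toCover hf hB hb w')
  rw [wordDist_comm] at e2
  have e4 := 𝒟.wordDist_triangle w (θ (𝒟.toCover hf hB hb w)) (θ (𝒟.toCover hf hB hb w'))
  have e5 := 𝒟.wordDist_triangle w (θ (𝒟.toCover hf hB hb w')) w'
  omega

end DefiningData

/-! ### Existence of the covers and of the defining data -/

theorem pathConnectedSpace_puncturedSphere (hfin : (postcriticalSet f).Finite) :
    PathConnectedSpace (PuncturedSphere f) := by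
  have ho : IsOpen (postcriticalSet f)ᶜ := hfin.isClosed.isOpen_compl
  refine isPathConnected_iff_pathConnectedSpace.1
    ((IsOpen.isConnected_iff_isPathConnected ho).1 ⟨?_, ?_⟩)
  · obtain ⟨x, -, hx⟩ := isOpen_univ.exists_notMem_finite univ_nonempty hfin
    exact ⟨x, hx⟩
  · rw [compl_eq_univ_sdiff]
    exact isPreconnected_univ.diff_finite_sphere isOpen_univ hfin

/-- The radii are also taken less than `1`, so that the balls are caps with positive parameter,
which are spherically convex. -/
theorem exists_ballCover {P : Set Sphere2} (hP : P.Finite) {δ : ℝ} (hδ : 0 < δ) :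
    ∃ 𝒰 : BallCover P δ, 𝒰.IsSmall := by
  have hr : ∀ x : Sphere2, ∃ r : ℝ, 0 < r ∧ r < δ ∧ r < 1 ∧ ∀ p ∈ P, p ∈ Metric.ball x r → p = x := by
    intro x
    have ho : IsOpen (P \ {x})ᶜ := hP.sdiff.isClosed.isOpen_compl
    obtain ⟨ε, hε, hb⟩ := Metric.isOpen_iff.1 ho x (by simp)
    have hm : 0 < min ε (min δ 1) := lt_min hε (lt_min hδ one_pos)
    refine ⟨min ε (min δ 1) / 2, half_pos hm, ?_, ?_, fun p hp hpb => ?_⟩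
    · exact (half_lt_self hm).trans_le ((min_le_right _ _).trans (min_le_left _ _))
    · exact (half_lt_self hm).trans_le ((min_le_right _ _).trans (min_le_right _ _))
    · by_contra hne
      exact hb (Metric.ball_subset_ball ((half_lt_self hm).le.trans (min_le_left _ _)) hpb)
        ⟨hp, hne⟩
  choose r hr0 hrδ hr1 hrP using hr
  obtain ⟨T, -, hT⟩ := isCompact_univ.elim_nhds_subcover (fun x => Metric.ball x (r x))
    fun x _ => Metric.ball_mem_nhds x (hr0 x)
  refine ⟨⟨(fun x => Metric.ball x (r x)) '' T, T.finite_toSet.image _, ?_, ?_⟩, ?_⟩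
  · rw [sUnion_image]
    exact univ_subset_iff.1 hT
  · rintro _ ⟨x, -, rfl⟩
    exact ⟨x, r x, hr0 x, hrδ x, rfl, hrP x⟩
  · rintro _ ⟨x, -, rfl⟩
    have h0 := hr0 x
    have h1 := hr1 x
    exact ⟨x, 1 - r x ^ 2 / 2, by nlinarith, by nlinarith [pow_pos h0 2], ball_eq_cap x h0, hrP x⟩

theorem isConvexTrace_empty : IsConvexTrace ∅ :=
  ⟨∅, convex_empty, by simp, by simp, by simp⟩

/-- An open half sphere punctured at its pole is covered by the four half spaces bounded by the
planes through the pole and one of the tangent vectors of a frame. -/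
theorem exists_halfSpace_mem {c x : Sphere2} (F : TangentFrame c)
    (hx : 0 < inner ℝ (c : Space3) (x : Space3)) (hne : x ≠ c) :
    ∃ s t : Bool,
      0 < inner ℝ ((if s then (1 : ℝ) else -1) • (if t then F.u else F.v)) (x : Space3) := by
  have h : inner ℝ F.u (x : Space3) ≠ 0 ∨ inner ℝ F.v (x : Space3) ≠ 0 := by
    by_contra! h
    have h1 := F.expand (x : Space3)
    rw [h.1, h.2, zero_smul, zero_smul, add_zero, add_zero] at h1
    have h2 := congrArg norm h1
    rw [norm_smul, c.norm_coe, x.norm_coe, Real.norm_of_nonneg hx.le, mul_one] at h2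
    rw [← h2, one_smul] at h1
    exact hne (Subtype.ext h1)
  rcases h with h | h <;> rcases h.lt_or_gt with h | h
  · exact ⟨false, true, by simpa [real_inner_smul_left] using h⟩
  · exact ⟨true, true, by simpa [real_inner_smul_left] using h⟩
  · exact ⟨false, false, by simpa [real_inner_smul_left] using h⟩
  · exact ⟨true, false, by simpa [real_inner_smul_left] using h⟩

/-- The elements of the cover whose centres are not postcritical, together with the half caps of
all elements, form a based cover of the punctured sphere. -/
theorem BallCover.exists_basedCover_refines [PathConnectedSpace (PuncturedSphere f)] {δ : ℝ}
    {𝒰 : BallCover (postcriticalSet f) δ} (h𝒰 : 𝒰.IsSmall) (b : PuncturedSphere f) :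
    ∃ (ι : Type) (_ : Finite ι) (𝒱 : BasedCover (PuncturedSphere f) b ι), 𝒱.Refines 𝒰.sets := by
  have := 𝒰.finite.to_subtype
  choose c a ha ha' hU hc using fun U : 𝒰.sets => h𝒰 U U.2
  let F : ∀ U : 𝒰.sets, TangentFrame (c U) := fun U => Classical.arbitrary _
  let w : 𝒰.sets → Bool × Bool → Space3 := fun U st =>
    (if st.1 then (1 : ℝ) else -1) • (if st.2 then (F U).u else (F U).v)
  have hw : ∀ U st, inner ℝ (w U st) (c U : Space3) = 0 := by
    rintro U ⟨s, t⟩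
    have h1 := (F U).inner_pu
    have h2 := (F U).inner_pv
    rw [real_inner_comm] at h1 h2
    cases s <;> cases t <;> simp [w, h1, h2]
  -- the set with index `(U, none)` is `U`, or empty if the centre of `U` is postcritical
  let V : 𝒰.sets × Option (Bool × Bool) → Set Sphere2
    | (U, none) => U ∩ {_x | c U ∉ postcriticalSet f}
    | (U, some st) => U ∩ {x : Sphere2 | 0 < inner ℝ (w U st) (x : Space3)}
  have hVU : ∀ U o, V (U, o) ⊆ U := by
    rintro U (_ | st) x hx
    · exact hx.1
    · exact hx.1
  have hUc : ∀ U : 𝒰.sets, IsConvexTrace (U : Set Sphere2) := by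
    intro U
    rw [hU U]
    exact isConvexTrace_cap _ (ha U).le
  have hcov : ∀ (U : 𝒰.sets), ∀ x ∈ (U : Set Sphere2), x ∉ postcriticalSet f →
      ∃ o, x ∈ V (U, o) := by
    intro U x hxU hxP
    by_cases hcP : c U ∈ postcriticalSet f
    · have hx' : x ∈ cap (c U) (a U) := by rw [← hU U]; exact hxU
      obtain ⟨s, t, h⟩ := exists_halfSpace_mem (F U) ((ha U).trans hx') fun h => hxP (h ▸ hcP)
      exact ⟨some (s, t), hxU, h⟩
    · exact ⟨none, hxU, hcP⟩
  have key : ∃ 𝒱 : BasedCover (PuncturedSphere f) b (𝒰.sets × Option (Bool × Bool)),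
      ∀ i, 𝒱.V i = Subtype.val ⁻¹' V i := by
    refine exists_basedCover b V ?_ ?_ ?_ ?_
    · rintro ⟨U, _ | st⟩
      · exact (𝒰.isOpen U.2).inter isOpen_const
      · exact (𝒰.isOpen U.2).inter (isOpen_lt continuous_const (by fun_prop))
    · rintro ⟨U, _ | st⟩
      · by_cases h : c U ∈ postcriticalSet f
        · have : V (U, none) = ∅ := by
            ext x; simp [V, h]
          rw [this]
          exact isConvexTrace_empty
        · have : V (U, none) = U := by
            ext x; simp [V, h]
          rw [this]
          exact hUc U
      · exact (hUc U).inter (isConvexTrace_halfSpace _)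
    · rintro ⟨U, o⟩ x hx hxP
      have hxc := hc U x hxP (hVU U o hx)
      rcases o with _ | st
      · exact hx.2 (hxc ▸ hxP)
      · have h1 : 0 < inner ℝ (w U st) (x : Space3) := hx.2
        rw [hxc, hw] at h1
        exact lt_irrefl _ h1
    · intro x hxP
      obtain ⟨U, hUs, hxU⟩ := 𝒰.exists_mem x
      obtain ⟨o, ho⟩ := hcov ⟨U, hUs⟩ x hxU hxP
      exact ⟨_, ho⟩
  obtain ⟨𝒱, h𝒱⟩ := key
  refine ⟨_, inferInstance, 𝒱, fun U hUs v hv => ?_⟩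
  obtain ⟨o, ho⟩ := hcov ⟨U, hUs⟩ v hv v.2
  refine ⟨(⟨U, hUs⟩, o), by rw [h𝒱]; exact ho, ?_⟩
  rw [h𝒱]
  exact (image_preimage_subset _ _).trans (hVU _ _)

/-- A finite set of generators of the fundamental group can be completed to defining data. -/
theorem exists_definingData [PathConnectedSpace (PuncturedSphere f)] (hf : IsBranchedCovering f)
    {b : PuncturedSphere f} {S : Set (FundamentalGroup (PuncturedSphere f) b)} (hS : S.Finite)
    (hS' : Subgroup.closure S = ⊤) : ∃ 𝒟 : DefiningData f, 𝒟.b = b := by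
  have hx : ∀ x : f ⁻¹' {(b : Sphere2)}, (x : Sphere2) ∉ postcriticalSet f := fun x h =>
    b.2 ((show f x = b from x.2) ▸ apply_mem_postcriticalSet h)
  have hrep : ∀ s : OrbifoldGroup f b, ∃ γ : Path b b, loopClass f b γ = s := by
    intro s
    obtain ⟨g, rfl⟩ := QuotientGroup.mk_surjective s
    obtain ⟨γ, rfl⟩ := Path.Homotopic.Quotient.mk_surjective g
    exact ⟨γ, rfl⟩
  choose γ hγ using hrep
  exact ⟨{  b := b
            X := f ⁻¹' {(b : Sphere2)}
            finite_X := (hf.finite_fiber 1 b).to_subtype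
            code := Equiv.refl _
            arc := fun x => (PathConnectedSpace.somePath b ⟨x, hx x⟩).map continuous_subtype_val
            arc_notMem := fun x t => (PathConnectedSpace.somePath b ⟨x, hx x⟩ t).2
            S := QuotientGroup.mk' (orbifoldRelations f b) '' S
            finite_S := hS.image _
            generates := by
              rw [← MonoidHom.map_closure, hS', ← MonoidHom.range_eq_map]
              exact MonoidHom.range_eq_top.2 (QuotientGroup.mk'_surjective _)
            loop := fun s => γ s
            loop_class := fun s => hγ s }, rfl⟩

/-! ### The quasi-isometry -/

namespace DefiningData

variable (𝒟 : DefiningData f)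

/-- The word at which an edge of the selfsimilarity complex is based: `w` for the edges joining `w`
to `s.w` or to `xw`. -/
def baseWord (d : 𝒟.complex.D) : List 𝒟.X := Sum.elim Prod.snd Prod.snd d.1

/-- A vertex is sent to itself, an interior point of an edge to the word at which the edge is
based. -/
def nearWord : 𝒟.complex.Point → List 𝒟.X :=
  Sum.elim id (Quot.lift (fun p => 𝒟.baseWord p.1) (by
    rintro ⟨d, t⟩ ⟨d', t'⟩ ⟨h, -⟩
    obtain rfl : d' = 𝒟.complex.rev d := h
    rfl))

/-- The word assigned to a point is an end of an edge on which the point lies. -/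
theorem exists_at_nearWord (p : 𝒟.complex.Point) :
    ∃ s, OneComplex.At p (𝒟.nearWord p : 𝒟.complex.V) s := by
  rcases p with w | e
  · exact ⟨0, OneComplex.at_vertex w⟩
  · induction e using Quot.ind with
    | mk q =>
      obtain ⟨⟨e, o⟩, t⟩ := q
      have hsrc : 𝒟.complex.src (e, true) = 𝒟.baseWord (e, o) := by
        rcases e with ⟨s, w⟩ | ⟨x, w⟩ <;> rfl
      cases o with
      | true => exact ⟨t, Or.inr ⟨(e, true), t, rfl, hsrc, rfl⟩⟩
      | false =>
        refine ⟨1 - t, Or.inr ⟨(e, true), ⟨1 - t, by linarith [t.2.2], by linarith [t.2.1]⟩, ?_,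
          hsrc, rfl⟩⟩
        exact congrArg Sum.inr (Quot.sound ⟨rfl, rfl⟩)

theorem nearWord_incl (A : 𝒟.complex.V → Prop) (p : (𝒟.complex.full A).Point) :
    A (𝒟.nearWord ((𝒟.complex.incl A).map p)) := by
  rcases p with w | e
  · exact w.2
  · induction e using Quot.ind with
    | mk q =>
      obtain ⟨⟨⟨⟨s, w⟩ | ⟨x, w⟩, _ | _⟩, h1, h2⟩, t⟩ := q
      · exact h2
      · exact h1
      · exact h2
      · exact h1

theorem nearWord_shift (p : 𝒟.complex'.Point) : 𝒟.nearWord (𝒟.shift.map p) =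
    (𝒟.nearWord ((𝒟.complex.incl fun w => 1 ≤ 𝒟.level w).map p)).dropLast := by
  rcases p with w | e
  · rfl
  · induction e using Quot.ind with
    | mk q => obtain ⟨⟨⟨⟨s, w⟩ | ⟨x, w⟩, o⟩, h⟩, t⟩ := q <;> rfl

end DefiningData


theorem mainTheorem3 (f : Sphere2 → Sphere2) (hf : IsThurstonMap f)
    (hper : ∀ x ∈ criticalPoints f, ∀ n : ℕ, 0 < n → f^[n] x ≠ x) (δ : ℝ) (hδ : 0 < δ) :
    ∃ (𝒟 : DefiningData f) (𝒰 : BallCover (postcriticalSet f) δ)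
      (Φ : 𝒟.complex.Point → (coverComplex f 𝒰.sets).Point),
      OneComplex.IsQuasiIsometry Φ ∧
      (∀ n : ℕ, ∀ p ∈ range (𝒟.complex.incl fun w => 𝒟.level w = n).map,
        Φ p ∈ range ((coverComplex f 𝒰.sets).incl fun v => CoverVertex.level v = n).map) ∧
      (∀ w : List 𝒟.X, ∃ v : CoverVertex f 𝒰.sets,
        Φ (OneComplex.vertex w) = OneComplex.vertex v ∧ 𝒟.Lam w ∈ v.carrier) ∧
      ∀ p : 𝒟.complex'.Point, ∃ q : (coverComplex' f 𝒰.sets).Point,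
        (OneComplex.incl _ _).map q = Φ ((OneComplex.incl _ _).map p) ∧
        (coverShift hf.branched 𝒰).map q = Φ (𝒟.shift.map p) := by
  have hpc := pathConnectedSpace_puncturedSphere hf.finite
  obtain ⟨𝒰, h𝒰⟩ := exists_ballCover hf.finite hδ
  -- a based cover is used twice: its transitions generate the fundamental group, which gives the
  -- defining data, and the second one, at the base point of the data, codes points by words
  obtain ⟨b₀⟩ := hpc.nonempty
  obtain ⟨ι₀, hι₀, 𝒱₀, -⟩ := BallCover.exists_basedCover_refines h𝒰 b₀
  obtain ⟨𝒟, -⟩ := exists_definingData hf.branched 𝒱₀.finite_generators 𝒱₀.closure_generators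
  obtain ⟨ι, hι, 𝒱, h𝒱⟩ := BallCover.exists_basedCover_refines h𝒰 𝒟.b
  obtain ⟨N, hN⟩ := hf.branched.exists_localDegree_iterate_le hper
  obtain ⟨B, hB, hb⟩ := 𝒰.exists_mem (𝒟.b : Sphere2)
  let φ : List 𝒟.X → CoverVertex f 𝒰.sets := 𝒟.toCover hf.branched hB hb
  let Φ : 𝒟.complex.Point → (coverComplex f 𝒰.sets).Point :=
    fun p => OneComplex.vertex (φ (𝒟.nearWord p) : (coverComplex f 𝒰.sets).V)
  refine ⟨𝒟, 𝒰, Φ, ?_, ?_, fun w => ⟨φ w, rfl, 𝒟.Lam_mem_toCover hf.branched hB hb w⟩, ?_⟩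
  · obtain ⟨A, hA⟩ := 𝒟.exists_dist_toCover_le hf.branched hB hb
    obtain ⟨A', c, hA'⟩ :=
      𝒟.exists_wordDist_le_dist_toCover 𝒱 hf.branched hf.finite hN h𝒰 h𝒱 hB hb
    obtain ⟨C, hC⟩ := 𝒟.exists_dist_le_toCover hf.branched hB hb hf.finite h𝒰
    have hG := coverComplex_graph (f := f) 𝒰.sets
    refine OneComplex.isQuasiIsometry_of_vertices (L := coverComplex f 𝒰.sets) (φ := φ) (A := A) (A' := A') (c := c) (B := C)
      𝒟.connected_graph (by rw [hG]; exact coverSimpleGraph_connected 𝒰.covers) (fun p => ?_)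
      (fun w w' h => by rw [hG]; exact hA w w' h) (fun w w' => by rw [hG]; exact hA' w w')
      (fun v => by rw [hG]; exact hC v)
    obtain ⟨s, hs⟩ := 𝒟.exists_at_nearWord p
    exact ⟨_, s, hs, rfl⟩
  · rintro n _ ⟨p, rfl⟩
    exact ⟨OneComplex.vertex ⟨φ (𝒟.nearWord ((𝒟.complex.incl _).map p)),
      𝒟.nearWord_incl (fun w => 𝒟.level w = n) p⟩, rfl⟩
  · intro p
    have hl := 𝒟.nearWord_incl (fun w => 1 ≤ 𝒟.level w) p
    refine ⟨OneComplex.vertex ⟨φ (𝒟.nearWord ((𝒟.complex.incl _).map p)), hl⟩, rfl, ?_⟩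
    have hne : 𝒟.nearWord ((𝒟.complex.incl fun w => 1 ≤ 𝒟.level w).map p) ≠ [] := by
      intro h
      rw [h] at hl
      simp [DefiningData.level] at hl
    have h := 𝒟.coverImage_toCover hf.branched hB hb _ hne
    rw [← 𝒟.nearWord_shift p] at h
    exact congrArg Sum.inl h
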